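/- **Improved phase estimation.** *Setting.* Let $U=\sum_j e^{2\pi i\lambda_j}|\psi_j\rangle\langle\psi_j|$ be a unitary on $\mathbb C^d$, with $(\psi_j)$ an orthonormal basis and $\lambda_j\in[0,1)$. For $n\ge 1$ and $\alpha\in(0,1)$, it satisfies an *$(n,\alpha)$-rounding promise* if $\lambda_j\notin\left[\frac{x}{2^n},\frac{x}{2^n}+\frac{\alpha}{2^n}\right]$ for all $j$ and all $x\in\{0,\dots,2^n\}$. Write $\mathrm{bit}_k(\lambda_j)$ for the $(k+1)$-th least significant bit of the $n$-bit integer $\lfloor 2^n\lambda_j\rfloor$, and $|\Delta_k\rangle$ for the $k$-qubit register that holds its $k$ least significant bits. Circuits consist of one- and two-qubit gates and of controlled calls to $U$ and $U^\dagger$, act on the stated registers only (no ancillae), and do not depend on $U$ or $d$. The query complexity is the number of calls to $U$ and $U^\dagger$. Closeness of maps refers to the diamond norm $|\Lambda|_\diamond=\sup_\rho|(\Lambda\otimes\mathcal I)(\rho)|_1$ of the difference of the induced channels, with $\rho$ ranging over density matrices on the system together with a finite-dimensional reference system. A *coherent iterative phase estimator with phases* assigns to every $n\ge1$, $\alpha\in(0,1)$,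 $k\in\{0,\dots,n-1\}$ and $\delta>0$ a circuit which, for every $U$ satisfying an $(n,\alpha)$-rounding promise, is $\delta$-close to some unitary that maps $|0\rangle|\Delta_k\rangle|\psi_j\rangle\mapsto e^{i\varphi_j}|\mathrm{bit}_k(\lambda_j)\rangle|\Delta_k\rangle|\psi_j\rangle$ for all $j$, for some real phases $\varphi_j$. A *phase estimator with phases* assigns to every $n\ge1$, $\alpha\in(0,1)$ and $\delta>0$ a circuit which, for every $U$ satisfying an $(n,\alpha)$-rounding promise, is $\delta$-close to the map $|0^n\rangle|\psi_j\rangle\mapsto e^{i\varphi_j}|\lfloor 2^n\lambda_j\rfloor\rangle|\psi_j\rangle$ for some real phases $\varphi_j$. *Statement.* There is a coherent iterative phase estimator with phases with the following properties. Its query complexity for bit $k$ is at most $C\,2^{n-k}\eta_k^{-1}\log(\delta^{-1})$ for all $\delta\le\frac12$, where $C$ is an absolute constant, $\eta_0=\frac\alpha2$, and $\eta_k=\frac12-\frac1{2^k}\left(\frac12+\frac\alpha2\right)$ for $k\ge1$. For $n$, $\alpha$, $\delta$, chain its circuits for $k=0,1,\dots,n-1$, the $k$-th one run with error target $\delta\,2^{-k-1}$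 on the $k$ bits already computed and one fresh output qubit. Then: 1. The chained circuits form a phase estimator with phases. 2. For every $c>0$ there is a constant $C_c$ such that for all $n\ge1$, $0<\alpha\le1-c$ and $0<\delta\le 1-c$ the chained circuit has query complexity at most $C_c\,2^n\alpha^{-1}\log(\delta^{-1})$. 3. No rounding promise is needed for the following. For all $n\ge1$, $\alpha\in(0,1)$, $\delta>0$ and every unitary $U=\sum_j e^{2\pi i\lambda_j}|\psi_j\rangle\langle\psi_j|$ as above, the same chained circuit is $\delta$-close in diamond norm to a map $$|0^n\rangle|\psi_j\rangle\mapsto\left(\xi_j|\lfloor2^n\lambda_j\rfloor\rangle+\zeta_j|\lambda_j'\rangle\right)|\psi_j\rangle,\qquad \lambda_j'=\lfloor2^n\lambda_j\rfloor-1\bmod 2^n,$$ for some complex amplitudes with $|\xi_j|^2+|\zeta_j|^2=1$. -/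

import Mathlib

open Matrix
open scoped ComplexOrder

noncomputable section

namespace QPE

/-! ### Trace norm, diamond norm -/

/-- The trace norm of a square matrix: the sum of its singular values, that is, of the square roots
of the eigenvalues of `Mᴴ * M`. -/
def traceNorm {m : Type*} [Fintype m] [DecidableEq m] (M : Matrix m m ℂ) : ℝ :=
  ∑ i, Real.sqrt ((isHermitian_conjTranspose_mul_self M).eigenvalues i)

/-- Density matrices. -/
def IsDensity {m : Type*} [Fintype m] (ρ : Matrix m m ℂ) : Prop :=
  ρ.PosSemidef ∧ ρ.trace = 1

/-- `(Φ ⊗ id) X`, where `id` is the identity superoperator on a reference system with basis `r`. -/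
def tensorId {m p : Type*} (r : Type*)
    (Φ : Matrix m m ℂ →ₗ[ℂ] Matrix p p ℂ) (X : Matrix (m × r) (m × r) ℂ) :
    Matrix (p × r) (p × r) ℂ :=
  Matrix.of fun a b => Φ (Matrix.of fun i j => X (i, a.2) (j, b.2)) a.1 b.1

/-- The diamond norm: the supremum of the trace norm of `(Φ ⊗ id) ρ` over all density matrices `ρ`
on the system together with a reference system of any finite dimension `k`. -/
def diamondNorm {m p : Type*} [Fintype m] [Fintype p] [DecidableEq p]
    (Φ : Matrix m m ℂ →ₗ[ℂ] Matrix p p ℂ) : ENNReal :=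
  ⨆ (k : ℕ) (ρ : Matrix (m × Fin k) (m × Fin k) ℂ) (_ : IsDensity ρ),
    ENNReal.ofReal (traceNorm (tensorId (Fin k) Φ ρ))

/-- The superoperator `ρ ↦ W ρ W†`. -/
def conjMap {m p : Type*} [Fintype m] (W : Matrix p m ℂ) :
    Matrix m m ℂ →ₗ[ℂ] Matrix p p ℂ where
  toFun ρ := W * ρ * Wᴴ
  map_add' ρ σ := by rw [Matrix.mul_add, Matrix.add_mul]
  map_smul' c ρ := by simp

/-! ### Ancilla-free circuits with oracle access: no qubits beyond the input and output registers,
and no qubits are discarded -/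

/-- Computational basis labels of an `n`-qubit register; `false` labels `|0⟩`, `true` labels `|1⟩`. -/
abbrev Reg (n : ℕ) : Type := Fin n → Bool

/-- Elementary operations on an `n`-qubit register and the system on which the oracle acts. -/
inductive Gate (n : ℕ) : Type
  /-- A one-qubit unitary on qubit `q`. -/
  | one (q : Fin n) (g : Matrix.unitaryGroup Bool ℂ) : Gate n
  /-- A two-qubit unitary on the distinct qubits `p`, `q`. -/
  | two (p q : Fin n) (hpq : p ≠ q) (g : Matrix.unitaryGroup (Bool × Bool) ℂ) : Gate n
  /-- A call to the oracle `U`, controlled on qubit `q`. -/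
  | query (q : Fin n) : Gate n
  /-- A call to `U†`, controlled on qubit `q`. -/
  | queryInv (q : Fin n) : Gate n

/-- A circuit, the gates being applied from the head of the list on. -/
abbrev Circuit (n : ℕ) : Type := List (Gate n)

/-- Controlled-`U` with control qubit `q`. -/
def controlled {n : ℕ} {ι : Type*} [DecidableEq ι] (q : Fin n) (U : Matrix ι ι ℂ) :
    Matrix (Reg n × ι) (Reg n × ι) ℂ :=
  Matrix.of fun a b =>
    if a.1 = b.1 then (if a.1 q = true then U a.2 b.2 else (1 : Matrix ι ι ℂ) a.2 b.2) else 0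

/-- The matrix of a gate when the oracle is `U`. -/
def Gate.eval {n : ℕ} {ι : Type*} [DecidableEq ι] (U : Matrix ι ι ℂ) :
    Gate n → Matrix (Reg n × ι) (Reg n × ι) ℂ
  | .one q g => Matrix.of fun a b =>
      if (∀ r, r ≠ q → a.1 r = b.1 r) ∧ a.2 = b.2 then g.1 (a.1 q) (b.1 q) else 0
  | .two p q _ g => Matrix.of fun a b =>
      if (∀ r, r ≠ p → r ≠ q → a.1 r = b.1 r) ∧ a.2 = b.2 then
        g.1 (a.1 p, a.1 q) (b.1 p, b.1 q) else 0
  | .query q => controlled q U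
  | .queryInv q => controlled q Uᴴ

/-- The matrix implemented by a circuit when the oracle is `U`. -/
def Circuit.eval {n : ℕ} {ι : Type*} [Fintype ι] [DecidableEq ι] (U : Matrix ι ι ℂ) :
    Circuit n → Matrix (Reg n × ι) (Reg n × ι) ℂ
  | [] => 1
  | g :: c => Circuit.eval U c * g.eval U

/-- Number of oracle calls made by a gate. -/
def Gate.queries {n : ℕ} : Gate n → ℕ
  | .one _ _ => 0
  | .two _ _ _ _ => 0
  | .query _ => 1
  | .queryInv _ => 1

/-- Number of calls to `U` or `U†` in a circuit. -/
def Circuit.queries {n : ℕ} (c : Circuit n) : ℕ := (c.map Gate.queries).sum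

/-- Run a gate on the qubits `f 0, …, f (m - 1)` of a larger register. -/
def Gate.onQubits {m n : ℕ} (f : Fin m ↪ Fin n) : Gate m → Gate n
  | .one q g => .one (f q) g
  | .two p q h g => .two (f p) (f q) (fun e => h (f.injective e)) g
  | .query q => .query (f q)
  | .queryInv q => .queryInv (f q)

/-- Run a circuit on the qubits `f 0, …, f (m - 1)` of a larger register. -/
def Circuit.onQubits {m n : ℕ} (f : Fin m ↪ Fin n) (c : Circuit m) : Circuit n :=
  c.map (Gate.onQubits f)

/-! ### Kets, phases, rounding promise -/

/-- The binary encoding of `x` in `n` qubits; qubit `k` holds the `(k+1)`-th least significant bit. -/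
def bits (n x : ℕ) : Reg n := fun k => x.testBit k

/-- The computational basis vector `|x⟩`. -/
def ket {n : ℕ} (x : Reg n) : Reg n → ℂ := Pi.single x 1

/-- The tensor product of two vectors. -/
def tensor {p ι : Type*} (v : p → ℂ) (w : ι → ℂ) : p × ι → ℂ := fun a => v a.1 * w a.2

/-- `U = ∑ j, exp (2πi lam j) |ψ j⟩⟨ψ j|` for an orthonormal basis `ψ` and phases in `[0, 1)`. -/
def IsPhaseDecomposition {d : ℕ} (U : Matrix (Fin d) (Fin d) ℂ) (lam : Fin d → ℝ)
    (ψ : OrthonormalBasis (Fin d) ℂ (EuclideanSpace ℂ (Fin d))) : Prop :=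
  (∀ j, 0 ≤ lam j ∧ lam j < 1) ∧
    U = ∑ j, Complex.exp (2 * Real.pi * Complex.I * lam j) •
      Matrix.vecMulVec (ψ j).ofLp (star (ψ j).ofLp)

/-- The condition that an `(n, α)`-rounding promise puts on the phases. -/
def RoundingPromise {d : ℕ} (n : ℕ) (α : ℝ) (lam : Fin d → ℝ) : Prop :=
  ∀ j, ∀ x : ℕ, x ≤ 2 ^ n →
    lam j ∉ Set.Icc ((x : ℝ) / 2 ^ n) ((x : ℝ) / 2 ^ n + α / 2 ^ n)

/-- The `n`-bit estimate `floor (2 ^ n * l)` of a phase `l ∈ [0, 1)`. -/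
def estimate (n : ℕ) (l : ℝ) : ℕ := ⌊(2 : ℝ) ^ n * l⌋₊

/-! ### Estimators -/

/-- The map `|0ⁿ⟩|φ⟩ ↦ c (|0ⁿ⟩|φ⟩)` implemented by a circuit whose register is initialized to
`|0ⁿ⟩`, as a matrix acting on `|φ⟩`. -/
def Circuit.isometry {n d : ℕ} (U : Matrix (Fin d) (Fin d) ℂ) (c : Circuit n) :
    Matrix (Reg n × Fin d) (Fin d) ℂ :=
  (c.eval U).submatrix id fun i => (fun _ => false, i)

/-- The linear map `|0ⁿ⟩|ψ j⟩ ↦ v j ⊗ |ψ j⟩`, as a matrix acting on the second register. -/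
def targetMap {n d : ℕ} (ψ : OrthonormalBasis (Fin d) ℂ (EuclideanSpace ℂ (Fin d)))
    (v : Fin d → Reg n → ℂ) : Matrix (Reg n × Fin d) (Fin d) ℂ :=
  ∑ j, Matrix.vecMulVec (tensor (v j) (ψ j).ofLp) (star (ψ j).ofLp)

/-- A protocol yields a circuit on `n` qubits from `n`, `α` and the error target `δ`. The circuit
does not depend on the oracle. -/
abbrev Protocol : Type := (n : ℕ) → (α : ℝ) → (δ : ℝ) → Circuit n

/-- `P` is a phase estimator with phases (and without garbage). -/
def IsPhaseEstimatorWithPhases (P : Protocol) : Prop :=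
  ∀ (n : ℕ) (α δ : ℝ), 1 ≤ n → 0 < α → α < 1 → 0 < δ →
    ∀ (d : ℕ) (U : Matrix (Fin d) (Fin d) ℂ) (lam : Fin d → ℝ)
      (ψ : OrthonormalBasis (Fin d) ℂ (EuclideanSpace ℂ (Fin d))),
      IsPhaseDecomposition U lam ψ → RoundingPromise n α lam →
      ∃ φ : Fin d → ℝ,
        diamondNorm (conjMap ((P n α δ).isometry U) -
          conjMap (targetMap ψ fun j =>
            Complex.exp (Complex.I * φ j) • ket (bits n (estimate n (lam j))))) ≤
        ENNReal.ofReal δ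

/-- An iterative protocol yields, from `n`, `α`, the position `k` of a bit and the error target `δ`,
a circuit on `k + 1` qubits: the qubits `0, …, k - 1` hold the `k` least significant bits of the
estimate, and qubit `k` receives the new bit. -/
abbrev IterativeProtocol : Type := (n : ℕ) → (α : ℝ) → (k : ℕ) → (δ : ℝ) → Circuit (k + 1)

/-- `E` is a coherent iterative phase estimator with phases (and without garbage): its circuit is
`δ`-close to some map `T` with `|0⟩|Δₖ⟩|ψ j⟩ ↦ exp (i φ j) |bitₖ (lam j)⟩|Δₖ⟩|ψ j⟩`, where `Δₖ`
consists of the `k` least significant bits of the estimate; on other inputs `T` is arbitrary. -/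
def IsIterativePhaseEstimatorWithPhases (E : IterativeProtocol) : Prop :=
  ∀ (n : ℕ) (α : ℝ) (k : ℕ) (δ : ℝ), 0 < α → α < 1 → k < n → 0 < δ →
    ∀ (d : ℕ) (U : Matrix (Fin d) (Fin d) ℂ) (lam : Fin d → ℝ)
      (ψ : OrthonormalBasis (Fin d) ℂ (EuclideanSpace ℂ (Fin d))),
      IsPhaseDecomposition U lam ψ → RoundingPromise n α lam →
      ∃ (φ : Fin d → ℝ) (T : Matrix.unitaryGroup (Reg (k + 1) × Fin d) ℂ),
        (∀ j,
          T.1 *ᵥ tensor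
              (ket (Fin.snoc (α := fun _ => Bool) (bits k (estimate n (lam j))) false))
              (ψ j).ofLp =
            Complex.exp (Complex.I * φ j) •
              tensor
                (ket (Fin.snoc (α := fun _ => Bool) (bits k (estimate n (lam j)))
                  ((estimate n (lam j)).testBit k)))
                (ψ j).ofLp) ∧
        diamondNorm (conjMap ((E n α k δ).eval U) - conjMap T.1) ≤ ENNReal.ofReal δ

/-- The non-iterative protocol that runs the iterative circuits for `k = 0, …, n - 1` one after the
other, the `k`-th one on the qubits `0, …, k` and with error target `δ * 2 ^ (-k-1)`. -/
def stitch (E : IterativeProtocol) : Protocol := fun n α δ =>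
  (List.finRange n).flatMap fun k : Fin n =>
    Circuit.onQubits (Fin.castLEEmb k.isLt) (E n α k (δ / 2 ^ ((k : ℕ) + 1)))

/-- The amplification gap `η` of the `k`-th bit. -/
def ampGap (α : ℝ) (k : ℕ) : ℝ :=
  if k = 0 then α / 2 else 1 / 2 - 1 / 2 ^ k * (1 / 2 + α / 2)

end QPE

end

namespace QPE

set_option linter.unusedSectionVars false

/-! ### Fejér–Riesz factorisation, and complementary polynomials as one-qubit gate sequences. -/

section UnitCircle

/-! ### Polynomials on the unit circle -/

open Polynomial ComplexConjugate

/-! On an eigenvector the oracle is a scalar, so a circuit acts on the register alone. Write `2 ^ n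
* λ = M + f` with `M` the estimate. A controlled `U ^ (2 ^ (n - 1 - k))`, corrected by the phase
known from the `k` lower bits and by a fixed shift, is the signal `(-1) ^ bit_k * exp (i π (f - (1 +
α) / 2) / 2 ^ k)` (`signalValue_eq`). Its real part has the sign given by the bit and modulus at
least `2 η_k` (`signalValue_re`). For `k = 0` this uses `α ≤ f ≤ 1`, which the promise supplies; for
`k ≥ 1` every `f` in `[0, 1 + α]` will do.

The sign is read off by one-qubit signal processing. If `|P z|² + |P (-z)|² = 1` on the unit circle,
then fixed gates interleaved with signals prepare a qubit with amplitudes `P z`, `P (-z)`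
(`exists_process_eq`). If moreover `|P| ≤ ε` for `Re z ≤ -2η`, this qubit is the bit up to phase and
small error, so there is no garbage to uncompute. Such a `P` of degree `O(η⁻¹ log ε⁻¹)` comes from a
sum of rotated kernels and Fejér–Riesz (`exists_halfBand`).

Without a promise, suppose `f < α`. For all `k ≥ 1` both readings `M + f` and `(M - 1) + (f + 1)`
are admissible, modulo `2 ^ n`. The two candidates differ in bit `0`, so whatever step `0` produces
is a superposition of their first bits, and by linearity the later steps complete each branch
(`exists_amplitudes`).

All maps are block diagonal in the eigenbasis, so the diamond distance is controlled by the worst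
single eigenvector (`opNorm_targetMap_le`, `diamondNorm_conjMap_sub_le`). Errors `δ / 2 ^ (k + 1)`
sum to `δ`, while the costs carry weights `(k + 1) / 2 ^ k`, whose sum is bounded
(`queries_stitch_le`). -/

theorem infinite_unitCircle : {z : ℂ | ‖z‖ = 1}.Infinite := by
  have h : IsPreconnected (Metric.sphere (0 : ℂ) 1) :=
    isPreconnected_sphere (by rw [Complex.rank_real_complex]; norm_num) 0 1
  have h2 := h.infinite_of_nontrivial ⟨1, by simp, -1, by simp, by norm_num⟩
  refine h2.mono fun z hz => ?_
  simpa using hz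

theorem poly_eq_of_unitCircle {p q : ℂ[X]} (h : ∀ z : ℂ, ‖z‖ = 1 → p.eval z = q.eval z) : p = q :=
  eq_of_infinite_eval_eq p q (infinite_unitCircle.mono fun z hz => h z hz)

theorem conj_eq_inv_of_norm_one {z : ℂ} (hz : ‖z‖ = 1) : conj z = z⁻¹ := by
  rw [Complex.inv_def, Complex.normSq_eq_norm_sq, hz]; simp

theorem mul_conj_of_norm_one {z : ℂ} (hz : ‖z‖ = 1) : z * conj z = 1 := by
  rw [Complex.mul_conj, Complex.normSq_eq_norm_sq, hz]; simp

/-- The polynomial that agrees with `z ^ N * conj (p z)` on the unit circle. -/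
noncomputable def conjReflect (N : ℕ) (p : ℂ[X]) : ℂ[X] := (p.map (starRingEnd ℂ)).reflect N

/-- Needed off the circle as well: it shows that the nonzero roots of a self-reciprocal polynomial
come in mirror pairs `w`, `(conj w)⁻¹`. -/
theorem eval_conjReflect_mul {N : ℕ} {p : ℂ[X]} (hp : p.natDegree ≤ N) {z : ℂ} (hz : z ≠ 0) :
    (conjReflect N p).eval z = z ^ N * conj (p.eval (conj z)⁻¹) := by
  let _ : Invertible z⁻¹ := invertibleOfNonzero (inv_ne_zero hz)
  have h := eval₂_reflect_mul_pow (RingHom.id ℂ) z⁻¹ N (p.map (starRingEnd ℂ))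
    (natDegree_map_le.trans hp)
  simp only [invOf_eq_inv, inv_inv] at h
  have h2 : conj (p.eval (conj z)⁻¹) = (p.map (starRingEnd ℂ)).eval z⁻¹ := by
    have := Polynomial.hom_eval₂ p (RingHom.id ℂ) (starRingEnd ℂ) ((conj z)⁻¹)
    rw [RingHom.comp_id, map_inv₀, Complex.conj_conj] at this
    rw [eval_map, ← this, eval₂_id]
  rw [h2, conjReflect]
  simp only [eval₂_id] at h
  rw [← h, mul_comm (z ^ N), mul_assoc, ← mul_pow, inv_mul_cancel₀ hz]
  simp

theorem eval_conjReflect {N : ℕ} {p : ℂ[X]} (hp : p.natDegree ≤ N) {z : ℂ} (hz : ‖z‖ = 1) :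
    (conjReflect N p).eval z = z ^ N * conj (p.eval z) := by
  have hz0 : z ≠ 0 := by rintro rfl; simp at hz
  rw [eval_conjReflect_mul hp hz0, conj_eq_inv_of_norm_one hz, inv_inv]

theorem coeff_zero_conjReflect (N : ℕ) (p : ℂ[X]) :
    (conjReflect N p).coeff 0 = conj (p.coeff N) := by
  simp [conjReflect, coeff_reflect]

theorem coeff_conjReflect_self (N : ℕ) (p : ℂ[X]) :
    (conjReflect N p).coeff N = conj (p.coeff 0) := by
  simp [conjReflect, coeff_reflect]

theorem natDegree_conjReflect_le {N : ℕ} {p : ℂ[X]} (hp : p.natDegree ≤ N) :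
    (conjReflect N p).natDegree ≤ N := by
  refine natDegree_reflect_le.trans ?_
  exact max_le le_rfl (natDegree_map_le.trans hp)

/-- **Fejér–Riesz** for strictly positive trigonometric polynomials. -/
theorem exists_spectral_factor (L : ℕ) (Q : ℂ[X]) (hdeg : Q.natDegree ≤ 2 * L)
    (hpos : ∀ z : ℂ, ‖z‖ = 1 → ∃ r : ℝ, 0 < r ∧ Q.eval z = r * z ^ L) :
    ∃ P : ℂ[X], P.natDegree ≤ L ∧
      ∀ z : ℂ, ‖z‖ = 1 → Q.eval z = ((‖P.eval z‖ ^ 2 : ℝ) : ℂ) * z ^ L := by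
  induction L generalizing Q with
  | zero =>
    obtain ⟨c, rfl⟩ := natDegree_eq_zero.1 (Nat.le_zero.1 hdeg)
    obtain ⟨r, hr, h⟩ := hpos 1 (by simp)
    refine ⟨C (Real.sqrt r : ℂ), by simp, fun z hz => ?_⟩
    simp only [eval_C, pow_zero, mul_one] at h ⊢
    rw [h, Complex.norm_real, Real.norm_eq_abs, sq_abs, Real.sq_sqrt hr.le]
  | succ L ih =>
    have hQne : ∀ z : ℂ, ‖z‖ = 1 → Q.eval z ≠ 0 := by
      intro z hz
      obtain ⟨r, hr, h⟩ := hpos z hz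
      rw [h]
      have hz0 : z ≠ 0 := by rintro rfl; simp at hz
      exact mul_ne_zero (by exact_mod_cast hr.ne') (pow_ne_zero _ hz0)
    have hsymm : conjReflect (2 * (L + 1)) Q = Q := by
      refine poly_eq_of_unitCircle fun z hz => ?_
      obtain ⟨r, hr, h⟩ := hpos z hz
      rw [eval_conjReflect hdeg hz, h]
      simp only [map_mul, Complex.conj_ofReal, map_pow]
      have := mul_conj_of_norm_one hz
      calc z ^ (2 * (L + 1)) * (r * conj z ^ (L + 1))
          = r * z ^ (L + 1) * (z * conj z) ^ (L + 1) := by ring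
        _ = _ := by rw [this]; ring
    -- A constant would be positive at `1` and negative at a point with `z ^ (L + 1) = -1`.
    have hdeg0 : Q.degree ≠ 0 := by
      intro h0
      obtain ⟨c, rfl⟩ : ∃ c, C c = Q := natDegree_eq_zero.1 (natDegree_eq_of_degree_eq_some h0)
      obtain ⟨r, hr, h⟩ := hpos 1 (by simp)
      obtain ⟨r', hr', h'⟩ := hpos (Complex.exp ((Real.pi / (L + 1) : ℝ) * Complex.I))
        (Complex.norm_exp_ofReal_mul_I _)
      have he : Complex.exp ((Real.pi / (L + 1) : ℝ) * Complex.I) ^ (L + 1) = -1 := by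
        rw [← Complex.exp_nat_mul, ← Complex.exp_pi_mul_I]
        congr 1
        have : (L : ℂ) + 1 ≠ 0 := by exact_mod_cast Nat.succ_ne_zero L
        push_cast
        field_simp
      rw [he] at h'
      simp only [eval_C, one_pow, mul_one] at h h'
      rw [h] at h'
      have : r = -r' := by exact_mod_cast (by simpa using h' : (r : ℂ) = -r')
      linarith
    obtain ⟨w, hw⟩ := IsAlgClosed.exists_root Q hdeg0
    have hwn : ‖w‖ ≠ 1 := fun h => hQne w h hw
    -- The mirror image of a root at `0` is a root at infinity: the top coefficient vanishes too, so
    -- dividing by `X` lowers the degree bound by two.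
    by_cases hw0 : w = 0
    · subst hw0
      obtain ⟨Q1, rfl⟩ := dvd_iff_isRoot.2 hw
      simp only [C_0, sub_zero] at *
      have htop : (X * Q1).coeff (2 * (L + 1)) = 0 := by
        have := coeff_conjReflect_self (2 * (L + 1)) (X * Q1)
        rw [hsymm] at this
        simpa using this
      have hQ1 : Q1.natDegree ≤ 2 * L := by
        rw [natDegree_le_iff_coeff_eq_zero]
        intro N hN
        rw [← coeff_X_mul]
        rcases Nat.lt_or_ge (2 * (L + 1)) (N + 1) with h | h
        · exact coeff_eq_zero_of_natDegree_lt (hdeg.trans_lt h)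
        · rw [show N + 1 = 2 * (L + 1) by omega, htop]
      have key : ∀ z : ℂ, ‖z‖ = 1 → ∀ a : ℂ, (X * Q1).eval z = a * z ^ (L + 1) →
          Q1.eval z = a * z ^ L := by
        intro z hz a h
        have hz0 : z ≠ 0 := by rintro rfl; simp at hz
        apply mul_left_cancel₀ hz0
        rw [eval_mul, eval_X] at h
        rw [h]; ring
      obtain ⟨P, hP, hPe⟩ := ih Q1 hQ1 fun z hz => by
        obtain ⟨r, hr, h⟩ := hpos z hz
        exact ⟨r, hr, key z hz _ h⟩
      refine ⟨P, by omega, fun z hz => ?_⟩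
      rw [eval_mul, eval_X, hPe z hz]; ring
    · have hcw : conj w ≠ 0 := by simpa using hw0
      have hroot2 : Q.IsRoot (conj w)⁻¹ := by
        have := eval_conjReflect_mul hdeg (z := (conj w)⁻¹) (inv_ne_zero hcw)
        rw [hsymm] at this
        rw [IsRoot, this]
        simp [hw.eq_zero]
      have hne : (conj w)⁻¹ ≠ w := by
        intro h
        apply hwn
        have h1 : w * conj w = 1 := by
          nth_rewrite 1 [← h]; exact inv_mul_cancel₀ hcw
        rw [Complex.mul_conj, Complex.normSq_eq_norm_sq] at h1
        have h2 : ‖w‖ ^ 2 = 1 := by exact_mod_cast h1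
        nlinarith [norm_nonneg w, sq_nonneg (‖w‖ - 1)]
      obtain ⟨R, rfl⟩ := dvd_iff_isRoot.2 hw
      have hR : R.IsRoot (conj w)⁻¹ := by
        rw [IsRoot, eval_mul] at hroot2
        simpa [sub_eq_zero, hne] using hroot2
      obtain ⟨Q1, rfl⟩ := dvd_iff_isRoot.2 hR
      have hQ10 : Q1 ≠ 0 := by
        rintro rfl
        exact hQne 1 (by simp) (by simp)
      have hQ1 : Q1.natDegree ≤ 2 * L := by
        rw [natDegree_mul (X_sub_C_ne_zero _) (mul_ne_zero (X_sub_C_ne_zero _) hQ10),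
          natDegree_mul (X_sub_C_ne_zero _) hQ10, natDegree_X_sub_C, natDegree_X_sub_C] at hdeg
        omega
      -- On the circle a mirror pair of factors is `z * |z - w|²` up to a constant. Moving that
      -- constant into the quotient keeps the quotient positive, and `X - w` is the factor
      -- contributed to `P`.
      have hfac : ∀ z : ℂ, ‖z‖ = 1 → (z - w) * (z - (conj w)⁻¹) =
          -(conj w)⁻¹ * z * ((‖z - w‖ ^ 2 : ℝ) : ℂ) := by
        intro z hz
        have hz1 := mul_conj_of_norm_one hz
        rw [← Complex.normSq_eq_norm_sq, ← Complex.mul_conj, map_sub]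
        have : z - (conj w)⁻¹ = -(conj w)⁻¹ * z * (conj z - conj w) := by
          have e : -(conj w)⁻¹ * z * (conj z - conj w) =
            -(conj w)⁻¹ * (z * conj z) + (conj w)⁻¹ * conj w * z := by ring
          rw [e, hz1, inv_mul_cancel₀ hcw]; ring
        rw [this]; ring
      obtain ⟨P, hP, hPe⟩ := ih (C (-(conj w)⁻¹) * Q1)
        (natDegree_C_mul_le _ _ |>.trans hQ1) fun z hz => by
          obtain ⟨r, hr, h⟩ := hpos z hz
          have hz0 : z ≠ 0 := by rintro rfl; simp at hz
          have hzw : z - w ≠ 0 := by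
            rw [sub_ne_zero]; rintro rfl; exact hwn hz
          have hn : 0 < ‖z - w‖ ^ 2 := by positivity
          refine ⟨r / ‖z - w‖ ^ 2, by positivity, ?_⟩
          have hnc : ((‖z - w‖ ^ 2 : ℝ) : ℂ) ≠ 0 := by exact_mod_cast hn.ne'
          simp only [eval_mul, eval_sub, eval_X, eval_C] at h ⊢
          rw [← mul_assoc, hfac z hz] at h
          rw [Complex.ofReal_div, div_mul_eq_mul_div, eq_div_iff hnc]
          apply mul_left_cancel₀ hz0
          calc z * (-(conj w)⁻¹ * Q1.eval z * ((‖z - w‖ ^ 2 : ℝ) : ℂ)) = _ := by ring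
            _ = _ := h
            _ = _ := by ring
      refine ⟨(X - C w) * P, ?_, fun z hz => ?_⟩
      · refine natDegree_mul_le.trans ?_
        rw [natDegree_X_sub_C]; omega
      · have h := hPe z hz
        simp only [eval_mul, eval_sub, eval_X, eval_C, norm_mul] at h ⊢
        rw [← mul_assoc, hfac z hz]
        calc -(conj w)⁻¹ * z * ((‖z - w‖ ^ 2 : ℝ) : ℂ) * eval z Q1
            = (-(conj w)⁻¹ * eval z Q1) * (z * ((‖z - w‖ ^ 2 : ℝ) : ℂ)) := by ring
          _ = _ := by rw [h]; push_cast; ring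

/-! ### Signal processing on one qubit -/

/-- The diagonal matrix `diag (1, w)`. -/
noncomputable def signal (w : ℂ) : Matrix Bool Bool ℂ := Matrix.diagonal fun b => if b then w else 1

/-- Apply the gates of a list to a vector of `ℂ²`, each one preceded by a signal. -/
noncomputable def process (w : ℂ) : List (Matrix.unitaryGroup Bool ℂ) → (Bool → ℂ) → (Bool → ℂ)
  | [], v => v
  | g :: l, v => process w l (g.1 *ᵥ (signal w *ᵥ v))

theorem process_append (w : ℂ) (l l' : List (Matrix.unitaryGroup Bool ℂ)) (v : Bool → ℂ) :
    process w (l ++ l') v = process w l' (process w l v) := by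
  induction l generalizing v with
  | nil => rfl
  | cons g l ih => simp [process, ih]

/-- The vector with entries `a`, `b`. -/
def vec2 (a b : ℂ) : Bool → ℂ := fun i => if i then b else a

/-- The unitary with first column `(a, b)` and determinant one. -/
noncomputable def colUnitary (a b : ℂ) (h : ‖a‖ ^ 2 + ‖b‖ ^ 2 = 1) : Matrix.unitaryGroup Bool ℂ :=
  ⟨Matrix.of fun i j => if j then (if i then conj a else -conj b) else (if i then b else a), by
    have h' : a * conj a + b * conj b = 1 := by
      rw [Complex.mul_conj, Complex.mul_conj, Complex.normSq_eq_norm_sq, Complex.normSq_eq_norm_sq]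
      exact_mod_cast h
    rw [Matrix.mem_unitaryGroup_iff]
    ext i j
    cases i <;> cases j <;> simp [Matrix.mul_apply] <;>
      first | linear_combination h' | ring⟩

theorem colUnitary_mulVec (a b : ℂ) (h : ‖a‖ ^ 2 + ‖b‖ ^ 2 = 1) (x y : ℂ) :
    (colUnitary a b h).1 *ᵥ vec2 x y = vec2 (a * x - conj b * y) (b * x + conj a * y) := by
  ext i
  cases i <;> simp [colUnitary, Matrix.mulVec, dotProduct, vec2] <;> ring

theorem signal_mulVec (w x y : ℂ) : signal w *ᵥ vec2 x y = vec2 x (w * y) := by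
  ext i
  cases i <;> simp [signal, Matrix.mulVec_diagonal, vec2]

/-- The vectors `(p₀, q₀)` and `(p₁, q₁)` are orthogonal, so the normalisation of the first serves
as `(a, b)`. If the first is zero, any unit vector orthogonal to the second does. -/
theorem exists_unit_cofactor {p₀ q₀ p₁ q₁ : ℂ} (h : p₀ * conj p₁ + q₀ * conj q₁ = 0) :
    ∃ a b : ℂ, ‖a‖ ^ 2 + ‖b‖ ^ 2 = 1 ∧ a * q₀ - b * p₀ = 0 ∧ conj a * p₁ + conj b * q₁ = 0 := by
  have norml : ∀ x y : ℂ, (x ≠ 0 ∨ y ≠ 0) → ∃ t : ℝ, ‖(t : ℂ) * x‖ ^ 2 + ‖(t : ℂ) * y‖ ^ 2 = 1 := by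
    intro x y hxy
    have hs : 0 < ‖x‖ ^ 2 + ‖y‖ ^ 2 := by
      rcases hxy with h | h <;> have := norm_pos_iff.2 h <;> positivity
    refine ⟨(Real.sqrt (‖x‖ ^ 2 + ‖y‖ ^ 2))⁻¹, ?_⟩
    simp only [norm_mul, Complex.norm_real, mul_pow, Real.norm_eq_abs, sq_abs, inv_pow,
      Real.sq_sqrt hs.le]
    field_simp
  by_cases h0 : p₀ ≠ 0 ∨ q₀ ≠ 0
  · obtain ⟨t, ht⟩ := norml p₀ q₀ h0
    refine ⟨t * p₀, t * q₀, ht, by ring, ?_⟩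
    have := congrArg conj h
    simp only [map_add, map_mul, Complex.conj_conj, map_zero, Complex.conj_ofReal] at this ⊢
    linear_combination (t : ℂ) * this
  · push Not at h0
    obtain ⟨rfl, rfl⟩ := h0
    by_cases h1 : conj q₁ ≠ 0 ∨ -conj p₁ ≠ 0
    · obtain ⟨t, ht⟩ := norml _ _ h1
      refine ⟨t * conj q₁, t * -conj p₁, ht, by ring, ?_⟩
      simp only [map_mul, map_neg, Complex.conj_conj, Complex.conj_ofReal]
      ring
    · push Not at h1
      obtain ⟨h1, h2⟩ := h1
      have e1 : q₁ = 0 := by simpa using h1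
      have e2 : p₁ = 0 := by simpa using h2
      exact ⟨1, 0, by simp, by simp, by simp [e2]⟩

/-- A pair of complementary polynomials of degree at most `L` is the output of a one-qubit circuit
with `L` signals. -/
theorem exists_process_eq (L : ℕ) (P Q : ℂ[X]) (hP : P.natDegree ≤ L) (hQ : Q.natDegree ≤ L)
    (h : ∀ z : ℂ, ‖z‖ = 1 → ‖P.eval z‖ ^ 2 + ‖Q.eval z‖ ^ 2 = 1) :
    ∃ (g : Matrix.unitaryGroup Bool ℂ) (l : List (Matrix.unitaryGroup Bool ℂ)), l.length = L ∧
      ∀ z : ℂ, ‖z‖ = 1 → process z l (g.1 *ᵥ vec2 1 0) = vec2 (P.eval z) (Q.eval z) := by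
  induction L generalizing P Q with
  | zero =>
    obtain ⟨p, rfl⟩ := natDegree_eq_zero.1 (Nat.le_zero.1 hP)
    obtain ⟨q, rfl⟩ := natDegree_eq_zero.1 (Nat.le_zero.1 hQ)
    have h1 := h 1 (by simp)
    simp only [eval_C] at h1
    refine ⟨colUnitary p q h1, [], rfl, fun z hz => ?_⟩
    rw [process, colUnitary_mulVec]; simp
  | succ L ih =>
    have hrel : P * conjReflect (L + 1) P + Q * conjReflect (L + 1) Q = X ^ (L + 1) := by
      refine poly_eq_of_unitCircle fun z hz => ?_
      simp only [eval_add, eval_mul, eval_pow, eval_X, eval_conjReflect hP hz,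
        eval_conjReflect hQ hz]
      have h1 : P.eval z * conj (P.eval z) + Q.eval z * conj (Q.eval z) = 1 := by
        rw [Complex.mul_conj, Complex.mul_conj, Complex.normSq_eq_norm_sq,
          Complex.normSq_eq_norm_sq]
        exact_mod_cast h z hz
      linear_combination z ^ (L + 1) * h1
    -- The constant coefficient of `hrel` says that the vectors of lowest and of highest
    -- coefficients are orthogonal. Hence undoing one suitable last gate kills the top coefficient
    -- of the first component and the constant coefficient of the second at once; the second is then
    -- divisible by `X`, which undoes one signal.
    have hc : P.coeff 0 * conj (P.coeff (L + 1)) + Q.coeff 0 * conj (Q.coeff (L + 1)) = 0 := by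
      have := congrArg (fun p => coeff p 0) hrel
      simpa only [coeff_add, mul_coeff_zero, coeff_zero_conjReflect, coeff_X_pow,
        (Nat.succ_ne_zero L).symm, if_false] using this
    obtain ⟨a, b, hab, hb0, ht⟩ := exists_unit_cofactor hc
    set P1 : ℂ[X] := C (conj a) * P + C (conj b) * Q with hP1
    set R : ℂ[X] := C (-b) * P + C a * Q with hR
    have hP1deg : P1.natDegree ≤ L := by
      rw [natDegree_le_iff_coeff_eq_zero]
      intro N hN
      rcases Nat.lt_or_ge (L + 1) N with h' | h'
      · simp only [hP1, coeff_add, coeff_C_mul, coeff_eq_zero_of_natDegree_lt (hP.trans_lt h'),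
          coeff_eq_zero_of_natDegree_lt (hQ.trans_lt h')]
        simp
      · rw [show N = L + 1 by omega]
        simpa only [hP1, coeff_add, coeff_C_mul] using ht
    have hRdeg : R.natDegree ≤ L + 1 := by
      refine (natDegree_add_le _ _).trans (max_le ?_ ?_)
      · exact (natDegree_C_mul_le _ _).trans hP
      · exact (natDegree_C_mul_le _ _).trans hQ
    have hR0 : R.coeff 0 = 0 := by
      simp only [hR, coeff_add, coeff_C_mul]
      linear_combination hb0
    obtain ⟨Q1, hQ1⟩ := X_dvd_iff.2 hR0
    have hQ1deg : Q1.natDegree ≤ L := by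
      rw [natDegree_le_iff_coeff_eq_zero]
      intro N hN
      rw [← coeff_X_mul, ← hQ1]
      exact coeff_eq_zero_of_natDegree_lt (hRdeg.trans_lt (by omega))
    have hab' : a * conj a + b * conj b = 1 := by
      rw [Complex.mul_conj, Complex.mul_conj, Complex.normSq_eq_norm_sq, Complex.normSq_eq_norm_sq]
      exact_mod_cast hab
    have hRe : ∀ z, z * Q1.eval z = -b * P.eval z + a * Q.eval z := by
      intro z
      have := congrArg (eval z) hQ1
      rw [eval_mul, eval_X] at this
      rw [← this]; simp [hR]
    have hP1e : ∀ z, P1.eval z = conj a * P.eval z + conj b * Q.eval z := by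
      intro z; simp [hP1]
    obtain ⟨g, l, hl, hgl⟩ := ih P1 Q1 hP1deg hQ1deg fun z hz => by
      have e : ‖Q1.eval z‖ = ‖z * Q1.eval z‖ := by rw [norm_mul, hz, one_mul]
      rw [e, hRe, hP1e, ← h z hz]
      have : ((‖conj a * P.eval z + conj b * Q.eval z‖ ^ 2 + ‖-b * P.eval z + a * Q.eval z‖ ^ 2 : ℝ)
          : ℂ) = ((‖P.eval z‖ ^ 2 + ‖Q.eval z‖ ^ 2 : ℝ) : ℂ) := by
        simp only [← Complex.normSq_eq_norm_sq]
        push_cast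
        simp only [← Complex.mul_conj, map_add, map_mul, map_neg, Complex.conj_conj]
        linear_combination (P.eval z * conj (P.eval z) + Q.eval z * conj (Q.eval z)) * hab'
      exact_mod_cast this
    refine ⟨g, l ++ [colUnitary a b hab], by simp [hl], fun z hz => ?_⟩
    rw [process_append, hgl z hz, process, process, signal_mulVec, colUnitary_mulVec, hRe, hP1e]
    congr 1
    · linear_combination P.eval z * hab'
    · linear_combination Q.eval z * hab'

end UnitCircle

/-! ### A half-band filter of degree `O(η⁻¹ log ε⁻¹)`. -/

section Filter

open Polynomial ComplexConjugate

/-! ### A half-band filter -/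

/-- Parseval for the finite Fourier transform. The rotation by `y` only changes the phases of the
coefficients, so the sum is independent of `y`. -/
theorem sum_norm_sq_eval_rootsOfUnity {N : ℕ} {ω : ℂ} (hω : IsPrimitiveRoot ω N) {G : ℂ[X]}
    (hG : G.natDegree < N) {y : ℂ} (hy : ‖y‖ = 1) :
    ∑ s ∈ Finset.range N, ‖G.eval (y * ω ^ s)‖ ^ 2 =
      N * ∑ i ∈ Finset.range N, ‖G.coeff i‖ ^ 2 := by
  have hN : N ≠ 0 := by omega
  have hω1 : ‖ω‖ = 1 := hω.norm'_eq_one hN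
  have hωc := mul_conj_of_norm_one hω1
  have hyc := mul_conj_of_norm_one hy
  have hgeom : ∀ i ∈ Finset.range N, ∀ j ∈ Finset.range N,
      ∑ s ∈ Finset.range N, (ω ^ i * conj ω ^ j) ^ s = if i = j then (N : ℂ) else 0 := by
    intro i hi j hj
    rw [Finset.mem_range] at hi hj
    split_ifs with hij
    · subst hij
      simp [← mul_pow, hωc]
    · have hu : ω ^ i * conj ω ^ j ≠ 1 := by
        intro h
        apply hij
        refine hω.pow_inj hi hj ?_
        calc ω ^ i = ω ^ i * (ω * conj ω) ^ j := by rw [hωc]; simp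
          _ = (ω ^ i * conj ω ^ j) * ω ^ j := by ring
          _ = ω ^ j := by rw [h, one_mul]
      have h1 := geom_sum_mul (ω ^ i * conj ω ^ j) N
      have h2 : (ω ^ i * conj ω ^ j) ^ N = 1 := by
        calc (ω ^ i * conj ω ^ j) ^ N = (ω ^ N) ^ i * conj (ω ^ N) ^ j := by
              rw [map_pow]; ring
          _ = 1 := by rw [hω.pow_eq_one]; simp
      rw [h2, sub_self] at h1
      exact (mul_eq_zero.1 h1).resolve_right (sub_ne_zero.2 hu)
  have key : ∀ s : ℕ, ((‖G.eval (y * ω ^ s)‖ ^ 2 : ℝ) : ℂ) =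
      ∑ i ∈ Finset.range N, ∑ j ∈ Finset.range N,
        (G.coeff i * y ^ i * conj (G.coeff j * y ^ j)) * (ω ^ i * conj ω ^ j) ^ s := by
    intro s
    rw [← Complex.normSq_eq_norm_sq, ← Complex.mul_conj, eval_eq_sum_range' hG, map_sum,
      Finset.sum_mul_sum]
    refine Finset.sum_congr rfl fun i _ => Finset.sum_congr rfl fun j _ => ?_
    simp only [map_mul, map_pow]
    ring
  have : ((∑ s ∈ Finset.range N, ‖G.eval (y * ω ^ s)‖ ^ 2 : ℝ) : ℂ) =
      ((N * ∑ i ∈ Finset.range N, ‖G.coeff i‖ ^ 2 : ℝ) : ℂ) := by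
    rw [Complex.ofReal_sum, Finset.sum_congr rfl fun s _ => key s, Finset.sum_comm]
    push_cast
    rw [Finset.mul_sum]
    refine Finset.sum_congr rfl fun i hi => ?_
    rw [Finset.sum_comm]
    simp_rw [← Finset.mul_sum]
    rw [Finset.sum_congr rfl fun j hj => by rw [hgeom i hi j hj]]
    simp only [mul_ite, mul_zero, Finset.sum_ite_eq, if_pos hi]
    rw [map_mul]
    have e : y ^ i * conj (y ^ i) = 1 := by rw [map_pow, ← mul_pow, hyc, one_pow]
    have e2 : G.coeff i * conj (G.coeff i) = (‖G.coeff i‖ : ℂ) ^ 2 := by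
      rw [Complex.mul_conj, Complex.normSq_eq_norm_sq]; push_cast; rfl
    calc _ = (N : ℂ) * (G.coeff i * conj (G.coeff i)) * (y ^ i * conj (y ^ i)) := by ring
      _ = _ := by rw [e, e2, mul_one]
  exact_mod_cast this

/-- Cauchy–Schwarz applied to the coefficients, which sum to `1`. It keeps the normalising constant
`κ` of the filter at least `1`. -/
theorem one_le_mul_sum_norm_sq_coeff {N L : ℕ} (hNL : L < N) {G : ℂ[X]} (hG : G.natDegree ≤ L)
    (h1 : G.eval 1 = 1) : 1 ≤ (L + 1 : ℝ) * ∑ i ∈ Finset.range N, ‖G.coeff i‖ ^ 2 := by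
  have h2 : (1 : ℝ) ≤ ∑ i ∈ Finset.range (L + 1), ‖G.coeff i‖ := by
    have := eval_eq_sum_range' (Nat.lt_succ_of_le hG) 1
    rw [h1] at this
    simp only [one_pow, mul_one] at this
    calc (1 : ℝ) = ‖(1 : ℂ)‖ := by simp
      _ ≤ _ := by rw [this]; exact norm_sum_le _ _
  have h3 := sq_sum_le_card_mul_sum_sq (s := Finset.range (L + 1)) (f := fun i => ‖G.coeff i‖)
  have h4 : ∑ i ∈ Finset.range (L + 1), ‖G.coeff i‖ ^ 2 ≤
      ∑ i ∈ Finset.range N, ‖G.coeff i‖ ^ 2 :=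
    Finset.sum_le_sum_of_subset_of_nonneg (Finset.range_mono (by omega))
      fun _ _ _ => sq_nonneg _
  rw [Finset.card_range] at h3
  push_cast at h3
  nlinarith [mul_le_mul_of_nonneg_left h4 (by positivity : (0 : ℝ) ≤ L + 1)]

/-- The polynomial `(1 + X + ⋯ + X ^ (m - 1)) / m`. -/
noncomputable def meanPoly (m : ℕ) : ℂ[X] := C ((m : ℂ)⁻¹) * ∑ j ∈ Finset.range m, X ^ j

theorem natDegree_meanPoly (m : ℕ) (hm : 0 < m) : (meanPoly m).natDegree < m := by
  refine lt_of_le_of_lt (natDegree_C_mul_le _ _) ?_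
  refine Nat.lt_of_le_pred hm (natDegree_sum_le_of_forall_le _ _ fun j hj => ?_)
  rw [natDegree_X_pow]
  exact Nat.le_pred_of_lt (Finset.mem_range.1 hj)

theorem meanPoly_eval_one (m : ℕ) (hm : 0 < m) : (meanPoly m).eval 1 = 1 := by
  have : (m : ℂ) ≠ 0 := by exact_mod_cast hm.ne'
  simp [meanPoly, eval_finsetSum, this]

theorem sum_norm_sq_coeff_meanPoly (m N : ℕ) (hm : 0 < m) (hN : m ≤ N) :
    ∑ i ∈ Finset.range N, ‖(meanPoly m).coeff i‖ ^ 2 = 1 / m := by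
  have hc : ∀ i, (meanPoly m).coeff i = if i < m then (m : ℂ)⁻¹ else 0 := by
    intro i
    simp [meanPoly, coeff_C_mul, coeff_X_pow]
  have : ∀ i, ‖(meanPoly m).coeff i‖ ^ 2 = if i < m then ((m : ℝ)⁻¹) ^ 2 else 0 := by
    intro i
    rw [hc]; split_ifs <;> simp
  simp_rw [this]
  rw [← Finset.sum_filter]
  have hf : Finset.filter (fun i => i < m) (Finset.range N) = Finset.range m := by
    ext i; simp; omega
  rw [hf, Finset.sum_const, Finset.card_range, nsmul_eq_mul]
  have : (m : ℝ) ≠ 0 := by exact_mod_cast hm.ne'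
  field_simp

/-- Geometric sum: away from its peak at `1` the kernel decays like `2 / (m |u - 1|)`. -/
theorem norm_meanPoly_eval_mul_le (m : ℕ) (hm : 0 < m) {u : ℂ} (hu : ‖u‖ = 1) :
    ‖(meanPoly m).eval u‖ * (m * ‖u - 1‖) ≤ 2 := by
  have hm' : (m : ℂ) ≠ 0 := by exact_mod_cast hm.ne'
  have h : (meanPoly m).eval u * (m * (u - 1)) = u ^ m - 1 := by
    rw [← geom_sum_mul]
    simp only [meanPoly, eval_mul, eval_C, eval_finsetSum, eval_pow, eval_X]
    field_simp
  calc ‖(meanPoly m).eval u‖ * (m * ‖u - 1‖) = ‖(meanPoly m).eval u * (m * (u - 1))‖ := by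
        simp
    _ = ‖u ^ m - 1‖ := by rw [h]
    _ ≤ ‖u ^ m‖ + ‖(1 : ℂ)‖ := norm_sub_le _ _
    _ = 2 := by rw [norm_pow, hu]; norm_num

/-- A polynomial of degree `L = (r + 1) m` whose squared modulus is a half-band filter with
transition region `|Re z| < 2 η`. -/
theorem exists_halfBand_of_params (m r : ℕ) (hm : 0 < m) {η ε : ℝ}
    (hmη : 2 ≤ m * η) (hε : 0 < ε) (hε1 : ε ≤ 1) (hr : (1 / 2 : ℝ) ^ r ≤ ε ^ 2 / 4) :
    ∃ P : ℂ[X], P.natDegree ≤ (r + 1) * m ∧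
      (∀ z : ℂ, ‖z‖ = 1 → ‖P.eval z‖ ^ 2 + ‖P.eval (-z)‖ ^ 2 = 1) ∧
      ∀ z : ℂ, ‖z‖ = 1 → z.re ≤ -(2 * η) → ‖P.eval z‖ ≤ ε := by
  set L := (r + 1) * m with hL
  have hL0 : 0 < L := by positivity
  set ω : ℂ := Complex.exp (-(2 * Real.pi * Complex.I / (L + L : ℕ))) with hωdef
  have hω : IsPrimitiveRoot ω (L + L) := by
    rw [hωdef, Complex.exp_neg]
    exact (Complex.isPrimitiveRoot_exp (L + L) (by omega)).inv
  have hω1 : ‖ω‖ = 1 := hω.norm'_eq_one (by omega)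
  have hωL : ω ^ L = -1 := by
    rw [hωdef, ← Complex.exp_nat_mul]
    have : (L : ℂ) ≠ 0 := by exact_mod_cast hL0.ne'
    rw [show (L : ℂ) * -(2 * Real.pi * Complex.I / (L + L : ℕ)) = -(Real.pi * Complex.I) by
      push_cast; field_simp; ring, Complex.exp_neg, Complex.exp_pi_mul_I]
    norm_num
  set G : ℂ[X] := meanPoly m ^ (r + 1) with hGdef
  have hGdeg : G.natDegree ≤ L := by
    refine natDegree_pow_le.trans ?_
    exact Nat.mul_le_mul_left _ (natDegree_meanPoly m hm).le
  have hG1 : G.eval 1 = 1 := by rw [hGdef, eval_pow, meanPoly_eval_one m hm, one_pow]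
  set κ : ℝ := (L + L : ℕ) * ∑ i ∈ Finset.range (L + L), ‖G.coeff i‖ ^ 2 with hκ
  have hκ1 : 1 ≤ κ := by
    have h1 := one_le_mul_sum_norm_sq_coeff (N := L + L) (by omega) hGdeg hG1
    refine h1.trans (mul_le_mul_of_nonneg_right ?_ (Finset.sum_nonneg fun _ _ => sq_nonneg _))
    push_cast
    have : (1 : ℝ) ≤ L := by exact_mod_cast hL0
    linarith
  have hpt : ∀ z : ℂ, ‖z‖ = 1 → ∀ s : ℕ, ‖Complex.I * z * ω ^ s‖ = 1 := by
    intro z hz s; simp [hz, hω1]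
  -- The sum runs over one half of the `2L`-th roots of unity. Since `ω ^ L = -1`, passing to `-z`
  -- gives the other half, so `S z + S (-z)` is constant by Parseval. The factor `I` turns the half
  -- circle so that `G` is evaluated at its peak `1` only when `Re z ≥ 0`.
  set S : ℂ → ℝ := fun z => ∑ s ∈ Finset.range L, ‖G.eval (Complex.I * z * ω ^ s)‖ ^ 2 with hS
  have hS0 : ∀ z, 0 ≤ S z := fun z => Finset.sum_nonneg fun _ _ => sq_nonneg _
  have hfull : ∀ z : ℂ, ‖z‖ = 1 → S z + S (-z) = κ := by
    intro z hz
    have hy : ‖Complex.I * z‖ = 1 := by simp [hz]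
    rw [hκ, ← sum_norm_sq_eval_rootsOfUnity hω (hGdeg.trans_lt (by omega)) hy,
      Finset.sum_range_add]
    congr 1
    refine Finset.sum_congr rfl fun s _ => ?_
    rw [pow_add, hωL]
    congr 3
    ring
  have htail : ∀ z : ℂ, ‖z‖ = 1 → z.re ≤ -(2 * η) → S z ≤ ε ^ 2 / 2 := by
    intro z hz hre
    have hsmall : ∀ s ∈ Finset.range L,
        ‖(meanPoly m).eval (Complex.I * z * ω ^ s)‖ ≤ 1 / 2 := by
      intro s hs
      have h1 := norm_meanPoly_eval_mul_le m hm (hpt z hz s)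
      -- The left point is as far from `1` as `z` is from `-I * exp (I t)`, whose real part `sin t`
      -- is nonnegative on the half circle, whereas `Re z ≤ -2η`.
      have hdist : 2 * η ≤ ‖Complex.I * z * ω ^ s - 1‖ := by
        set t : ℝ := 2 * Real.pi * s / (L + L : ℕ) with ht
        have hωs : ω ^ s = Complex.exp (-(t * Complex.I)) := by
          rw [hωdef, ← Complex.exp_nat_mul, ht]
          congr 1
          push_cast
          ring
        have hinv : Complex.exp (-(t * Complex.I)) * Complex.exp (t * Complex.I) = 1 := by
          rw [← Complex.exp_add]; simp
        have e1 : Complex.I * z * ω ^ s - 1 =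
            (Complex.I * ω ^ s) * (z - -Complex.I * Complex.exp (t * Complex.I)) := by
          rw [hωs]
          linear_combination (-Complex.I ^ 2) * hinv - Complex.I_sq
        have e2 : ‖Complex.I * z * ω ^ s - 1‖ =
            ‖z - -Complex.I * Complex.exp (t * Complex.I)‖ := by
          rw [e1, norm_mul]; simp [hω1]
        have hsin : 0 ≤ Real.sin t := by
          apply Real.sin_nonneg_of_nonneg_of_le_pi
          · positivity
          · have : (s : ℝ) ≤ L := by exact_mod_cast (Finset.mem_range.1 hs).le
            have hLr : (0 : ℝ) < L := by exact_mod_cast hL0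
            rw [ht]
            push_cast
            rw [div_le_iff₀ (by positivity)]
            nlinarith [Real.pi_pos]
        have hre2 : (-Complex.I * Complex.exp (t * Complex.I)).re = Real.sin t := by
          rw [Complex.exp_mul_I]
          simp [Complex.mul_re, Complex.cos_ofReal_im, Complex.sin_ofReal_re]
        rw [e2]
        have := Complex.abs_re_le_norm (z - -Complex.I * Complex.exp (t * Complex.I))
        rw [Complex.sub_re, hre2] at this
        have h3 := neg_abs_le (z.re - Real.sin t)
        linarith
      have hmr : (0 : ℝ) < m := by exact_mod_cast hm
      have h4 : 4 ≤ m * ‖Complex.I * z * ω ^ s - 1‖ := by nlinarith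
      have := norm_nonneg ((meanPoly m).eval (Complex.I * z * ω ^ s))
      nlinarith
    -- Of the `r + 1` factors of `G`, `r` are bounded pointwise by `1 / 2`. The last is kept for
    -- Parseval over the full circle, which gives `2 (r + 1)`, free of `m`.
    have hle : S z ≤ (1 / 4 : ℝ) ^ r *
        ∑ s ∈ Finset.range (L + L), ‖(meanPoly m).eval (Complex.I * z * ω ^ s)‖ ^ 2 := by
      rw [Finset.mul_sum]
      refine (Finset.sum_le_sum fun s hs => ?_).trans
        (Finset.sum_le_sum_of_subset_of_nonneg (Finset.range_mono (by omega : L ≤ L + L))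
          fun _ _ _ => by positivity)
      rw [hGdef, eval_pow, norm_pow]
      set x := ‖(meanPoly m).eval (Complex.I * z * ω ^ s)‖
      have hx : 0 ≤ x := norm_nonneg _
      have hx2 : x ^ 2 ≤ 1 / 4 := by nlinarith [hsmall s hs]
      calc (x ^ (r + 1)) ^ 2 = (x ^ 2) ^ r * x ^ 2 := by ring
        _ ≤ (1 / 4) ^ r * x ^ 2 := by gcongr
    have hmL : m ≤ L + L := by
      rw [hL]; nlinarith
    rw [sum_norm_sq_eval_rootsOfUnity hω ((natDegree_meanPoly m hm).trans_le hmL)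
      (by simp [hz]), sum_norm_sq_coeff_meanPoly m _ hm hmL] at hle
    have hmr : (m : ℝ) ≠ 0 := by exact_mod_cast hm.ne'
    have e3 : ((L + L : ℕ) : ℝ) * (1 / m) = 2 * (r + 1) := by
      rw [hL]; push_cast; field_simp; ring
    rw [e3] at hle
    have h5 : ((r : ℝ) + 1) ≤ 2 ^ r := by
      exact_mod_cast Nat.lt_two_pow_self (n := r)
    calc S z ≤ (1 / 4 : ℝ) ^ r * (2 * (r + 1)) := hle
      _ ≤ (1 / 4 : ℝ) ^ r * (2 * 2 ^ r) := by gcongr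
      _ = 2 * (1 / 2) ^ r := by
        rw [show (1 / 4 : ℝ) = 1 / 2 * (1 / 2) by norm_num, mul_pow]
        have : (1 / 2 : ℝ) ^ r * 2 ^ r = 1 := by rw [← mul_pow]; norm_num
        linear_combination 2 * (1 / 2 : ℝ) ^ r * this
      _ ≤ ε ^ 2 / 2 := by linarith
  have hε2 : ε ^ 2 ≤ 1 := by nlinarith
  have hκ0 : 0 < κ := by linarith
  -- The scaling makes `A z + A (-z) = 1`. The summand `ε ^ 2 / 2` gives the strict positivity that
  -- `exists_spectral_factor` asks for and uses half of the error budget `ε ^ 2`.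
  set A : ℂ → ℝ := fun z => (1 - ε ^ 2) / κ * S z + ε ^ 2 / 2 with hA
  have hApos : ∀ z, 0 < A z := by
    intro z
    have : 0 ≤ (1 - ε ^ 2) / κ * S z := mul_nonneg (div_nonneg (by linarith) hκ0.le) (hS0 z)
    have : 0 < ε ^ 2 := by positivity
    simp only [hA]; linarith
  set Gs : ℕ → ℂ[X] := fun s => G.comp (C (Complex.I * ω ^ s) * X) with hGs
  have hGsdeg : ∀ s, (Gs s).natDegree ≤ L := by
    intro s
    refine natDegree_comp_le.trans ?_
    calc _ ≤ L * 1 := Nat.mul_le_mul hGdeg ((natDegree_C_mul_le _ _).trans natDegree_X_le)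
      _ = L := mul_one L
  set Q : ℂ[X] := C (((1 - ε ^ 2) / κ : ℝ) : ℂ) *
      ∑ s ∈ Finset.range L, Gs s * conjReflect L (Gs s) + C ((ε ^ 2 / 2 : ℝ) : ℂ) * X ^ L with hQ
  have hQdeg : Q.natDegree ≤ 2 * L := by
    refine (natDegree_add_le _ _).trans (max_le ?_ ?_)
    · refine (natDegree_C_mul_le _ _).trans (natDegree_sum_le_of_forall_le _ _ fun s _ => ?_)
      refine natDegree_mul_le.trans ?_
      have := natDegree_conjReflect_le (hGsdeg s)
      have := hGsdeg s
      omega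
    · refine (natDegree_C_mul_X_pow_le _ _).trans (by omega)
  have hQe : ∀ z : ℂ, ‖z‖ = 1 → Q.eval z = (A z : ℂ) * z ^ L := by
    intro z hz
    have hs : ∀ s, (Gs s * conjReflect L (Gs s)).eval z =
        ((‖G.eval (Complex.I * z * ω ^ s)‖ ^ 2 : ℝ) : ℂ) * z ^ L := by
      intro s
      rw [eval_mul, eval_conjReflect (hGsdeg s) hz, ← Complex.normSq_eq_norm_sq,
        ← Complex.mul_conj]
      have : (Gs s).eval z = G.eval (Complex.I * z * ω ^ s) := by
        simp only [hGs, eval_comp, eval_mul, eval_C, eval_X]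
        congr 1; ring
      rw [this]; ring
    simp only [hQ, eval_add, eval_mul, eval_C, eval_finsetSum, eval_pow, eval_X] at hs ⊢
    rw [Finset.sum_congr rfl fun s _ => hs s, ← Finset.sum_mul]
    simp only [hA, hS]
    push_cast
    ring
  obtain ⟨P, hP, hPe⟩ := exists_spectral_factor L Q hQdeg fun z hz => ⟨A z, hApos z, hQe z hz⟩
  have hPA : ∀ z : ℂ, ‖z‖ = 1 → ‖P.eval z‖ ^ 2 = A z := by
    intro z hz
    have hz0 : z ≠ 0 := by rintro rfl; simp at hz
    have h := hPe z hz
    rw [hQe z hz] at h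
    exact_mod_cast (mul_right_cancel₀ (pow_ne_zero L hz0) h).symm
  refine ⟨P, hP, fun z hz => ?_, fun z hz hre => ?_⟩
  · rw [hPA z hz, hPA (-z) (by simpa using hz)]
    have := hfull z hz
    have e : A z + A (-z) = (1 - ε ^ 2) * ((S z + S (-z)) / κ) + ε ^ 2 := by
      simp only [hA]; ring
    rw [e, this, div_self hκ0.ne']; ring
  · have h1 := hPA z hz
    have h2 := htail z hz hre
    have h3 : (1 - ε ^ 2) / κ * S z ≤ 1 * S z := by
      refine mul_le_mul_of_nonneg_right ?_ (hS0 z)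
      rw [div_le_one hκ0]
      nlinarith [sq_nonneg ε]
    have h4 : ‖P.eval z‖ ^ 2 ≤ ε ^ 2 := by
      rw [h1]; simp only [hA]; linarith
    exact (sq_le_sq₀ (norm_nonneg _) hε.le).1 h4

/-- Take `m = ⌈2 / η⌉` and `r = ⌈4 log ε⁻¹ / log 2⌉`, so that `2 ^ (-r) ≤ ε ^ 4 ≤ ε ^ 2 / 4`. The
constant is `36 = 12 * 3`, from `r + 1 ≤ 12 log ε⁻¹` and `m ≤ 3 η⁻¹`. -/
theorem exists_halfBand : ∃ K : ℝ, 0 < K ∧ ∀ η ε : ℝ, 0 < η → η ≤ 1 → 0 < ε → ε ≤ 1 / 2 →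
    ∃ (L : ℕ) (P : ℂ[X]), (L : ℝ) ≤ K * (η⁻¹ * Real.log ε⁻¹) ∧ P.natDegree ≤ L ∧
      (∀ z : ℂ, ‖z‖ = 1 → ‖P.eval z‖ ^ 2 + ‖P.eval (-z)‖ ^ 2 = 1) ∧
      ∀ z : ℂ, ‖z‖ = 1 → z.re ≤ -(2 * η) → ‖P.eval z‖ ≤ ε := by
  refine ⟨36, by norm_num, fun η ε hη hη1 hε hε1 => ?_⟩
  have hl2 : 1 / 2 < Real.log 2 := by have := Real.log_two_gt_d9; linarith
  have hle : Real.log 2 ≤ Real.log ε⁻¹ := by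
    apply Real.log_le_log (by norm_num)
    rw [le_inv_comm₀ (by norm_num) hε]; linarith
  set l := Real.log ε⁻¹ with hl
  have hl0 : 0 ≤ l := by linarith
  have hlog0 : 0 < Real.log 2 := by linarith
  set r := ⌈4 * l / Real.log 2⌉₊ with hr
  set m := ⌈2 / η⌉₊ with hm
  have hm0 : 0 < m := Nat.ceil_pos.2 (by positivity)
  have hm1 : 2 / η ≤ m := Nat.le_ceil _
  have hm2 : (m : ℝ) ≤ 3 * η⁻¹ := by
    have h1 := (Nat.ceil_lt_add_one (by positivity : (0 : ℝ) ≤ 2 / η)).le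
    have h2 : 1 ≤ η⁻¹ := (one_le_inv₀ hη).2 hη1
    have h3 : 2 / η = 2 * η⁻¹ := div_eq_mul_inv _ _
    rw [hm]; linarith
  have hr1 : 4 * l / Real.log 2 ≤ r := Nat.le_ceil _
  have hr2 : (r : ℝ) + 1 ≤ 12 * l := by
    have h1 := (Nat.ceil_lt_add_one (by positivity : (0 : ℝ) ≤ 4 * l / Real.log 2)).le
    have h2 : 4 * l / Real.log 2 ≤ 8 * l := by
      rw [div_le_iff₀ (by linarith)]; nlinarith
    have : (r : ℝ) ≤ 8 * l + 1 := by linarith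
    linarith
  have hrε : (1 / 2 : ℝ) ^ r ≤ ε ^ 2 / 4 := by
    have h1 : 4 * l ≤ r * Real.log 2 := (div_le_iff₀ (by linarith)).1 hr1
    have h2 : (2 : ℝ) ^ r = Real.exp (r * Real.log 2) := by
      rw [Real.exp_nat_mul, Real.exp_log (by norm_num)]
    have h3 : 4 * (ε ^ 2)⁻¹ ≤ 2 ^ r := by
      have h4 : Real.exp (4 * l) = ε⁻¹ ^ 4 := by
        rw [show (4 : ℝ) * l = ((4 : ℕ) : ℝ) * l by norm_num, Real.exp_nat_mul, hl,
          Real.exp_log (by positivity)]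
      rw [h2]
      refine le_trans ?_ (Real.exp_le_exp.2 h1)
      rw [h4]
      have h5 : 2 ≤ ε⁻¹ := by rw [le_inv_comm₀ (by norm_num) hε]; linarith
      rw [← inv_pow]
      have h6 : (4 : ℝ) ≤ ε⁻¹ ^ 2 := by nlinarith
      nlinarith [sq_nonneg ε⁻¹]
    rw [one_div, inv_pow, inv_le_comm₀ (by positivity) (by positivity)]
    calc (ε ^ 2 / 4)⁻¹ = 4 * (ε ^ 2)⁻¹ := by rw [inv_div]; ring
      _ ≤ _ := h3
  obtain ⟨P, hP, h1, h2⟩ := exists_halfBand_of_params m r hm0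
    ((div_le_iff₀ hη).1 hm1) hε (by linarith) hrε
  refine ⟨(r + 1) * m, P, ?_, hP, h1, h2⟩
  push_cast
  have h3 : 0 ≤ η⁻¹ := by positivity
  calc ((r : ℝ) + 1) * m ≤ (12 * l) * (3 * η⁻¹) := by
        apply mul_le_mul hr2 hm2 (by positivity) (by positivity)
    _ = _ := by ring

end Filter

/-! ### From operator norms to trace and diamond norms; rotating one unit vector to another. -/

section Norm

open ComplexConjugate
open scoped Matrix.Norms.L2Operator

/-! ### Euclidean norm of vectors, operator norm of matrices -/

section Norms

variable {m n p ι : Type*} [Fintype m] [Fintype n] [Fintype p] [Fintype ι]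

/-- The Euclidean norm. -/
noncomputable def vnorm (v : m → ℂ) : ℝ := ‖(WithLp.toLp 2 v : EuclideanSpace ℂ m)‖

theorem vnorm_nonneg (v : m → ℂ) : 0 ≤ vnorm v := norm_nonneg _

theorem vnorm_sq (v : m → ℂ) : vnorm v ^ 2 = ∑ i, ‖v i‖ ^ 2 := by
  rw [vnorm, EuclideanSpace.norm_sq_eq]

theorem vnorm_le_iff {v : m → ℂ} {r : ℝ} (hr : 0 ≤ r) : vnorm v ≤ r ↔ ∑ i, ‖v i‖ ^ 2 ≤ r ^ 2 := by
  rw [← vnorm_sq, sq_le_sq₀ (vnorm_nonneg v) hr]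

theorem vnorm_add_le (v w : m → ℂ) : vnorm (v + w) ≤ vnorm v + vnorm w := by
  simpa [vnorm, WithLp.toLp_add] using norm_add_le (WithLp.toLp 2 v : EuclideanSpace ℂ m)
    (WithLp.toLp 2 w)

theorem vnorm_smul (c : ℂ) (v : m → ℂ) : vnorm (c • v) = ‖c‖ * vnorm v := by
  simp [vnorm, norm_smul]

theorem star_dotProduct_self (v : m → ℂ) : star v ⬝ᵥ v = ((vnorm v ^ 2 : ℝ) : ℂ) := by
  rw [vnorm_sq, dotProduct]
  push_cast
  refine Finset.sum_congr rfl fun i _ => ?_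
  rw [Pi.star_apply, RCLike.star_def, mul_comm, Complex.mul_conj, Complex.normSq_eq_norm_sq]
  push_cast
  rfl

theorem norm_star_dotProduct_le (v w : m → ℂ) : ‖star v ⬝ᵥ w‖ ≤ vnorm v * vnorm w := by
  have := norm_inner_le_norm (𝕜 := ℂ) (WithLp.toLp 2 v : EuclideanSpace ℂ m) (WithLp.toLp 2 w)
  rwa [EuclideanSpace.inner_toLp_toLp, dotProduct_comm] at this

variable [DecidableEq m] [DecidableEq n] [DecidableEq p] [DecidableEq ι]

theorem vnorm_mulVec_le (A : Matrix p m ℂ) (v : m → ℂ) : vnorm (A *ᵥ v) ≤ ‖A‖ * vnorm v :=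
  Matrix.l2_opNorm_mulVec A (WithLp.toLp 2 v)

theorem opNorm_le {A : Matrix p m ℂ} {r : ℝ} (hr : 0 ≤ r)
    (h : ∀ v : m → ℂ, vnorm (A *ᵥ v) ≤ r * vnorm v) : ‖A‖ ≤ r := by
  rw [Matrix.l2_opNorm_def]
  exact ContinuousLinearMap.opNorm_le_bound _ hr fun x => h x.ofLp

theorem vnorm_mulVec_of_isometry {A : Matrix p m ℂ} (h : Aᴴ * A = 1) (v : m → ℂ) :
    vnorm (A *ᵥ v) = vnorm v := by
  rw [← sq_eq_sq₀ (vnorm_nonneg _) (vnorm_nonneg _)]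
  have : star (A *ᵥ v) ⬝ᵥ (A *ᵥ v) = star v ⬝ᵥ v := by
    rw [star_mulVec, ← dotProduct_mulVec, mulVec_mulVec, h, one_mulVec]
  rw [star_dotProduct_self, star_dotProduct_self] at this
  exact_mod_cast this

theorem opNorm_le_one_of_isometry {A : Matrix p m ℂ} (h : Aᴴ * A = 1) : ‖A‖ ≤ 1 := by
  refine opNorm_le zero_le_one fun v => ?_
  rw [one_mul, vnorm_mulVec_of_isometry h]

theorem opNorm_blockDiagonal_le {A : ι → Matrix p m ℂ} {r : ℝ} (hr : 0 ≤ r)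
    (h : ∀ j, ‖A j‖ ≤ r) : ‖blockDiagonal A‖ ≤ r := by
  refine opNorm_le hr fun v => ?_
  rw [vnorm_le_iff (mul_nonneg hr (vnorm_nonneg v)), mul_pow, vnorm_sq v]
  have e : ∀ a : p × ι, (blockDiagonal A *ᵥ v) a = (A a.2 *ᵥ fun i => v (i, a.2)) a.1 := by
    rintro ⟨a, j⟩
    simp only [mulVec, dotProduct, blockDiagonal_apply, Fintype.sum_prod_type]
    refine Finset.sum_congr rfl fun i _ => ?_
    simp
  simp_rw [e]
  rw [Fintype.sum_prod_type_right, Fintype.sum_prod_type_right, Finset.mul_sum]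
  refine Finset.sum_le_sum fun j _ => ?_
  have h1 := vnorm_mulVec_le (A j) fun i => v (i, j)
  have h2 : vnorm (A j *ᵥ fun i => v (i, j)) ≤ r * vnorm fun i => v (i, j) :=
    h1.trans (mul_le_mul_of_nonneg_right (h j) (vnorm_nonneg _))
  have h3 := pow_le_pow_left₀ (vnorm_nonneg _) h2 2
  rwa [mul_pow, vnorm_sq, vnorm_sq] at h3

/-! ### Trace norm and diamond norm -/

/-- Polar decomposition: `V` is the pseudo-inverse of `|M|` times `Mᴴ`. This is the attained half of
the duality between trace norm and operator norm. -/
theorem exists_contraction_trace_eq_traceNorm (M : Matrix m m ℂ) :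
    ∃ V : Matrix m m ℂ, ‖V‖ ≤ 1 ∧ ((traceNorm M : ℝ) : ℂ) = (V * M).trace := by
  set hH := isHermitian_conjTranspose_mul_self M
  set U : Matrix m m ℂ := hH.eigenvectorUnitary.1 with hU
  set lam := hH.eigenvalues with hlam
  have hpos : ∀ i, 0 ≤ lam i := (posSemidef_conjTranspose_mul_self M).eigenvalues_nonneg
  have hUU : Uᴴ * U = 1 := Matrix.mem_unitaryGroup_iff'.1 hH.eigenvectorUnitary.2
  have hUU' : U * Uᴴ = 1 := Matrix.mem_unitaryGroup_iff.1 hH.eigenvectorUnitary.2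
  have hspec : Mᴴ * M = U * diagonal (fun i => (lam i : ℂ)) * Uᴴ := by
    have := hH.spectral_theorem
    rw [Unitary.conjStarAlgAut_apply] at this
    exact this
  -- The convention `0⁻¹ = 0` makes this the pseudo-inverse on the kernel of `M`.
  set d : m → ℝ := fun i => (Real.sqrt (lam i))⁻¹ with hd
  have hdl : ∀ i, d i * lam i = Real.sqrt (lam i) := by
    intro i
    simp only [hd]
    nth_rewrite 2 [← Real.mul_self_sqrt (hpos i)]
    by_cases h0 : Real.sqrt (lam i) = 0
    · simp [h0]
    · field_simp
  have hddl : ∀ i, d i * lam i * d i ≤ 1 := by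
    intro i
    rw [hdl]
    exact mul_inv_le_one
  have hdiag : (diagonal fun i => (d i : ℂ))ᴴ = diagonal fun i => (d i : ℂ) := by
    rw [diagonal_conjTranspose]
    congr 1
    ext i
    simp
  refine ⟨U * diagonal (fun i => (d i : ℂ)) * Uᴴ * Mᴴ, ?_, ?_⟩
  · set V := U * diagonal (fun i => (d i : ℂ)) * Uᴴ * Mᴴ with hV
    have hVV : V * Vᴴ = U * diagonal (fun i => ((d i * lam i * d i : ℝ) : ℂ)) * Uᴴ := by
      have : V * Vᴴ = U * diagonal (fun i => (d i : ℂ)) * Uᴴ * (Mᴴ * M) *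
          (U * diagonal (fun i => (d i : ℂ)) * Uᴴ) := by
        rw [hV]
        simp only [conjTranspose_mul, conjTranspose_conjTranspose, hdiag, Matrix.mul_assoc]
      rw [this, hspec]
      calc _ = U * diagonal (fun i => (d i : ℂ)) * (Uᴴ * U) * diagonal (fun i => (lam i : ℂ)) *
            (Uᴴ * U) * diagonal (fun i => (d i : ℂ)) * Uᴴ := by
            simp only [Matrix.mul_assoc]
        _ = _ := by
          rw [hUU]
          simp only [Matrix.mul_one, Matrix.mul_assoc U, diagonal_mul_diagonal]
          push_cast
          rfl
    have h1 : ‖V‖ * ‖V‖ ≤ 1 := by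
      have := Matrix.l2_opNorm_conjTranspose_mul_self Vᴴ
      rw [conjTranspose_conjTranspose, l2_opNorm_conjTranspose] at this
      rw [← this, hVV]
      have hU1 := opNorm_le_one_of_isometry hUU
      have hU2 : ‖Uᴴ‖ ≤ 1 := by rwa [l2_opNorm_conjTranspose]
      have hD : ‖(diagonal (fun i => ((d i * lam i * d i : ℝ) : ℂ)) : Matrix m m ℂ)‖ ≤ 1 := by
        rw [l2_opNorm_diagonal, pi_norm_le_iff_of_nonneg zero_le_one]
        intro i
        rw [Complex.norm_real, Real.norm_eq_abs, abs_of_nonneg]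
        · exact hddl i
        · have : 0 ≤ d i := inv_nonneg.2 (Real.sqrt_nonneg _)
          have := hpos i
          positivity
      refine (l2_opNorm_mul _ _).trans ?_
      have h2 := (l2_opNorm_mul U (diagonal (fun i => ((d i * lam i * d i : ℝ) : ℂ)))).trans
        (mul_le_one₀ hU1 (norm_nonneg _) hD)
      exact mul_le_one₀ h2 (norm_nonneg _) hU2
    nlinarith [norm_nonneg V]
  · rw [Matrix.mul_assoc _ Mᴴ M, hspec]
    have : U * diagonal (fun i => (d i : ℂ)) * Uᴴ * (U * diagonal (fun i => (lam i : ℂ)) * Uᴴ) =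
        U * (diagonal (fun i => ((Real.sqrt (lam i) : ℝ) : ℂ)) * Uᴴ) := by
      calc _ = U * diagonal (fun i => (d i : ℂ)) * (Uᴴ * U) * diagonal (fun i => (lam i : ℂ)) *
            Uᴴ := by simp only [Matrix.mul_assoc]
        _ = _ := by
          rw [hUU]
          simp only [Matrix.mul_one, Matrix.mul_assoc U, diagonal_mul_diagonal]
          simp_rw [← hdl]
          push_cast
          rfl
    rw [this, trace_mul_comm, Matrix.mul_assoc, hUU, Matrix.mul_one, trace_diagonal, traceNorm]
    push_cast
    rfl

open scoped MatrixOrder in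
theorem PosSemidef.exists_conjTranspose_mul_self {ρ : Matrix m m ℂ} (hρ : ρ.PosSemidef) :
    ∃ B : Matrix m m ℂ, ρ = Bᴴ * B :=
  CStarAlgebra.nonneg_iff_eq_star_mul_self.1 hρ.nonneg

/-- Factoring `ρ = Bᴴ * B` turns the trace into a sum of `⟨b, A b⟩` over vectors `b` whose squared
norms add up to `1`. -/
theorem norm_trace_mul_density_le (A : Matrix m m ℂ) {ρ : Matrix m m ℂ} (hρ : IsDensity ρ) :
    ‖(A * ρ).trace‖ ≤ ‖A‖ := by
  obtain ⟨B, rfl⟩ := PosSemidef.exists_conjTranspose_mul_self hρ.1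
  have hB : ∑ i, vnorm (Bᴴ.col i) ^ 2 = 1 := by
    have h := hρ.2
    rw [trace_mul_comm] at h
    have e : (B * Bᴴ).trace = ((∑ i, vnorm (Bᴴ.col i) ^ 2 : ℝ) : ℂ) := by
      rw [Matrix.trace, Complex.ofReal_sum]
      refine Finset.sum_congr rfl fun i _ => ?_
      rw [← star_dotProduct_self]
      simp [Matrix.diag, Matrix.mul_apply, dotProduct, Matrix.col]
    rw [e] at h
    exact_mod_cast h
  have e : (A * (Bᴴ * B)).trace = ∑ i, star (Bᴴ.col i) ⬝ᵥ (A *ᵥ Bᴴ.col i) := by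
    rw [← Matrix.mul_assoc, trace_mul_comm, Matrix.trace]
    refine Finset.sum_congr rfl fun i _ => ?_
    simp [Matrix.diag, Matrix.mul_apply, dotProduct, Matrix.col, mulVec]
  rw [e]
  calc _ ≤ ∑ i, ‖star (Bᴴ.col i) ⬝ᵥ (A *ᵥ Bᴴ.col i)‖ := norm_sum_le _ _
    _ ≤ ∑ i, ‖A‖ * vnorm (Bᴴ.col i) ^ 2 := by
      refine Finset.sum_le_sum fun i _ => ?_
      have h1 := norm_star_dotProduct_le (Bᴴ.col i) (A *ᵥ Bᴴ.col i)
      have h2 := vnorm_mulVec_le A (Bᴴ.col i)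
      nlinarith [vnorm_nonneg (Bᴴ.col i)]
    _ = ‖A‖ := by rw [← Finset.mul_sum, hB, mul_one]

/-- With `D = W - T` the difference is `D ρ Wᴴ + T ρ Dᴴ`. Testing against the contraction of the
polar decomposition bounds each term by `‖D‖`. -/
theorem traceNorm_conj_sub_le {W T : Matrix p m ℂ} {ρ : Matrix m m ℂ} (hρ : IsDensity ρ)
    (hW : ‖W‖ ≤ 1) (hT : ‖T‖ ≤ 1) : traceNorm (W * ρ * Wᴴ - T * ρ * Tᴴ) ≤ 2 * ‖W - T‖ := by
  obtain ⟨V, hV, hVt⟩ := exists_contraction_trace_eq_traceNorm (W * ρ * Wᴴ - T * ρ * Tᴴ)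
  set D := W - T with hD
  have hsplit : (V * (W * ρ * Wᴴ - T * ρ * Tᴴ)).trace =
      (Wᴴ * V * D * ρ).trace + (Dᴴ * V * T * ρ).trace := by
    have : V * (W * ρ * Wᴴ - T * ρ * Tᴴ) = (V * D * ρ) * Wᴴ + (V * T * ρ) * Dᴴ := by
      simp only [hD, conjTranspose_sub, Matrix.mul_sub, Matrix.sub_mul, Matrix.mul_assoc]
      abel
    rw [this, trace_add, trace_mul_comm _ Wᴴ, trace_mul_comm _ Dᴴ]
    simp only [Matrix.mul_assoc]
  have hW' : ‖Wᴴ‖ ≤ 1 := by rwa [l2_opNorm_conjTranspose]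
  have h1 : ‖Wᴴ * V * D‖ ≤ ‖D‖ := by
    have a := (l2_opNorm_mul Wᴴ V).trans (mul_le_one₀ hW' (norm_nonneg _) hV)
    exact (l2_opNorm_mul _ _).trans (mul_le_of_le_one_left (norm_nonneg _) a)
  have h2 : ‖Dᴴ * V * T‖ ≤ ‖D‖ := by
    rw [Matrix.mul_assoc]
    have a := (l2_opNorm_mul V T).trans (mul_le_one₀ hV (norm_nonneg _) hT)
    refine (l2_opNorm_mul _ _).trans ?_
    rw [l2_opNorm_conjTranspose]
    exact mul_le_of_le_one_right (norm_nonneg _) a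
  calc traceNorm (W * ρ * Wᴴ - T * ρ * Tᴴ)
      ≤ ‖((traceNorm (W * ρ * Wᴴ - T * ρ * Tᴴ) : ℝ) : ℂ)‖ := by
        rw [Complex.norm_real]; exact le_abs_self _
    _ ≤ ‖(Wᴴ * V * D * ρ).trace‖ + ‖(Dᴴ * V * T * ρ).trace‖ := by
        rw [hVt, hsplit]; exact norm_add_le _ _
    _ ≤ ‖Wᴴ * V * D‖ + ‖Dᴴ * V * T‖ :=
        add_le_add (norm_trace_mul_density_le _ hρ) (norm_trace_mul_density_le _ hρ)
    _ ≤ 2 * ‖D‖ := by linarith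

theorem tensorId_conjMap {r : Type*} [Fintype r] [DecidableEq r] (W : Matrix p m ℂ)
    (X : Matrix (m × r) (m × r) ℂ) :
    tensorId r (conjMap W) X =
      blockDiagonal (fun _ : r => W) * X * (blockDiagonal fun _ : r => W)ᴴ := by
  ext ⟨a, s⟩ ⟨b, t⟩
  simp only [tensorId, conjMap, LinearMap.coe_mk, AddHom.coe_mk, Matrix.of_apply, Matrix.mul_apply,
    conjTranspose_apply, blockDiagonal_apply, Fintype.sum_prod_type]
  simp [ite_mul, apply_ite]

/-- A reference system replaces `W` and `T` by block diagonal matrices with equal blocks. Operator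
norms do not grow, so the bound is uniform in the dimension of the reference. -/
theorem diamondNorm_conjMap_sub_le {W T : Matrix p m ℂ} (hW : ‖W‖ ≤ 1) (hT : ‖T‖ ≤ 1) {ε δ : ℝ}
    (h : ‖W - T‖ ≤ ε) (hεδ : 2 * ε ≤ δ) :
    diamondNorm (conjMap W - conjMap T) ≤ ENNReal.ofReal δ := by
  refine iSup_le fun k => iSup_le fun ρ => iSup_le fun hρ => ENNReal.ofReal_le_ofReal ?_
  have e : tensorId (Fin k) (conjMap W - conjMap T) ρ =
      tensorId (Fin k) (conjMap W) ρ - tensorId (Fin k) (conjMap T) ρ := by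
    ext a b; simp [tensorId]
  rw [e, tensorId_conjMap, tensorId_conjMap]
  refine (traceNorm_conj_sub_le hρ (opNorm_blockDiagonal_le zero_le_one fun _ => hW)
    (opNorm_blockDiagonal_le zero_le_one fun _ => hT)).trans ?_
  have e2 : blockDiagonal (fun _ : Fin k => W) - blockDiagonal (fun _ : Fin k => T) =
      blockDiagonal fun _ : Fin k => W - T := by
    rw [← blockDiagonal_sub]; rfl
  rw [e2]
  have := opNorm_blockDiagonal_le (norm_nonneg (W - T)) (A := fun _ : Fin k => W - T)
    fun _ => le_rfl
  linarith

/-! ### A unitary close to the identity that takes one unit vector to another -/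

theorem opNorm_vecMulVec_star_le (a b : m → ℂ) :
    ‖vecMulVec a (star b)‖ ≤ vnorm a * vnorm b := by
  refine opNorm_le (mul_nonneg (vnorm_nonneg a) (vnorm_nonneg b)) fun x => ?_
  have : vecMulVec a (star b) *ᵥ x = (star b ⬝ᵥ x) • a := by
    rw [vecMulVec_mulVec]; ext i; simp [mul_comm]
  rw [this, vnorm_smul]
  have := norm_star_dotProduct_le b x
  nlinarith [vnorm_nonneg a]

/-- The reflection in the hyperplane orthogonal to a unit vector. -/
noncomputable def householder (a : m → ℂ) : Matrix m m ℂ := 1 - (2 : ℂ) • vecMulVec a (star a)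

theorem householder_conjTranspose (a : m → ℂ) : (householder a)ᴴ = householder a := by
  rw [householder, conjTranspose_sub, conjTranspose_smul, conjTranspose_one,
    conjTranspose_vecMulVec]
  simp

theorem householder_mul_self {a : m → ℂ} (ha : vnorm a = 1) :
    householder a * householder a = 1 := by
  have h : vecMulVec a (star a) * vecMulVec a (star a) = vecMulVec a (star a) := by
    rw [vecMulVec_mul_vecMulVec, star_dotProduct_self, ha]; simp
  simp only [householder, Matrix.mul_sub, Matrix.sub_mul, Matrix.mul_one, Matrix.one_mul,
    Matrix.smul_mul, Matrix.mul_smul, h]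
  module

theorem householder_mulVec (a x : m → ℂ) : householder a *ᵥ x = x - (2 * (star a ⬝ᵥ x)) • a := by
  rw [householder, sub_mulVec, one_mulVec, smul_mulVec, vecMulVec_mulVec]
  ext i; simp; ring

/-- Reflect in `u`, then in the normalised midpoint `a` of `u` and `v`: `u ↦ -u ↦ v`. The second
step needs a real inner product, and `c ≥ 0` ensures `u + v ≠ 0`. As `a` is no farther from `u` than
`v` is, the two reflections nearly cancel. -/
theorem exists_unitary_near_one {u v : m → ℂ} (hu : vnorm u = 1) (hv : vnorm v = 1) {c : ℝ}
    (hc : 0 ≤ c) (hvu : star v ⬝ᵥ u = c) :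
    ∃ R : Matrix.unitaryGroup m ℂ, R.1 *ᵥ u = v ∧ ‖R.1 - 1‖ ≤ 4 * vnorm (u - v) := by
  have huv : star u ⬝ᵥ v = c := by
    have := congrArg star hvu
    rw [star_dotProduct, star_star] at this
    simpa [dotProduct_comm] using this
  have hs2 : vnorm (u + v) ^ 2 = 2 + 2 * c := by
    have h := star_dotProduct_self (u + v)
    rw [star_add, add_dotProduct, dotProduct_add, dotProduct_add, star_dotProduct_self,
      star_dotProduct_self, hu, hv, huv, hvu] at h
    have : ((vnorm (u + v) ^ 2 : ℝ) : ℂ) = ((2 + 2 * c : ℝ) : ℂ) := by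
      rw [← h]; push_cast; ring
    exact_mod_cast this
  set s := vnorm (u + v) with hs
  have hs0 : 0 < s := by
    rcases (vnorm_nonneg (u + v)).lt_or_eq with h | h
    · exact h
    · rw [← hs] at h; rw [← h] at hs2; nlinarith
  have hs_le : s ≤ 2 := by
    have := vnorm_add_le u v; rw [hu, hv] at this; linarith
  set a : m → ℂ := ((s⁻¹ : ℝ) : ℂ) • (u + v) with ha
  have ha1 : vnorm a = 1 := by
    rw [ha, vnorm_smul, Complex.norm_real, Real.norm_eq_abs, abs_of_pos (inv_pos.2 hs0), ← hs,
      inv_mul_cancel₀ hs0.ne']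
  have hua : vnorm (u - a) ≤ vnorm (u - v) := by
    have e : u - a = (1 / 2 : ℂ) • (u - v) + ((1 / 2 - s⁻¹ : ℝ) : ℂ) • (u + v) := by
      rw [ha]; push_cast; module
    have h1 : vnorm (u - a) ≤ 1 / 2 * vnorm (u - v) + (1 - s / 2) := by
      rw [e]
      refine (vnorm_add_le _ _).trans ?_
      rw [vnorm_smul, vnorm_smul, ← hs, Complex.norm_real, Real.norm_eq_abs, abs_of_nonpos]
      · have : -(1 / 2 - s⁻¹) * s = 1 - s / 2 := by field_simp; ring
        rw [this]; norm_num
      · have : 1 / 2 ≤ s⁻¹ := by rw [le_inv_comm₀ (by norm_num) hs0]; linarith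
        linarith
    have h2 : 2 ≤ s + vnorm (u - v) := by
      have e2 : (2 : ℂ) • u = (u + v) + (u - v) := by module
      have := vnorm_add_le (u + v) (u - v)
      rw [← e2, vnorm_smul, hu] at this
      simpa using this
    linarith
  have hmem : householder a * householder u ∈ Matrix.unitaryGroup m ℂ := by
    rw [Matrix.mem_unitaryGroup_iff, star_eq_conjTranspose, conjTranspose_mul,
      householder_conjTranspose, householder_conjTranspose, Matrix.mul_assoc,
      ← Matrix.mul_assoc (householder u), householder_mul_self hu, Matrix.one_mul,
      householder_mul_self ha1]
  refine ⟨⟨householder a * householder u, hmem⟩, ?_, ?_⟩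
  · have h1 : householder u *ᵥ u = -u := by
      rw [householder_mulVec, star_dotProduct_self, hu]
      push_cast; module
    have h2 : star a ⬝ᵥ (-u) = -((s⁻¹ * (1 + c) : ℝ) : ℂ) := by
      rw [dotProduct_neg, ha, star_smul, smul_dotProduct, star_add, add_dotProduct,
        star_dotProduct_self, hu, hvu]
      simp
    rw [← mulVec_mulVec, h1, householder_mulVec, h2, ha, smul_smul]
    have h3 : 2 * -((s⁻¹ * (1 + c) : ℝ) : ℂ) * ((s⁻¹ : ℝ) : ℂ) = -1 := by
      have : 2 * (s⁻¹ * (1 + c)) * s⁻¹ = 1 := by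
        have : 1 + c = s ^ 2 / 2 := by linarith
        rw [this]; field_simp
      have h : 2 * -(s⁻¹ * (1 + c)) * s⁻¹ = -1 := by linarith
      exact_mod_cast h
    rw [h3]
    module
  · have hH : ‖householder u‖ ≤ 1 := opNorm_le_one_of_isometry (by
      rw [householder_conjTranspose, householder_mul_self hu])
    have e : householder a * householder u - 1 =
        ((2 : ℂ) • (vecMulVec (u - a) (star u) + vecMulVec a (star (u - a)))) * householder u := by
      rw [← householder_mul_self hu, ← Matrix.sub_mul]
      congr 1
      rw [householder, householder, star_sub, sub_vecMulVec, vecMulVec_sub]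
      module
    simp only [e]
    refine (l2_opNorm_mul _ _).trans ?_
    refine (mul_le_of_le_one_right (norm_nonneg _) hH).trans ?_
    rw [norm_smul]
    have h1 := opNorm_vecMulVec_star_le (u - a) u
    have h2 := opNorm_vecMulVec_star_le a (u - a)
    rw [hu] at h1
    rw [ha1] at h2
    have h3 := norm_add_le (vecMulVec (u - a) (star u)) (vecMulVec a (star (u - a)))
    have : ‖(2 : ℂ)‖ = 2 := by norm_num
    rw [this]
    linarith

end Norms

end Norm

/-! ### Circuits as families of scalar-oracle circuits, one for each eigenvector. -/

section Eigenbasis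

open ComplexConjugate
open scoped Matrix.Norms.L2Operator Kronecker

/-! ### Matrices acting on a subset of the qubits -/

section LocalMatrix

variable {ρ τ : Type*} [Fintype ρ] [DecidableEq ρ] [Fintype τ] [DecidableEq τ]

/-- The laws relating a function that reads a component of a state and one that overwrites it. -/
structure IsLens (get : ρ → τ) (set : ρ → τ → ρ) : Prop where
  get_set : ∀ a t, get (set a t) = t
  set_set : ∀ a s t, set (set a s) t = set a t
  set_get : ∀ a, set a (get a) = a

/-- The matrix that acts as `g` on a component of the state. -/
noncomputable def localMat (get : ρ → τ) (set : ρ → τ → ρ) (g : Matrix τ τ ℂ) : Matrix ρ ρ ℂ :=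
  Matrix.of fun a b => if b = set a (get b) then g (get a) (get b) else 0

variable {get : ρ → τ} {set : ρ → τ → ρ}

/-- The states that agree with `a` off the component are parametrised by the value of that
component, so products of local matrices reduce to products over `τ`. -/
theorem IsLens.sum_ite (h : IsLens get set) (a : ρ) (F : ρ → ℂ) :
    ∑ b, (if b = set a (get b) then F b else 0) = ∑ t, F (set a t) := by
  rw [← Finset.sum_filter]
  refine Finset.sum_nbij' get (set a) (fun _ _ => Finset.mem_univ _) (fun t _ => ?_)
    (fun b hb => ?_) (fun t _ => h.get_set a t) (fun b hb => ?_)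
  · simp [h.get_set]
  · exact (Finset.mem_filter.1 hb).2.symm
  · rw [← (Finset.mem_filter.1 hb).2]

theorem IsLens.localMat_mul (h : IsLens get set) (g g' : Matrix τ τ ℂ) :
    localMat get set g * localMat get set g' = localMat get set (g * g') := by
  ext a c
  simp only [localMat, Matrix.mul_apply, Matrix.of_apply, ite_mul, zero_mul]
  rw [h.sum_ite a fun b => g (get a) (get b) * if c = set b (get c) then g' (get b) (get c) else 0]
  simp only [h.get_set, h.set_set]
  split_ifs <;> simp

theorem IsLens.localMat_one (h : IsLens get set) : localMat get set 1 = 1 := by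
  ext a b
  simp only [localMat, Matrix.of_apply, Matrix.one_apply]
  by_cases hab : a = b
  · subst hab; simp [h.set_get]
  · rw [if_neg hab]
    split_ifs with h1 h2
    · rw [← h2, h.set_get] at h1
      exact absurd h1.symm hab
    · rfl
    · rfl

theorem IsLens.localMat_conjTranspose (h : IsLens get set) (g : Matrix τ τ ℂ) :
    (localMat get set g)ᴴ = localMat get set gᴴ := by
  have key : ∀ a b, b = set a (get b) → a = set b (get a) := by
    intro a b hb
    rw [hb, h.set_set, h.set_get]
  ext a b
  simp only [localMat, conjTranspose_apply, Matrix.of_apply]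
  by_cases hb : b = set a (get b)
  · rw [if_pos hb, if_pos (key a b hb)]
  · rw [if_neg hb, if_neg fun h' => hb (key b a h')]; simp

theorem IsLens.localMat_isometry (h : IsLens get set) (g : Matrix.unitaryGroup τ ℂ) :
    (localMat get set g.1)ᴴ * localMat get set g.1 = 1 := by
  rw [h.localMat_conjTranspose, h.localMat_mul]
  have : g.1ᴴ * g.1 = 1 := Matrix.mem_unitaryGroup_iff'.1 g.2
  rw [this, h.localMat_one]

end LocalMatrix

section Semantics

variable {n : ℕ}

theorem isLens_one (q : Fin n) :
    IsLens (fun a : Reg n => a q) (fun a t => Function.update a q t) where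
  get_set a t := by simp
  set_set a s t := by simp
  set_get a := by simp

theorem isLens_two {p q : Fin n} (hpq : p ≠ q) :
    IsLens (fun a : Reg n => (a p, a q))
      (fun a t => Function.update (Function.update a p t.1) q t.2) where
  get_set a t := by simp [hpq]
  set_set a s t := by
    rw [Function.update_comm hpq.symm, Function.update_idem, Function.update_idem]
  set_get a := by simp

theorem eq_update_iff {a b : Reg n} {q : Fin n} :
    b = Function.update a q (b q) ↔ ∀ r, r ≠ q → a r = b r := by
  constructor
  · intro h r hr
    rw [h]; simp [hr]
  · intro h
    ext r
    by_cases hr : r = q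
    · subst hr; simp
    · simp [hr, h r hr]

theorem eq_update_update_iff {a b : Reg n} {p q : Fin n} :
    b = Function.update (Function.update a p (b p)) q (b q) ↔
      ∀ r, r ≠ p → r ≠ q → a r = b r := by
  constructor
  · intro h r hp hq
    rw [h]; simp [hp, hq]
  · intro h
    ext r
    by_cases hq : r = q
    · subst hq; simp
    · by_cases hp : r = p
      · subst hp; simp [hq]
      · simp [hp, hq, h r hp hq]

/-- The action of a gate on the register when the oracle is multiplication by the scalar `z`. -/
noncomputable def Gate.act (z : ℂ) : Gate n → Matrix (Reg n) (Reg n) ℂ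
  | .one q g => localMat (fun a => a q) (fun a t => Function.update a q t) g.1
  | .two p q _ g => localMat (fun a => (a p, a q))
      (fun a t => Function.update (Function.update a p t.1) q t.2) g.1
  | .query q => Matrix.diagonal fun a => if a q = true then z else 1
  | .queryInv q => Matrix.diagonal fun a => if a q = true then conj z else 1

/-- The action of a circuit on the register when the oracle is multiplication by `z`. -/
noncomputable def Circuit.act (z : ℂ) : Circuit n → Matrix (Reg n) (Reg n) ℂ
  | [] => 1
  | g :: c => Circuit.act z c * g.act z

theorem Circuit.act_append (z : ℂ) (c c' : Circuit n) :
    Circuit.act z (c ++ c') = Circuit.act z c' * Circuit.act z c := by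
  induction c with
  | nil => simp [Circuit.act]
  | cons g c ih =>
    rw [List.cons_append, Circuit.act, ih, Circuit.act, Matrix.mul_assoc]

theorem Gate.act_isometry {z : ℂ} (hz : ‖z‖ = 1) (g : Gate n) : (g.act z)ᴴ * g.act z = 1 := by
  have h1 : conj z * z = 1 := by
    rw [mul_comm, Complex.mul_conj, Complex.normSq_eq_norm_sq, hz]; simp
  cases g with
  | one q g => exact (isLens_one q).localMat_isometry g
  | two p q h g => exact (isLens_two h).localMat_isometry g
  | query q =>
    rw [Gate.act, diagonal_conjTranspose, diagonal_mul_diagonal, ← diagonal_one]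
    congr 1; ext a
    by_cases h : a q = true <;> simp [h, h1]
  | queryInv q =>
    rw [Gate.act, diagonal_conjTranspose, diagonal_mul_diagonal, ← diagonal_one]
    congr 1; ext a
    by_cases h : a q = true <;> simp [h, mul_comm z, h1]

theorem Circuit.act_isometry {z : ℂ} (hz : ‖z‖ = 1) (c : Circuit n) :
    (Circuit.act z c)ᴴ * Circuit.act z c = 1 := by
  induction c with
  | nil => simp [Circuit.act]
  | cons g c ih =>
    rw [Circuit.act, conjTranspose_mul, Matrix.mul_assoc, ← Matrix.mul_assoc _ _ (g.act z), ih,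
      Matrix.one_mul, g.act_isometry hz]

/-! ### Reduction to an eigenbasis of the oracle -/

variable {ι : Type*} [Fintype ι] [DecidableEq ι] {p m q : Type*} [Fintype p] [DecidableEq p]
  [Fintype m] [DecidableEq m] [Fintype q] [DecidableEq q]

/-- The matrix that acts as `A j` on the first factor if the second factor is in the state given
by column `j` of `V`. -/
noncomputable def blockSum (V : Matrix ι ι ℂ) (A : ι → Matrix p m ℂ) :
    Matrix (p × ι) (m × ι) ℂ :=
  ((1 : Matrix p p ℂ) ⊗ₖ V) * blockDiagonal A * ((1 : Matrix m m ℂ) ⊗ₖ Vᴴ)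

theorem blockSum_mul {V : Matrix ι ι ℂ} (hV : Vᴴ * V = 1) (A : ι → Matrix p m ℂ)
    (B : ι → Matrix m q ℂ) : blockSum V A * blockSum V B = blockSum V fun j => A j * B j := by
  have h : ((1 : Matrix m m ℂ) ⊗ₖ Vᴴ) * ((1 : Matrix m m ℂ) ⊗ₖ V) = 1 := by
    rw [← mul_kronecker_mul, hV, Matrix.one_mul, one_kronecker_one]
  rw [blockSum, blockSum, blockSum, blockDiagonal_mul]
  calc _ = ((1 : Matrix p p ℂ) ⊗ₖ V) * blockDiagonal A *
        (((1 : Matrix m m ℂ) ⊗ₖ Vᴴ) * ((1 : Matrix m m ℂ) ⊗ₖ V)) * blockDiagonal B *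
        ((1 : Matrix q q ℂ) ⊗ₖ Vᴴ) := by simp only [Matrix.mul_assoc]
    _ = _ := by rw [h, Matrix.mul_one, Matrix.mul_assoc _ (blockDiagonal A)]

theorem blockSum_conjTranspose (V : Matrix ι ι ℂ) (A : ι → Matrix p m ℂ) :
    (blockSum V A)ᴴ = blockSum V fun j => (A j)ᴴ := by
  rw [blockSum, blockSum, conjTranspose_mul, conjTranspose_mul, conjTranspose_kronecker,
    conjTranspose_kronecker, conjTranspose_one, conjTranspose_one, conjTranspose_conjTranspose,
    Matrix.mul_assoc, blockDiagonal_conjTranspose]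

theorem blockSum_sub (V : Matrix ι ι ℂ) (A B : ι → Matrix p m ℂ) :
    blockSum V A - blockSum V B = blockSum V fun j => A j - B j := by
  rw [blockSum, blockSum, blockSum, ← Matrix.sub_mul, ← Matrix.mul_sub, ← blockDiagonal_sub]
  rfl

theorem blockSum_const {V : Matrix ι ι ℂ} (hV : V * Vᴴ = 1) (A : Matrix p m ℂ) :
    blockSum V (fun _ => A) = A ⊗ₖ (1 : Matrix ι ι ℂ) := by
  rw [blockSum, ← kronecker_one, ← mul_kronecker_mul, ← mul_kronecker_mul, Matrix.one_mul,
    Matrix.mul_one, Matrix.mul_one, hV]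

theorem opNorm_kronecker_one_le {V : Matrix ι ι ℂ} (hV : Vᴴ * V = 1) :
    ‖((1 : Matrix p p ℂ) ⊗ₖ V)‖ ≤ 1 := by
  refine opNorm_le_one_of_isometry ?_
  rw [conjTranspose_kronecker, ← mul_kronecker_mul, hV, conjTranspose_one, Matrix.one_mul,
    one_kronecker_one]

theorem opNorm_blockSum_le {V : Matrix ι ι ℂ} (hV : Vᴴ * V = 1) {A : ι → Matrix p m ℂ} {r : ℝ}
    (hr : 0 ≤ r) (h : ∀ j, ‖A j‖ ≤ r) : ‖blockSum V A‖ ≤ r := by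
  have h1 := opNorm_kronecker_one_le (p := p) hV
  have h2 : ‖((1 : Matrix m m ℂ) ⊗ₖ Vᴴ)‖ ≤ 1 := by
    have := opNorm_kronecker_one_le (p := m) hV
    rwa [← l2_opNorm_conjTranspose, conjTranspose_kronecker, conjTranspose_one] at this
  have h3 := opNorm_blockDiagonal_le hr h
  have h4 : ‖((1 : Matrix p p ℂ) ⊗ₖ V) * blockDiagonal A‖ ≤ r :=
    (l2_opNorm_mul _ _).trans ((mul_le_of_le_one_left (norm_nonneg _) h1).trans h3)
  exact (l2_opNorm_mul _ _).trans ((mul_le_of_le_one_right (norm_nonneg _) h2).trans h4)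

theorem kronecker_mulVec_tensor {r s : Type*} [Fintype r] [Fintype s] (A : Matrix p r ℂ)
    (B : Matrix m s ℂ) (v : r → ℂ) (w : s → ℂ) :
    (A ⊗ₖ B) *ᵥ tensor v w = tensor (A *ᵥ v) (B *ᵥ w) := by
  ext ⟨a, b⟩
  simp only [mulVec, dotProduct, tensor, kroneckerMap_apply, Fintype.sum_prod_type]
  rw [Finset.sum_mul_sum]
  refine Finset.sum_congr rfl fun i _ => Finset.sum_congr rfl fun j _ => by ring

theorem blockDiagonal_mulVec_tensor_single (A : ι → Matrix p m ℂ) (v : m → ℂ) (j : ι) :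
    blockDiagonal A *ᵥ tensor v (Pi.single j 1) = tensor (A j *ᵥ v) (Pi.single j 1) := by
  ext ⟨a, i⟩
  simp only [mulVec, dotProduct, tensor, blockDiagonal_apply, Fintype.sum_prod_type]
  by_cases h : i = j
  · subst h
    simp
  · simp [Pi.single_apply, h]

theorem blockSum_mulVec_tensor {V : Matrix ι ι ℂ} (hV : Vᴴ * V = 1) (A : ι → Matrix p m ℂ)
    (v : m → ℂ) (j : ι) : blockSum V A *ᵥ tensor v (V.col j) = tensor (A j *ᵥ v) (V.col j) := by
  have h1 : V.col j = V *ᵥ Pi.single j 1 := by simp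
  have h2 : Vᴴ *ᵥ V.col j = Pi.single j 1 := by rw [h1, mulVec_mulVec, hV, one_mulVec]
  rw [blockSum, ← mulVec_mulVec, ← mulVec_mulVec, kronecker_mulVec_tensor, h2, one_mulVec,
    blockDiagonal_mulVec_tensor_single, kronecker_mulVec_tensor, one_mulVec, ← h1]

/-- A controlled matrix is `P₀ ⊗ 1 + P₁ ⊗ W` with projections on the control; the change of basis on
the system does not touch them. -/
theorem controlled_eq_blockSum {V : Matrix ι ι ℂ} (hV : V * Vᴴ = 1) (z : ι → ℂ) (q : Fin n) :
    controlled q (V * diagonal z * Vᴴ) =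
      blockSum V fun j => diagonal fun a : Reg n => if a q = true then z j else 1 := by
  set P : Bool → Matrix (Reg n) (Reg n) ℂ := fun b =>
    diagonal fun a : Reg n => if a q = b then 1 else 0 with hP
  have e1 : ∀ W : Matrix ι ι ℂ, controlled q W =
      P false ⊗ₖ (1 : Matrix ι ι ℂ) + P true ⊗ₖ W := by
    intro W
    ext ⟨a, i⟩ ⟨b, j⟩
    simp only [controlled, Matrix.of_apply, Matrix.add_apply, kroneckerMap_apply, hP,
      diagonal_apply]
    by_cases hab : a = b
    · subst hab
      cases h : a q <;> simp
    · simp [hab]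
  have e2 : blockDiagonal (fun j => diagonal fun a : Reg n => if a q = true then z j else 1) =
      P false ⊗ₖ (1 : Matrix ι ι ℂ) + P true ⊗ₖ diagonal z := by
    rw [← e1]
    ext ⟨a, i⟩ ⟨b, j⟩
    simp only [controlled, Matrix.of_apply, blockDiagonal_apply, diagonal_apply, Matrix.one_apply]
    by_cases hab : a = b
    · subst hab
      cases h : a q <;> simp
    · simp [hab]
  rw [e1, blockSum, e2, Matrix.mul_add, Matrix.add_mul]
  simp only [← mul_kronecker_mul, Matrix.one_mul, Matrix.mul_one, hV]

theorem Gate.eval_eq_blockSum {V : Matrix ι ι ℂ} (hV : V * Vᴴ = 1) (z : ι → ℂ) (g : Gate n) :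
    g.eval (V * diagonal z * Vᴴ) = blockSum V fun j => g.act (z j) := by
  cases g with
  | one q g =>
    simp only [Gate.act]
    rw [blockSum_const hV]
    ext ⟨a, i⟩ ⟨b, j⟩
    simp only [Gate.eval, Matrix.of_apply, kroneckerMap_apply, localMat, Matrix.one_apply,
      eq_update_iff]
    by_cases h : i = j <;> simp [h]
  | two p q hpq g =>
    simp only [Gate.act]
    rw [blockSum_const hV]
    ext ⟨a, i⟩ ⟨b, j⟩
    simp only [Gate.eval, Matrix.of_apply, kroneckerMap_apply, localMat, Matrix.one_apply,
      eq_update_update_iff]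
    by_cases h : i = j <;> simp [h]
  | query q => exact controlled_eq_blockSum hV z q
  | queryInv q =>
    have : (V * diagonal z * Vᴴ)ᴴ = V * diagonal (fun j => conj (z j)) * Vᴴ := by
      rw [conjTranspose_mul, conjTranspose_mul, conjTranspose_conjTranspose,
        diagonal_conjTranspose, Matrix.mul_assoc]
      rfl
    rw [Gate.eval, this]
    exact controlled_eq_blockSum hV _ q

/-- The central reduction: in the eigenbasis the circuit splits into independent blocks, in each of
which a query is a controlled phase on the register. -/
theorem Circuit.eval_eq_blockSum {V : Matrix ι ι ℂ} (hV : V * Vᴴ = 1) (z : ι → ℂ)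
    (c : Circuit n) :
    c.eval (V * diagonal z * Vᴴ) = blockSum V fun j => c.act (z j) := by
  have hV' : Vᴴ * V = 1 := mul_eq_one_comm.1 hV
  induction c with
  | nil =>
    simp only [Circuit.eval, Circuit.act]
    rw [blockSum_const hV, one_kronecker_one]
  | cons g c ih =>
    rw [Circuit.eval, ih, Gate.eval_eq_blockSum hV, blockSum_mul hV']
    rfl

variable {d : ℕ}

/-- The unitary whose columns are the vectors of an orthonormal basis. -/
noncomputable def basisMatrix (ψ : OrthonormalBasis (Fin d) ℂ (EuclideanSpace ℂ (Fin d))) :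
    Matrix (Fin d) (Fin d) ℂ :=
  Matrix.of fun i j => (ψ j).ofLp i

theorem basisMatrix_col (ψ : OrthonormalBasis (Fin d) ℂ (EuclideanSpace ℂ (Fin d))) (j : Fin d) :
    (basisMatrix ψ).col j = (ψ j).ofLp := rfl

theorem basisMatrix_isometry (ψ : OrthonormalBasis (Fin d) ℂ (EuclideanSpace ℂ (Fin d))) :
    (basisMatrix ψ)ᴴ * basisMatrix ψ = 1 := by
  ext i j
  have := orthonormal_iff_ite.1 ψ.orthonormal i j
  rw [EuclideanSpace.inner_eq_star_dotProduct, dotProduct_comm] at this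
  rw [Matrix.one_apply, ← this]
  rfl

theorem basisMatrix_unitary (ψ : OrthonormalBasis (Fin d) ℂ (EuclideanSpace ℂ (Fin d))) :
    basisMatrix ψ * (basisMatrix ψ)ᴴ = 1 :=
  mul_eq_one_comm.1 (basisMatrix_isometry ψ)

/-- The eigenvalue of the oracle with phase `l`. -/
noncomputable def eigenvalue (l : ℝ) : ℂ := Complex.exp (2 * Real.pi * Complex.I * l)

theorem norm_eigenvalue (l : ℝ) : ‖eigenvalue l‖ = 1 := by
  rw [eigenvalue, show 2 * Real.pi * Complex.I * l = ((2 * Real.pi * l : ℝ) : ℂ) * Complex.I by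
    push_cast; ring, Complex.norm_exp_ofReal_mul_I]

theorem IsPhaseDecomposition.eq_conj {U : Matrix (Fin d) (Fin d) ℂ} {lam : Fin d → ℝ}
    {ψ : OrthonormalBasis (Fin d) ℂ (EuclideanSpace ℂ (Fin d))}
    (h : IsPhaseDecomposition U lam ψ) :
    U = basisMatrix ψ * diagonal (fun j => eigenvalue (lam j)) * (basisMatrix ψ)ᴴ := by
  rw [h.2]
  ext a b
  rw [Matrix.sum_apply, Matrix.mul_apply]
  refine Finset.sum_congr rfl fun j _ => ?_
  rw [mul_diagonal, Matrix.smul_apply, vecMulVec_apply, smul_eq_mul, conjTranspose_apply,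
    eigenvalue]
  simp only [basisMatrix, Matrix.of_apply, Pi.star_apply]
  ring

theorem eq_targetMap {ψ : OrthonormalBasis (Fin d) ℂ (EuclideanSpace ℂ (Fin d))}
    {A : Matrix (Reg n × Fin d) (Fin d) ℂ} {v : Fin d → Reg n → ℂ}
    (h : ∀ j, A *ᵥ (ψ j).ofLp = tensor (v j) (ψ j).ofLp) : A = targetMap ψ v := by
  have e : A = (A * basisMatrix ψ) * (basisMatrix ψ)ᴴ := by
    rw [Matrix.mul_assoc, basisMatrix_unitary, Matrix.mul_one]
  rw [e, targetMap]
  ext a b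
  rw [Matrix.sum_apply, Matrix.mul_apply]
  refine Finset.sum_congr rfl fun j _ => ?_
  rw [vecMulVec_apply, ← h j]
  rfl

theorem targetMap_mulVec (ψ : OrthonormalBasis (Fin d) ℂ (EuclideanSpace ℂ (Fin d)))
    (v : Fin d → Reg n → ℂ) (j : Fin d) :
    targetMap ψ v *ᵥ (ψ j).ofLp = tensor (v j) (ψ j).ofLp := by
  have h : ∀ i, star (ψ i).ofLp ⬝ᵥ (ψ j).ofLp = if i = j then 1 else 0 := by
    intro i
    rw [← orthonormal_iff_ite.1 ψ.orthonormal i j, EuclideanSpace.inner_eq_star_dotProduct,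
      dotProduct_comm]
  rw [targetMap, sum_mulVec]
  simp only [vecMulVec_mulVec, h]
  rw [Finset.sum_eq_single j (fun i _ hi => by simp [hi]) (by simp)]
  simp

theorem Circuit.isometry_eq_targetMap {U : Matrix (Fin d) (Fin d) ℂ} {lam : Fin d → ℝ}
    {ψ : OrthonormalBasis (Fin d) ℂ (EuclideanSpace ℂ (Fin d))}
    (h : IsPhaseDecomposition U lam ψ) (c : Circuit n) :
    c.isometry U =
      targetMap ψ fun j => c.act (eigenvalue (lam j)) *ᵥ ket (fun _ => false) := by
  refine eq_targetMap fun j => ?_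
  rw [← basisMatrix_col, ← blockSum_mulVec_tensor (basisMatrix_isometry ψ)
    (fun j => c.act (eigenvalue (lam j))), ← Circuit.eval_eq_blockSum (basisMatrix_unitary ψ),
    ← h.eq_conj]
  ext a
  simp only [Circuit.isometry, mulVec, dotProduct, Matrix.submatrix_apply, tensor, ket,
    Fintype.sum_prod_type, id]
  rw [Finset.sum_eq_single (fun _ => false) (fun b _ hb => by simp [hb])
    (by simp)]
  simp

/-- The images of different eigenvectors are orthogonal because their second factors are. So the
largest error counts rather than the sum, and the bound does not depend on `d`. -/
theorem opNorm_targetMap_le (ψ : OrthonormalBasis (Fin d) ℂ (EuclideanSpace ℂ (Fin d)))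
    {v : Fin d → Reg n → ℂ} {r : ℝ} (hr : 0 ≤ r) (h : ∀ j, vnorm (v j) ≤ r) :
    ‖targetMap ψ v‖ ≤ r := by
  set B : Matrix (Reg n × Fin d) (Fin d) ℂ :=
    Matrix.of fun a j => if a.2 = j then v j a.1 else 0 with hB
  have e : targetMap ψ v = ((1 : Matrix (Reg n) (Reg n) ℂ) ⊗ₖ basisMatrix ψ) * B *
      (basisMatrix ψ)ᴴ := by
    symm
    refine eq_targetMap fun j => ?_
    have h1 : (basisMatrix ψ)ᴴ *ᵥ (ψ j).ofLp = Pi.single j 1 := by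
      rw [← basisMatrix_col, ← mulVec_single_one, mulVec_mulVec, basisMatrix_isometry,
        one_mulVec]
    have h2 : B *ᵥ Pi.single j 1 = tensor (v j) (Pi.single j 1) := by
      ext ⟨a, i⟩
      simp [hB, tensor, Pi.single_apply]
    rw [← mulVec_mulVec, h1, ← mulVec_mulVec, h2, kronecker_mulVec_tensor, one_mulVec,
      mulVec_single_one, basisMatrix_col]
  have hBn : ‖B‖ ≤ r := by
    refine opNorm_le hr fun x => ?_
    rw [vnorm_le_iff (mul_nonneg hr (vnorm_nonneg x)), mul_pow, vnorm_sq x,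
      Fintype.sum_prod_type_right, Finset.mul_sum]
    refine Finset.sum_le_sum fun j _ => ?_
    have e1 : ∀ a, (B *ᵥ x) (a, j) = v j a * x j := by
      intro a
      simp [hB, mulVec, dotProduct]
    simp only [e1, norm_mul, mul_pow]
    rw [← Finset.sum_mul, ← vnorm_sq]
    have := pow_le_pow_left₀ (vnorm_nonneg _) (h j) 2
    gcongr
  have h1 := opNorm_kronecker_one_le (p := Reg n) (basisMatrix_isometry ψ)
  have h2 : ‖(basisMatrix ψ)ᴴ‖ ≤ 1 := by
    rw [l2_opNorm_conjTranspose]; exact opNorm_le_one_of_isometry (basisMatrix_isometry ψ)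
  rw [e]
  have h4 := (l2_opNorm_mul ((1 : Matrix (Reg n) (Reg n) ℂ) ⊗ₖ basisMatrix ψ) B).trans
    ((mul_le_of_le_one_left (norm_nonneg _) h1).trans hBn)
  exact (l2_opNorm_mul _ _).trans ((mul_le_of_le_one_right (norm_nonneg _) h2).trans h4)

theorem targetMap_sub (ψ : OrthonormalBasis (Fin d) ℂ (EuclideanSpace ℂ (Fin d)))
    (v w : Fin d → Reg n → ℂ) :
    targetMap ψ v - targetMap ψ w = targetMap ψ fun j => v j - w j := by
  refine eq_targetMap fun j => ?_
  rw [sub_mulVec, targetMap_mulVec, targetMap_mulVec]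
  ext a
  simp [tensor, sub_mul]

theorem vnorm_ket (x : Reg n) : vnorm (ket x) = 1 := by
  have : vnorm (ket x) ^ 2 = 1 := by
    rw [vnorm_sq, Finset.sum_eq_single x (fun b _ hb => by simp [ket, hb])
      (by simp)]
    simp [ket]
  nlinarith [vnorm_nonneg (ket x)]

/-- Closeness of the map implemented by a circuit to a target map, tested on eigenvectors. -/
theorem Circuit.diamondNorm_isometry_sub_targetMap_le {U : Matrix (Fin d) (Fin d) ℂ}
    {lam : Fin d → ℝ} {ψ : OrthonormalBasis (Fin d) ℂ (EuclideanSpace ℂ (Fin d))}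
    (h : IsPhaseDecomposition U lam ψ) (c : Circuit n) {v : Fin d → Reg n → ℂ} {ε δ : ℝ}
    (hε : 0 ≤ ε) (hεδ : 2 * ε ≤ δ) (hv : ∀ j, vnorm (v j) = 1)
    (hc : ∀ j, vnorm (c.act (eigenvalue (lam j)) *ᵥ ket (fun _ => false) - v j) ≤ ε) :
    diamondNorm (conjMap (c.isometry U) - conjMap (targetMap ψ v)) ≤ ENNReal.ofReal δ := by
  rw [Circuit.isometry_eq_targetMap h]
  refine diamondNorm_conjMap_sub_le (ε := ε) ?_ ?_ ?_ hεδ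
  · refine opNorm_targetMap_le ψ zero_le_one fun j => ?_
    rw [vnorm_mulVec_of_isometry (Circuit.act_isometry (norm_eigenvalue _) c), vnorm_ket]
  · exact opNorm_targetMap_le ψ zero_le_one fun j => (hv j).le
  · rw [targetMap_sub]
    exact opNorm_targetMap_le ψ hε hc

/-- Closeness of a circuit to a unitary with prescribed values on a state for each eigenvector. -/
theorem Circuit.exists_unitary_near {U : Matrix (Fin d) (Fin d) ℂ} {lam : Fin d → ℝ}
    {ψ : OrthonormalBasis (Fin d) ℂ (EuclideanSpace ℂ (Fin d))}
    (h : IsPhaseDecomposition U lam ψ) (c : Circuit n) {x v : Fin d → Reg n → ℂ} {ε δ : ℝ}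
    (hε : 0 ≤ ε) (hεδ : 8 * ε ≤ δ) (hx : ∀ j, vnorm (x j) = 1) (hv : ∀ j, vnorm (v j) = 1)
    (hreal : ∀ j, ∃ r : ℝ, 0 ≤ r ∧
      star (v j) ⬝ᵥ (c.act (eigenvalue (lam j)) *ᵥ x j) = r)
    (hc : ∀ j, vnorm (c.act (eigenvalue (lam j)) *ᵥ x j - v j) ≤ ε) :
    ∃ T : Matrix.unitaryGroup (Reg n × Fin d) ℂ,
      (∀ j, T.1 *ᵥ tensor (x j) (ψ j).ofLp = tensor (v j) (ψ j).ofLp) ∧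
      diamondNorm (conjMap (c.eval U) - conjMap T.1) ≤ ENNReal.ofReal δ := by
  set A : Fin d → Matrix (Reg n) (Reg n) ℂ := fun j => c.act (eigenvalue (lam j)) with hA
  have hAi : ∀ j, (A j)ᴴ * A j = 1 := fun j => Circuit.act_isometry (norm_eigenvalue _) c
  have hAn : ∀ j, ‖A j‖ ≤ 1 := fun j => opNorm_le_one_of_isometry (hAi j)
  -- In each block a rotation close to `1` moves the actual output exactly onto the target, and the
  -- blocks `R j * A j` form `T`. The factor `8` is `4` from the rotation times `2` from the diamond
  -- norm.
  have hex : ∀ j, ∃ R : Matrix.unitaryGroup (Reg n) ℂ, R.1 *ᵥ (A j *ᵥ x j) = v j ∧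
      ‖R.1 - 1‖ ≤ 4 * ε := by
    intro j
    obtain ⟨r, hr, hr'⟩ := hreal j
    obtain ⟨R, hR, hR'⟩ := exists_unitary_near_one
      (by rw [vnorm_mulVec_of_isometry (hAi j), hx j]) (hv j) hr hr'
    exact ⟨R, hR, hR'.trans (by linarith [hc j])⟩
  choose R hR hR' using hex
  have hV := basisMatrix_isometry ψ
  have hRi : ∀ j, (R j).1ᴴ * (R j).1 = 1 := fun j => Matrix.mem_unitaryGroup_iff'.1 (R j).2
  have hTi : ∀ j, ((R j).1 * A j)ᴴ * ((R j).1 * A j) = 1 := fun j => by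
    rw [conjTranspose_mul, Matrix.mul_assoc, ← Matrix.mul_assoc _ _ (A j), hRi, Matrix.one_mul,
      hAi]
  have hT : blockSum (basisMatrix ψ) (fun j => (R j).1 * A j) ∈
      Matrix.unitaryGroup (Reg n × Fin d) ℂ := by
    rw [Matrix.mem_unitaryGroup_iff', star_eq_conjTranspose, blockSum_conjTranspose,
      blockSum_mul hV]
    simp only [hTi]
    rw [blockSum_const (basisMatrix_unitary ψ), one_kronecker_one]
  refine ⟨⟨_, hT⟩, fun j => ?_, ?_⟩
  · rw [← basisMatrix_col]
    simp only
    rw [blockSum_mulVec_tensor hV, ← mulVec_mulVec, hR]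
  · rw [h.eq_conj, Circuit.eval_eq_blockSum (basisMatrix_unitary ψ)]
    refine diamondNorm_conjMap_sub_le (ε := 4 * ε) (opNorm_blockSum_le hV zero_le_one hAn)
      (opNorm_blockSum_le hV zero_le_one fun j => opNorm_le_one_of_isometry (hTi j)) ?_
      (by linarith)
    rw [blockSum_sub]
    refine opNorm_blockSum_le hV (by linarith) fun j => ?_
    have e : A j - (R j).1 * A j = -(((R j).1 - 1) * A j) := by
      rw [Matrix.sub_mul, Matrix.one_mul]; abel
    have := l2_opNorm_mul ((R j).1 - 1) (A j)
    have h2 := mul_le_of_le_one_right (norm_nonneg ((R j).1 - 1)) (hAn j)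
    have h3 := hR' j
    show ‖A j - (R j).1 * A j‖ ≤ 4 * ε
    rw [e, norm_neg]
    linarith

end Semantics

end Eigenbasis

/-! ### The circuit for one bit, and the signal that it feeds to the gate sequence. -/

section BitCircuit

open ComplexConjugate

/-! ### Gate sequences that distinguish the two half planes -/

/-- A family of one-qubit gate sequences that decide the sign of the real part of the signal, outside
of a gap `2 η` and up to an error `ε`. -/
def Discriminates (g : ℝ → ℝ → Matrix.unitaryGroup Bool ℂ)
    (l : ℝ → ℝ → List (Matrix.unitaryGroup Bool ℂ)) : Prop :=
  ∀ η ε : ℝ, 0 < η → η ≤ 1 → 0 < ε → ε ≤ 1 / 2 → ∀ z : ℂ, ‖z‖ = 1 →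
    ∃ p q : ℂ, process z (l η ε) ((g η ε).1 *ᵥ vec2 1 0) = vec2 p q ∧ ‖p‖ ^ 2 + ‖q‖ ^ 2 = 1 ∧
      (z.re ≤ -(2 * η) → ‖p‖ ≤ ε) ∧ (2 * η ≤ z.re → ‖q‖ ≤ ε)

/-- The complementary partner of the half-band filter `P` is `P (-X)`, so smallness of `q` on the
right half plane is smallness of `P` on the left one. -/
theorem exists_discriminates : ∃ (K : ℝ) (g : ℝ → ℝ → Matrix.unitaryGroup Bool ℂ)
    (l : ℝ → ℝ → List (Matrix.unitaryGroup Bool ℂ)), 0 < K ∧ Discriminates g l ∧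
      ∀ η ε : ℝ, 0 < η → η ≤ 1 → 0 < ε → ε ≤ 1 / 2 →
        ((l η ε).length : ℝ) ≤ K * (η⁻¹ * Real.log ε⁻¹) := by
  obtain ⟨K, hK, H⟩ := exists_halfBand
  have : ∀ η ε : ℝ, ∃ (g : Matrix.unitaryGroup Bool ℂ) (l : List (Matrix.unitaryGroup Bool ℂ)),
      0 < η → η ≤ 1 → 0 < ε → ε ≤ 1 / 2 → (l.length : ℝ) ≤ K * (η⁻¹ * Real.log ε⁻¹) ∧
      ∀ z : ℂ, ‖z‖ = 1 → ∃ p q : ℂ, process z l (g.1 *ᵥ vec2 1 0) = vec2 p q ∧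
        ‖p‖ ^ 2 + ‖q‖ ^ 2 = 1 ∧ (z.re ≤ -(2 * η) → ‖p‖ ≤ ε) ∧ (2 * η ≤ z.re → ‖q‖ ≤ ε) := by
    intro η ε
    by_cases h : 0 < η ∧ η ≤ 1 ∧ 0 < ε ∧ ε ≤ 1 / 2
    · obtain ⟨L, P, hL, hP, h1, h2⟩ := H η ε h.1 h.2.1 h.2.2.1 h.2.2.2
      obtain ⟨g, l, hl, hgl⟩ := exists_process_eq L P (P.comp (-Polynomial.X)) hP
        (Polynomial.natDegree_comp_le.trans (by simpa using hP)) (by simpa using h1)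
      refine ⟨g, l, fun _ _ _ _ => ⟨by rwa [hl], fun z hz => ⟨_, _, hgl z hz, ?_, h2 z hz, ?_⟩⟩⟩
      · simpa using h1 z hz
      · intro hre
        have := h2 (-z) (by simpa using hz) (by simpa using hre)
        simpa using this
    -- Parameters out of range get an arbitrary sequence, so that `g` and `l` are total functions.
    · exact ⟨1, [], fun h1 h2 h3 h4 => absurd ⟨h1, h2, h3, h4⟩ h⟩
  choose g l hgl using this
  exact ⟨K, g, l, hK, fun η ε h1 h2 h3 h4 => (hgl η ε h1 h2 h3 h4).2,
    fun η ε h1 h2 h3 h4 => (hgl η ε h1 h2 h3 h4).1⟩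

/-! ### The circuit for one bit -/

/-- The gate `diag (1, exp (i φ))`. -/
noncomputable def phaseGate (φ : ℝ) : Matrix.unitaryGroup Bool ℂ :=
  ⟨diagonal fun b => if b = true then Complex.exp (φ * Complex.I) else 1, by
    rw [Matrix.mem_unitaryGroup_iff, star_eq_conjTranspose, diagonal_conjTranspose,
      diagonal_mul_diagonal, ← diagonal_one]
    congr 1; ext b
    cases b
    · simp
    · simpa using mul_conj_of_norm_one (Complex.norm_exp_ofReal_mul_I φ)⟩

/-- The controlled phase gate `diag (1, 1, 1, exp (i φ))`. -/
noncomputable def ctrlPhaseGate (φ : ℝ) : Matrix.unitaryGroup (Bool × Bool) ℂ :=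
  ⟨diagonal fun b => if b.2 = true then (if b.1 = true then Complex.exp (φ * Complex.I) else 1)
      else 1, by
    rw [Matrix.mem_unitaryGroup_iff, star_eq_conjTranspose, diagonal_conjTranspose,
      diagonal_mul_diagonal, ← diagonal_one]
    congr 1; ext ⟨a, b⟩
    cases a <;> cases b
    · simp
    · simp
    · simp
    · simpa using mul_conj_of_norm_one (Complex.norm_exp_ofReal_mul_I φ)⟩

variable {k n N : ℕ}

theorem castSucc_ne_last (f : Fin (k + 1) ↪ Fin n) (i : Fin k) : f i.castSucc ≠ f (Fin.last k) :=
  fun h => (Fin.castSucc_lt_last i).ne (f.injective h)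

/-- The circuit that multiplies the component `|1⟩` of the last qubit by `U ^ t`, by the phase
`θ`, and by `-π y / 2 ^ k`, where `y` is the integer held by the first `k` qubits. -/
noncomputable def signalCircuit (f : Fin (k + 1) ↪ Fin n) (t : ℕ) (θ : ℝ) : Circuit n :=
  List.replicate t (.query (f (Fin.last k))) ++
    ((List.finRange k).map (fun i => Gate.two (f i.castSucc) (f (Fin.last k))
      (castSucc_ne_last f i) (ctrlPhaseGate (-(Real.pi * 2 ^ (i : ℕ) / 2 ^ k)))) ++
    [.one (f (Fin.last k)) (phaseGate θ)])

/-- The circuit that runs `process` on the last qubit. -/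
noncomputable def processCircuit (f : Fin (k + 1) ↪ Fin n) (t : ℕ) (θ : ℝ) :
    List (Matrix.unitaryGroup Bool ℂ) → Circuit n
  | [] => []
  | g :: l => signalCircuit f t θ ++ .one (f (Fin.last k)) g :: processCircuit f t θ l

/-- The circuit that computes a bit. -/
noncomputable def bitCircuit (f : Fin (k + 1) ↪ Fin n) (t : ℕ) (θ : ℝ)
    (g : Matrix.unitaryGroup Bool ℂ) (l : List (Matrix.unitaryGroup Bool ℂ)) : Circuit n :=
  .one (f (Fin.last k)) g :: processCircuit f t θ l

theorem onQubits_append (h : Fin n ↪ Fin N) (c c' : Circuit n) :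
    Circuit.onQubits h (c ++ c') = Circuit.onQubits h c ++ Circuit.onQubits h c' :=
  List.map_append

theorem onQubits_signalCircuit (f : Fin (k + 1) ↪ Fin n) (h : Fin n ↪ Fin N) (t : ℕ) (θ : ℝ) :
    Circuit.onQubits h (signalCircuit f t θ) = signalCircuit (f.trans h) t θ := by
  simp [Circuit.onQubits, signalCircuit, Gate.onQubits, Function.comp_def]

theorem onQubits_processCircuit (f : Fin (k + 1) ↪ Fin n) (h : Fin n ↪ Fin N) (t : ℕ) (θ : ℝ)
    (l : List (Matrix.unitaryGroup Bool ℂ)) :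
    Circuit.onQubits h (processCircuit f t θ l) = processCircuit (f.trans h) t θ l := by
  induction l with
  | nil => rfl
  | cons g l ih =>
    rw [processCircuit, processCircuit, onQubits_append, onQubits_signalCircuit, ← ih]
    rfl

/-- Since the circuit is built along an arbitrary embedding, relabelling qubits only composes
embeddings; one analysis serves the stand-alone circuit and the chain. -/
theorem onQubits_bitCircuit (f : Fin (k + 1) ↪ Fin n) (h : Fin n ↪ Fin N) (t : ℕ) (θ : ℝ)
    (g : Matrix.unitaryGroup Bool ℂ) (l : List (Matrix.unitaryGroup Bool ℂ)) :
    Circuit.onQubits h (bitCircuit f t θ g l) = bitCircuit (f.trans h) t θ g l := by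
  rw [bitCircuit, bitCircuit, ← onQubits_processCircuit]
  rfl

theorem queries_append (c c' : Circuit n) :
    Circuit.queries (c ++ c') = c.queries + c'.queries := by
  simp [Circuit.queries]

theorem queries_signalCircuit (f : Fin (k + 1) ↪ Fin n) (t : ℕ) (θ : ℝ) :
    (signalCircuit f t θ).queries = t := by
  simp [signalCircuit, Circuit.queries, Gate.queries, Function.comp_def]

theorem queries_bitCircuit (f : Fin (k + 1) ↪ Fin n) (t : ℕ) (θ : ℝ)
    (g : Matrix.unitaryGroup Bool ℂ) (l : List (Matrix.unitaryGroup Bool ℂ)) :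
    (bitCircuit f t θ g l).queries = l.length * t := by
  have h : ∀ g' : Matrix.unitaryGroup Bool ℂ, ∀ c : Circuit n,
      Circuit.queries (.one (f (Fin.last k)) g' :: c) = c.queries := by
    intro g' c; simp [Circuit.queries, Gate.queries]
  rw [bitCircuit, h]
  induction l with
  | nil => simp [processCircuit, Circuit.queries]
  | cons g l ih =>
    rw [processCircuit, queries_append, queries_signalCircuit, h, ih, List.length_cons]
    ring

theorem queries_onQubits (h : Fin n ↪ Fin N) (c : Circuit n) :
    (Circuit.onQubits h c).queries = c.queries := by
  simp only [Circuit.queries, Circuit.onQubits, List.map_map]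
  congr 2
  ext g
  cases g <;> rfl

/-! ### Action of the circuit for one bit -/

/-- The state in which qubit `q` is in the state `v` and the other qubits are as in `x`. -/
noncomputable def line (x : Reg n) (q : Fin n) (v : Bool → ℂ) : Reg n → ℂ :=
  fun a => if a = Function.update x q (a q) then v (a q) else 0

theorem line_vec2 (x : Reg n) (q : Fin n) (a b : ℂ) :
    line x q (vec2 a b) =
      a • ket (Function.update x q false) + b • ket (Function.update x q true) := by
  ext y
  simp only [line, vec2, ket, Pi.add_apply, Pi.smul_apply, Pi.single_apply, smul_eq_mul]
  cases h : y q
  · have : y ≠ Function.update x q true := fun h' => by rw [h'] at h; simp at h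
    simp [this]
  · have : y ≠ Function.update x q false := fun h' => by rw [h'] at h; simp at h
    simp [this]

theorem act_one_line (z : ℂ) (x : Reg n) (q : Fin n) (g : Matrix.unitaryGroup Bool ℂ)
    (v : Bool → ℂ) : (Gate.one q g).act z *ᵥ line x q v = line x q (g.1 *ᵥ v) := by
  ext a
  simp only [Gate.act, localMat, mulVec, dotProduct, Matrix.of_apply, ite_mul, zero_mul]
  rw [(isLens_one q).sum_ite a fun b => g.1 (a q) (b q) * line x q v b]
  have h : ∀ t, Function.update a q t = Function.update x q t ↔ a = Function.update x q (a q) := by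
    intro t
    constructor
    · intro h
      have := congrArg (fun b => Function.update b q (a q)) h
      simpa using this
    · intro h
      rw [h]; simp
  simp only [line, Function.update_self, h, mulVec, dotProduct]
  split_ifs <;> simp

/-- Multiplication by `W`, controlled on qubit `q`. -/
noncomputable def ctrlDiag (q : Fin n) (W : Reg n → ℂ) : Matrix (Reg n) (Reg n) ℂ :=
  diagonal fun a => if a q = true then W a else 1

theorem ctrlDiag_mul (q : Fin n) (W W' : Reg n → ℂ) :
    ctrlDiag q W * ctrlDiag q W' = ctrlDiag q fun a => W a * W' a := by
  rw [ctrlDiag, ctrlDiag, ctrlDiag, diagonal_mul_diagonal]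
  congr 1; ext a; split_ifs <;> simp

theorem ctrlDiag_one (q : Fin n) : ctrlDiag q (fun _ => 1) = 1 := by
  simp [ctrlDiag]

theorem ctrlDiag_mulVec_line {q : Fin n} {W : Reg n → ℂ} (x : Reg n)
    (hW : ∀ b, W (Function.update x q b) = W x) (v : Bool → ℂ) :
    ctrlDiag q W *ᵥ line x q v = line x q (signal (W x) *ᵥ v) := by
  ext a
  rw [ctrlDiag, mulVec_diagonal]
  simp only [line, signal, mulVec_diagonal]
  by_cases h : a = Function.update x q (a q)
  · have : W a = W x := by rw [h]; exact hW _
    simp [← h, this]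
  · simp [h]

theorem IsLens.localMat_diagonal {ρ τ : Type*} [Fintype ρ] [DecidableEq ρ] [Fintype τ]
    [DecidableEq τ] {get : ρ → τ} {set : ρ → τ → ρ} (h : IsLens get set) (D : τ → ℂ) :
    localMat get set (diagonal D) = diagonal fun a => D (get a) := by
  ext a b
  simp only [localMat, Matrix.of_apply, diagonal_apply]
  by_cases hab : a = b
  · subst hab; simp [h.set_get]
  · rw [if_neg hab]
    split_ifs with h1 h2
    · rw [← h2, h.set_get] at h1
      exact absurd h1.symm hab
    · rfl
    · rfl

/-- The factor by which `signalCircuit` multiplies the component `|1⟩` of the last qubit. -/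
noncomputable def signalValue (t : ℕ) (θ : ℝ) (z : ℂ) (y : Fin k → Bool) : ℂ :=
  Complex.exp (θ * Complex.I) *
    ((∏ i, if y i = true then
      Complex.exp ((-(Real.pi * 2 ^ (i : ℕ) / 2 ^ k) : ℝ) * Complex.I) else 1) * z ^ t)

theorem norm_signalValue (t : ℕ) (θ : ℝ) {z : ℂ} (hz : ‖z‖ = 1) (y : Fin k → Bool) :
    ‖signalValue t θ z y‖ = 1 := by
  rw [signalValue, norm_mul, norm_mul, Complex.norm_exp_ofReal_mul_I, norm_pow, hz, norm_prod,
    Finset.prod_eq_one]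
  · simp
  · intro i _
    split_ifs
    · exact Complex.norm_exp_ofReal_mul_I _
    · simp

/-- Every gate here is diagonal and acts only when the last qubit is `1`, so the factors simply
multiply. -/
theorem act_signalCircuit (z : ℂ) (f : Fin (k + 1) ↪ Fin n) (t : ℕ) (θ : ℝ) :
    (signalCircuit f t θ).act z =
      ctrlDiag (f (Fin.last k)) fun a => signalValue t θ z fun i => a (f i.castSucc) := by
  set q := f (Fin.last k) with hq
  have h1 : Circuit.act z (List.replicate t (Gate.query q)) = ctrlDiag q fun _ => z ^ t := by
    induction t with
    | zero => simp [Circuit.act, ctrlDiag_one]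
    | succ t ih =>
      rw [List.replicate_succ, Circuit.act, ih]
      exact (ctrlDiag_mul q _ _).trans (by simp [pow_succ])
  have h2 : ∀ L : List (Fin k), Circuit.act z (L.map fun i => Gate.two (f i.castSucc) q
      (castSucc_ne_last f i) (ctrlPhaseGate (-(Real.pi * 2 ^ (i : ℕ) / 2 ^ k)))) =
      ctrlDiag q fun a => (L.map fun i : Fin k => if a (f i.castSucc) = true then
        Complex.exp ((-(Real.pi * 2 ^ (i : ℕ) / 2 ^ k) : ℝ) * Complex.I) else 1).prod := by
    intro L
    induction L with
    | nil => simp [Circuit.act, ctrlDiag_one]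
    | cons i L ih =>
      rw [List.map_cons, Circuit.act, ih, Gate.act, ctrlPhaseGate,
        (isLens_two (castSucc_ne_last f i)).localMat_diagonal]
      refine (ctrlDiag_mul q _ _).trans ?_
      congr 1
      ext a
      rw [List.map_cons, List.prod_cons, mul_comm]
  have h3 : Circuit.act z [Gate.one q (phaseGate θ)] =
      ctrlDiag q fun _ => Complex.exp (θ * Complex.I) := by
    rw [Circuit.act, Circuit.act, Matrix.one_mul, Gate.act, phaseGate,
      (isLens_one q).localMat_diagonal]
    rfl
  rw [signalCircuit, Circuit.act_append, Circuit.act_append, h1, h2, h3, ctrlDiag_mul,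
    ctrlDiag_mul]
  congr 1
  ext a
  rw [signalValue, Fin.prod_univ_def, mul_assoc]

/-- The qubits that hold the known bits never change, so all signals are equal and the state stays
in a two-dimensional space. -/
theorem act_bitCircuit_line (z : ℂ) (f : Fin (k + 1) ↪ Fin n) (t : ℕ) (θ : ℝ)
    (g : Matrix.unitaryGroup Bool ℂ) (l : List (Matrix.unitaryGroup Bool ℂ)) (x : Reg n)
    (v : Bool → ℂ) :
    (bitCircuit f t θ g l).act z *ᵥ line x (f (Fin.last k)) v =
      line x (f (Fin.last k))
        (process (signalValue t θ z fun i => x (f i.castSucc)) l (g.1 *ᵥ v)) := by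
  rw [bitCircuit, Circuit.act, ← mulVec_mulVec, act_one_line]
  generalize g.1 *ᵥ v = v
  induction l generalizing v with
  | nil => simp [processCircuit, Circuit.act, process]
  | cons g l ih =>
    rw [processCircuit, Circuit.act_append, ← mulVec_mulVec, act_signalCircuit,
      ctrlDiag_mulVec_line x, Circuit.act, ← mulVec_mulVec, act_one_line, ih, process]
    intro b
    congr 1
    ext i
    rw [Function.update_of_ne (castSucc_ne_last f i)]

/-! ### The iterative protocol -/

/-- The error target of the gate sequence for a bit. -/
noncomputable def gateError (δ : ℝ) : ℝ := min δ (1 / 2) / 16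

/-- The number of oracle calls per signal. -/
def signalPower (n k : ℕ) : ℕ := 2 ^ (n - 1 - k)

/-- The phase shift that centers the signal. -/
noncomputable def signalShift (α : ℝ) (k : ℕ) : ℝ := -(Real.pi * ((1 + α) / 2) / 2 ^ k)

/-- The iterative protocol that uses given gate sequences. -/
noncomputable def bitProtocol (g : ℝ → ℝ → Matrix.unitaryGroup Bool ℂ)
    (l : ℝ → ℝ → List (Matrix.unitaryGroup Bool ℂ)) : IterativeProtocol := fun n α k δ =>
  bitCircuit (Function.Embedding.refl _) (signalPower n k) (signalShift α k)
    (g (ampGap α k) (gateError δ)) (l (ampGap α k) (gateError δ))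

theorem ampGap_pos {α : ℝ} (h0 : 0 < α) (h1 : α < 1) (k : ℕ) : 0 < ampGap α k := by
  rw [ampGap]
  split_ifs with hk
  · linarith
  · have : (1 : ℝ) / 2 ^ k ≤ 1 / 2 := by
      rw [div_le_div_iff₀ (by positivity) (by norm_num), one_mul, one_mul]
      calc (2 : ℝ) = 2 ^ 1 := by norm_num
        _ ≤ 2 ^ k := pow_le_pow_right₀ (by norm_num) (Nat.one_le_iff_ne_zero.2 hk)
    nlinarith

theorem ampGap_le_half {α : ℝ} (h0 : 0 < α) (h1 : α < 1) (k : ℕ) : ampGap α k ≤ 1 / 2 := by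
  rw [ampGap]
  split_ifs with hk
  · linarith
  · have : 0 ≤ (1 : ℝ) / 2 ^ k * (1 / 2 + α / 2) := by positivity
    linarith

theorem gateError_pos {δ : ℝ} (h : 0 < δ) : 0 < gateError δ := by
  have : 0 < min δ (1 / 2) := lt_min h (by norm_num)
  rw [gateError]; positivity

theorem gateError_le {δ : ℝ} : gateError δ ≤ δ / 16 := by
  rw [gateError]; have := min_le_left δ (1 / 2); linarith

theorem gateError_le_half {δ : ℝ} : gateError δ ≤ 1 / 2 := by
  rw [gateError]; have := min_le_right δ (1 / 2); linarith

/-- The condition under which the bits of `M` are computed correctly from a phase `l`, the bits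
below the `k`-th one being given. -/
def IsCentered (n : ℕ) (α : ℝ) (l : ℝ) (M k : ℕ) : Prop :=
  ∃ (f : ℝ) (w : ℤ), 2 ^ n * l = M + f + 2 ^ n * w ∧
    |f - (1 + α) / 2| / 2 ^ k ≤ 1 / 2 - ampGap α k

/-- The low bits of `M` add up to `M % 2 ^ k`. The denominator `c` is kept separate from `k` so that
the induction does not change it. -/
theorem prod_exp_testBit (M : ℕ) (c : ℝ) (k : ℕ) :
    (∏ i : Fin k, if M.testBit i = true then
      Complex.exp ((-(Real.pi * 2 ^ (i : ℕ) / c) : ℝ) * Complex.I) else 1) =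
      Complex.exp ((-(Real.pi * (M % 2 ^ k : ℕ) / c) : ℝ) * Complex.I) := by
  induction k with
  | zero => simp [Nat.mod_one]
  | succ k ih =>
    rw [Fin.prod_univ_castSucc]
    simp only [Fin.val_castSucc, Fin.val_last]
    rw [ih, Nat.mod_pow_succ, Nat.testBit_eq_decide_div_mod_eq]
    rcases Nat.mod_two_eq_zero_or_one (M / 2 ^ k) with h | h
    · simp [h]
    · rw [h]
      simp only [decide_true, if_true, ← Complex.exp_add]
      congr 1
      push_cast
      ring

/-- The power of the oracle has phase `π (M + f) / 2 ^ k` modulo `2π`; the term with `w` is a full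
number of turns because `k < n`. Removing `M % 2 ^ k` leaves `π` times the integer `M / 2 ^ k`,
whose parity is bit `k`. -/
theorem signalValue_eq {n k M : ℕ} (hk : k < n) {α l f : ℝ} {w : ℤ}
    (h : 2 ^ n * l = M + f + 2 ^ n * w) :
    signalValue (signalPower n k) (signalShift α k) (eigenvalue l) (fun i : Fin k => M.testBit i) =
      (-1) ^ (M / 2 ^ k) *
        Complex.exp ((Real.pi * ((f - (1 + α) / 2) / 2 ^ k) : ℝ) * Complex.I) := by
  have hB : ((-1 : ℂ)) ^ (M / 2 ^ k) =
      Complex.exp ((M / 2 ^ k : ℕ) * (Real.pi * Complex.I)) := by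
    rw [Complex.exp_nat_mul, Complex.exp_pi_mul_I]
  rw [signalValue, prod_exp_testBit M (2 ^ k) k, eigenvalue, ← Complex.exp_nat_mul,
    ← Complex.exp_add, ← Complex.exp_add, hB, ← Complex.exp_add]
  rw [Complex.exp_eq_exp_iff_exists_int]
  have key : signalShift α k + (-(Real.pi * (M % 2 ^ k : ℕ) / 2 ^ k) +
      2 * Real.pi * l * signalPower n k) = (M / 2 ^ k : ℕ) * Real.pi +
        Real.pi * ((f - (1 + α) / 2) / 2 ^ k) + 2 ^ (n - 1 - k) * w * (2 * Real.pi) := by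
    have hn : (2 : ℝ) ^ n = 2 * 2 ^ (n - 1 - k) * 2 ^ k := by
      rw [← pow_succ', ← pow_add]; congr 1; omega
    have hM : (M : ℝ) = 2 ^ k * (M / 2 ^ k : ℕ) + (M % 2 ^ k : ℕ) := by
      exact_mod_cast (Nat.div_add_mod M (2 ^ k)).symm
    have h2k : (2 : ℝ) ^ k ≠ 0 := by positivity
    have hl : 2 * l * 2 ^ (n - 1 - k) =
        (M / 2 ^ k : ℕ) + (M % 2 ^ k : ℕ) / 2 ^ k + f / 2 ^ k + 2 * 2 ^ (n - 1 - k) * w := by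
      field_simp
      rw [hn] at h
      linear_combination h + hM
    rw [signalShift, signalPower]
    push_cast
    linear_combination Real.pi * hl
  have keyC := congrArg (fun x : ℝ => (x : ℂ) * Complex.I) key
  refine ⟨2 ^ (n - 1 - k) * w, ?_⟩
  push_cast at keyC ⊢
  linear_combination keyC

/-- The angle is within `π / 2 - π η` of `0` or `π`, so the real part has modulus at least `sin (π
η)`, which is at least `2 η` by Jordan's inequality. -/
theorem signalValue_re {n k M : ℕ} (hk : k < n) {α l : ℝ} (h0 : 0 < α) (h1 : α < 1)
    (h : IsCentered n α l M k) :
    (M.testBit k = true → (signalValue (signalPower n k) (signalShift α k) (eigenvalue l)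
      (fun i : Fin k => M.testBit i)).re ≤ -(2 * ampGap α k)) ∧
    (M.testBit k = false → 2 * ampGap α k ≤ (signalValue (signalPower n k) (signalShift α k)
      (eigenvalue l) (fun i : Fin k => M.testBit i)).re) := by
  obtain ⟨f, w, hf, hg⟩ := h
  rw [signalValue_eq hk hf]
  set η := ampGap α k
  have hη0 : 0 < η := ampGap_pos h0 h1 k
  have hη1 : η ≤ 1 / 2 := ampGap_le_half h0 h1 k
  set x := (f - (1 + α) / 2) / 2 ^ k with hx
  have hxa : |x| ≤ 1 / 2 - η := by
    rwa [hx, abs_div, abs_of_pos (by positivity : (0 : ℝ) < 2 ^ k)]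
  have hpi := Real.pi_pos
  have hcos : 2 * η ≤ Real.cos (Real.pi * x) := by
    rw [← Real.cos_abs, abs_mul, abs_of_pos hpi]
    have e1 : Real.cos (Real.pi / 2 - Real.pi * η) ≤ Real.cos (Real.pi * |x|) := by
      apply Real.cos_le_cos_of_nonneg_of_le_pi
      · positivity
      · nlinarith
      · nlinarith
    rw [Real.cos_pi_div_two_sub] at e1
    have e2 := Real.mul_le_sin (x := Real.pi * η) (by positivity) (by nlinarith)
    have e3 : 2 / Real.pi * (Real.pi * η) = 2 * η := by field_simp
    linarith
  rw [Nat.testBit_eq_decide_div_mod_eq]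
  have hre : (Complex.exp ((Real.pi * x : ℝ) * Complex.I)).re = Real.cos (Real.pi * x) :=
    Complex.exp_ofReal_mul_I_re _
  constructor
  · intro hb
    have hodd : Odd (M / 2 ^ k) := Nat.odd_iff.2 (by simpa using hb)
    rw [hodd.neg_one_pow, neg_one_mul, Complex.neg_re, hre]
    linarith
  · intro hb
    have heven : Even (M / 2 ^ k) := Nat.even_iff.2 (by simpa using hb)
    rw [heven.neg_one_pow, one_mul, hre]
    exact hcos

end BitCircuit

/-! ### Error analysis of one bit and of the chain, behaviour without a promise, query counts. -/

section Estimator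

open ComplexConjugate

variable {k n N : ℕ} {g : ℝ → ℝ → Matrix.unitaryGroup Bool ℂ}
  {l : ℝ → ℝ → List (Matrix.unitaryGroup Bool ℂ)}

/-! ### Errors of the circuit for one bit -/

/-- Take `u = p / |p|`; then `|p - u| = 1 - |p| ≤ 1 - |p|² = |q|² ≤ ε`. This phase makes the overlap
real, as `exists_unitary_near_one` requires. -/
theorem exists_phase_near {p q : ℂ} {ε : ℝ} (hε : ε ≤ 1 / 2) (h : ‖p‖ ^ 2 + ‖q‖ ^ 2 = 1)
    (hq : ‖q‖ ≤ ε) : ∃ u : ℂ, ‖u‖ = 1 ∧ ‖p - u‖ ≤ ε ∧ conj u * p = (‖p‖ : ℝ) := by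
  have hq0 := norm_nonneg q
  have hp0 : 0 < ‖p‖ := by
    rcases (norm_nonneg p).lt_or_eq with h' | h'
    · exact h'
    · rw [← h'] at h; nlinarith
  have hpc : (‖p‖ : ℂ) ≠ 0 := by exact_mod_cast hp0.ne'
  have hp1 : ‖p‖ ≤ 1 := by nlinarith
  refine ⟨p / ‖p‖, ?_, ?_, ?_⟩
  · rw [norm_div, Complex.norm_real, norm_norm, div_self hp0.ne']
  · have e : p - p / ‖p‖ = (p / ‖p‖) * ((‖p‖ - 1 : ℝ) : ℂ) := by
      push_cast; field_simp
    rw [e, norm_mul, norm_div, Complex.norm_real, norm_norm, div_self hp0.ne', one_mul,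
      Complex.norm_real, Real.norm_eq_abs, abs_of_nonpos (by linarith)]
    nlinarith
  · rw [map_div₀, Complex.conj_ofReal, div_mul_eq_mul_div, mul_comm (conj p), Complex.mul_conj,
      Complex.normSq_eq_norm_sq]
    push_cast
    field_simp

theorem star_ket_dotProduct (x : Reg n) (v : Reg n → ℂ) : star (ket x) ⬝ᵥ v = v x := by
  rw [dotProduct, Finset.sum_eq_single x (fun b _ hb => by simp [ket, hb]) (by simp)]
  simp [ket]

theorem vnorm_smul_ket {u : ℂ} (hu : ‖u‖ = 1) (x : Reg n) : vnorm (u • ket x) = 1 := by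
  rw [vnorm_smul, vnorm_ket, hu, one_mul]

theorem vnorm_add_kets {a b : ℂ} (h : ‖a‖ ^ 2 + ‖b‖ ^ 2 = 1) {x y : Reg n} (hxy : x ≠ y) :
    vnorm (a • ket x + b • ket y) = 1 := by
  have e : star (a • ket x + b • ket y) ⬝ᵥ (a • ket x + b • ket y) = 1 := by
    rw [star_add, star_smul, star_smul, add_dotProduct, smul_dotProduct, smul_dotProduct,
      star_ket_dotProduct, star_ket_dotProduct]
    have : conj a * a + conj b * b = 1 := by
      rw [mul_comm, Complex.mul_conj, mul_comm, Complex.mul_conj, Complex.normSq_eq_norm_sq,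
        Complex.normSq_eq_norm_sq]
      exact_mod_cast h
    simpa [ket, hxy, hxy.symm] using this
  rw [star_dotProduct_self] at e
  have : vnorm (a • ket x + b • ket y) ^ 2 = 1 := by exact_mod_cast e
  nlinarith [vnorm_nonneg (a • ket x + b • ket y)]

/-- The circuit that `bitProtocol` runs for bit `k`, on given qubits. -/
theorem onQubits_bitProtocol (f : Fin (k + 1) ↪ Fin N) (α δ : ℝ) :
    Circuit.onQubits f (bitProtocol g l n α k δ) =
      bitCircuit f (signalPower n k) (signalShift α k) (g (ampGap α k) (gateError δ))
        (l (ampGap α k) (gateError δ)) := by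
  rw [bitProtocol, onQubits_bitCircuit]
  rfl

/-- Only the last clause needs a centered phase; the rest describes step `0` when there is no
promise. -/
theorem act_bit (hgl : Discriminates g l) {α δ : ℝ} (h0 : 0 < α) (h1 : α < 1) (hδ : 0 < δ)
    (f : Fin (k + 1) ↪ Fin N) (lam : ℝ) {x : Reg N} (hx : x (f (Fin.last k)) = false) :
    ∃ p q : ℂ, ‖p‖ ^ 2 + ‖q‖ ^ 2 = 1 ∧
      (bitCircuit f (signalPower n k) (signalShift α k) (g (ampGap α k) (gateError δ))
        (l (ampGap α k) (gateError δ))).act (eigenvalue lam) *ᵥ ket x =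
        p • ket x + q • ket (Function.update x (f (Fin.last k)) true) ∧
      ∀ M : ℕ, (∀ i : Fin k, x (f i.castSucc) = M.testBit i) → k < n → IsCentered n α lam M k →
        (M.testBit k = true → ‖p‖ ≤ gateError δ) ∧ (M.testBit k = false → ‖q‖ ≤ gateError δ) := by
  have hη0 := ampGap_pos h0 h1 k
  obtain ⟨p, q, hpq, hn, hp, hq⟩ := hgl (ampGap α k) (gateError δ) hη0
    (by linarith [ampGap_le_half h0 h1 k]) (gateError_pos hδ) gateError_le_half
    (signalValue (signalPower n k) (signalShift α k) (eigenvalue lam) fun i => x (f i.castSucc))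
    (norm_signalValue _ _ (norm_eigenvalue lam) _)
  have hxu : Function.update x (f (Fin.last k)) false = x := by rw [← hx]; simp
  refine ⟨p, q, hn, ?_, fun M hM hk hc => ?_⟩
  · have e : ket x = line x (f (Fin.last k)) (vec2 1 0) := by
      rw [line_vec2, hxu]; simp
    rw [e, act_bitCircuit_line, hpq, line_vec2, hxu, line_vec2, hxu]
    simp
  · have := signalValue_re hk h0 h1 hc
    simp only [hM] at hp hq
    exact ⟨fun h => hp (this.1 h), fun h => hq (this.2 h)⟩

/-- The wrong amplitude and the rounding of the right one to modulus `1` cost at most `δ / 16` each.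
-/
theorem act_bit_near (hgl : Discriminates g l) {α δ : ℝ} (h0 : 0 < α) (h1 : α < 1) (hδ : 0 < δ)
    (f : Fin (k + 1) ↪ Fin N) {lam : ℝ} {x : Reg N} (hx : x (f (Fin.last k)) = false) {M : ℕ}
    (hM : ∀ i : Fin k, x (f i.castSucc) = M.testBit i) (hk : k < n)
    (hc : IsCentered n α lam M k) :
    ∃ u : ℂ, ‖u‖ = 1 ∧
      vnorm ((bitCircuit f (signalPower n k) (signalShift α k) (g (ampGap α k) (gateError δ))
        (l (ampGap α k) (gateError δ))).act (eigenvalue lam) *ᵥ ket x -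
        u • ket (Function.update x (f (Fin.last k)) (M.testBit k))) ≤ δ / 8 ∧
      ∃ r : ℝ, 0 ≤ r ∧ star (u • ket (Function.update x (f (Fin.last k)) (M.testBit k))) ⬝ᵥ
        ((bitCircuit f (signalPower n k) (signalShift α k) (g (ampGap α k) (gateError δ))
        (l (ampGap α k) (gateError δ))).act (eigenvalue lam) *ᵥ ket x) = r := by
  obtain ⟨p, q, hn, hact, hb⟩ := act_bit (n := n) hgl h0 h1 hδ f lam hx
  obtain ⟨hbt, hbf⟩ := hb M hM hk hc
  have hxu : Function.update x (f (Fin.last k)) false = x := by rw [← hx]; simp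
  have hne : x ≠ Function.update x (f (Fin.last k)) true := by
    intro h
    have := congrFun h (f (Fin.last k))
    simp [hx] at this
  have hle := gateError_le (δ := δ)
  rw [hact]
  cases hbit : M.testBit k
  · obtain ⟨u, hu, hpu, hcu⟩ := exists_phase_near gateError_le_half hn (hbf hbit)
    refine ⟨u, hu, ?_, ‖p‖, norm_nonneg p, ?_⟩
    · rw [hxu]
      have e : p • ket x + q • ket (Function.update x (f (Fin.last k)) true) - u • ket x =
          (p - u) • ket x + q • ket (Function.update x (f (Fin.last k)) true) := by module
      rw [e]
      refine (vnorm_add_le _ _).trans ?_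
      rw [vnorm_smul, vnorm_smul, vnorm_ket, vnorm_ket]
      linarith [hbf hbit]
    · rw [hxu, star_smul, smul_dotProduct, star_ket_dotProduct]
      simpa [ket, hne.symm, hne] using hcu
  · obtain ⟨u, hu, hpu, hcu⟩ := exists_phase_near gateError_le_half ((add_comm _ _).trans hn)
      (hbt hbit)
    refine ⟨u, hu, ?_, ‖q‖, norm_nonneg q, ?_⟩
    · have e : p • ket x + q • ket (Function.update x (f (Fin.last k)) true) -
          u • ket (Function.update x (f (Fin.last k)) true) =
          p • ket x + (q - u) • ket (Function.update x (f (Fin.last k)) true) := by module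
      rw [e]
      refine (vnorm_add_le _ _).trans ?_
      rw [vnorm_smul, vnorm_smul, vnorm_ket, vnorm_ket]
      linarith [hbt hbit]
    · rw [star_smul, smul_dotProduct, star_ket_dotProduct]
      simpa [ket, hne.symm, hne] using hcu

/-! ### Centered phases -/

theorem estimate_le {n : ℕ} {a : ℝ} (ha : 0 ≤ a) : (estimate n a : ℝ) ≤ 2 ^ n * a :=
  Nat.floor_le (by positivity)

theorem lt_estimate_add_one (n : ℕ) (a : ℝ) : 2 ^ n * a < estimate n a + 1 :=
  Nat.lt_floor_add_one _

theorem estimate_lt {n : ℕ} {a : ℝ} (ha : 0 ≤ a) (ha1 : a < 1) : estimate n a < 2 ^ n := by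
  have h := estimate_le (n := n) ha
  have : (estimate n a : ℝ) < 2 ^ n := by
    have : (0 : ℝ) < 2 ^ n := by positivity
    nlinarith
  exact_mod_cast this

/-- Bit `0` uses that `[α, 1]` has half-length `(1 - α) / 2`. Higher bits use only the wider
interval `[0, 1 + α]` with the same centre, as `ampGap` prescribes. -/
theorem isCentered_of_le {n : ℕ} {α a : ℝ} (h0 : 0 < α) (ha : 0 ≤ a)
    (h : estimate n a + α ≤ 2 ^ n * a) (k : ℕ) : IsCentered n α a (estimate n a) k := by
  refine ⟨2 ^ n * a - estimate n a, 0, by simp, ?_⟩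
  have h2 := lt_estimate_add_one n a
  have h3 : |2 ^ n * a - estimate n a - (1 + α) / 2| ≤ (1 - α) / 2 := by
    rw [abs_le]; constructor <;> linarith
  rw [ampGap]
  split_ifs with hk
  · subst hk
    rw [pow_zero, div_one]; linarith
  · have h4 : |2 ^ n * a - estimate n a - (1 + α) / 2| ≤ 1 / 2 + α / 2 := by
      rw [abs_le]; have := estimate_le (n := n) ha; constructor <;> linarith
    have := div_le_div_of_nonneg_right h4 (by positivity : (0 : ℝ) ≤ 2 ^ k)
    rw [div_eq_inv_mul (1 / 2 + α / 2)] at this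
    rw [one_div (2 ^ k)]
    linarith

/-- The interval `[0, 1 + α]` is longer than `1`: for `f ≤ α` it contains both `f` and `f + 1`, so
the estimate and its predecessor are both admissible. -/
theorem isCentered_of_ne_zero {n M : ℕ} {α a f : ℝ} {w : ℤ} (hf0 : 0 ≤ f) (hf1 : f ≤ 1 + α)
    (h : 2 ^ n * a = M + f + 2 ^ n * w) {k : ℕ} (hk : k ≠ 0) : IsCentered n α a M k := by
  refine ⟨f, w, h, ?_⟩
  rw [ampGap, if_neg hk]
  have h4 : |f - (1 + α) / 2| ≤ 1 / 2 + α / 2 := by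
    rw [abs_le]; constructor <;> linarith
  have := div_le_div_of_nonneg_right h4 (by positivity : (0 : ℝ) ≤ 2 ^ k)
  rw [div_eq_inv_mul (1 / 2 + α / 2)] at this
  rw [one_div (2 ^ k)]
  linarith

theorem RoundingPromise.lt_mul {d n : ℕ} {α : ℝ} {lam : Fin d → ℝ}
    (h : RoundingPromise n α lam) {j : Fin d} (h0 : 0 ≤ lam j) (h1 : lam j < 1) :
    estimate n (lam j) + α < 2 ^ n * lam j := by
  by_contra hcon
  push Not at hcon
  apply h j (estimate n (lam j)) (estimate_lt h0 h1).le
  have h2 : (0 : ℝ) < 2 ^ n := by positivity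
  constructor
  · rw [div_le_iff₀ h2, mul_comm]; exact estimate_le h0
  · rw [← add_div, le_div_iff₀ h2, mul_comm]; exact hcon

/-! ### The iterative estimator -/

theorem isIterativePhaseEstimatorWithPhases_bitProtocol (hgl : Discriminates g l) :
    IsIterativePhaseEstimatorWithPhases (bitProtocol g l) := by
  intro n α k δ h0 h1 hk hδ d U lam ψ hU hR
  set c := bitProtocol g l n α k δ with hc
  set x : Fin d → Reg (k + 1) := fun j =>
    Fin.snoc (α := fun _ => Bool) (bits k (estimate n (lam j))) false with hx
  have hxs : ∀ j b, Function.update (x j) (Fin.last k) b =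
      Fin.snoc (α := fun _ => Bool) (bits k (estimate n (lam j))) b := by
    intro j b
    ext i
    refine Fin.lastCases ?_ (fun i => ?_) i
    · simp [hx]
    · simp [hx, (Fin.castSucc_lt_last i).ne]
  have hstep : ∀ j, ∃ u : ℂ, ‖u‖ = 1 ∧
      vnorm (c.act (eigenvalue (lam j)) *ᵥ ket (x j) -
        u • ket (Function.update (x j) (Fin.last k) ((estimate n (lam j)).testBit k))) ≤ δ / 8 ∧
      ∃ r : ℝ, 0 ≤ r ∧ star (u • ket (Function.update (x j) (Fin.last k)
        ((estimate n (lam j)).testBit k))) ⬝ᵥ (c.act (eigenvalue (lam j)) *ᵥ ket (x j)) = r := by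
    intro j
    obtain ⟨hl0, hl1⟩ := hU.1 j
    exact act_bit_near hgl h0 h1 hδ (Function.Embedding.refl _) (by simp [hx])
      (fun i => by simp [hx, bits]) hk (isCentered_of_le h0 hl0 (hR.lt_mul hl0 hl1).le k)
  choose u hu hnear hreal using hstep
  obtain ⟨T, hT, hT'⟩ := Circuit.exists_unitary_near hU c (x := fun j => ket (x j))
    (by positivity) (by linarith : 8 * (δ / 8) ≤ δ) (fun j => vnorm_ket _)
    (fun j => vnorm_smul_ket (hu j) _) hreal hnear
  refine ⟨fun j => (u j).arg, T, fun j => ?_, hT'⟩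
  have e : Complex.exp (Complex.I * (u j).arg) = u j := by
    have := Complex.norm_mul_exp_arg_mul_I (u j)
    rwa [hu j, Complex.ofReal_one, one_mul, mul_comm] at this
  rw [e]
  refine (hT j).trans ?_
  rw [hxs]
  ext a
  simp [tensor, mul_assoc]

/-! ### The chained circuits -/

/-- The circuit for bit `k` in the chain. -/
noncomputable def chainStep (E : IterativeProtocol) (n : ℕ) (α δ : ℝ) (k : Fin n) : Circuit n :=
  Circuit.onQubits (Fin.castLEEmb k.isLt) (E n α k (δ / 2 ^ ((k : ℕ) + 1)))

/-- The chained circuits from bit `j` on. -/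
noncomputable def chainFrom (E : IterativeProtocol) (n : ℕ) (α δ : ℝ) (j : ℕ) : Circuit n :=
  ((List.finRange n).drop j).flatMap (chainStep E n α δ)

theorem stitch_eq_chainFrom (E : IterativeProtocol) (n : ℕ) (α δ : ℝ) :
    stitch E n α δ = chainFrom E n α δ 0 := rfl

theorem chainFrom_of_lt (E : IterativeProtocol) {n j : ℕ} (α δ : ℝ) (hj : j < n) :
    chainFrom E n α δ j = chainStep E n α δ ⟨j, hj⟩ ++ chainFrom E n α δ (j + 1) := by
  have : j < (List.finRange n).length := by simpa using hj
  rw [chainFrom, List.drop_eq_getElem_cons this, List.flatMap_cons]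
  simp [chainFrom]

/-- The register that holds the `j` least significant bits of `M`. -/
def lowBits (n j M : ℕ) : Reg n := fun i => if (i : ℕ) < j then M.testBit i else false

theorem lowBits_zero (n M : ℕ) : lowBits n 0 M = fun _ => false := by
  ext i; simp [lowBits]

theorem lowBits_self (n M : ℕ) : lowBits n n M = bits n M := by
  ext i; simp [lowBits, bits]

theorem update_lowBits {n j : ℕ} (hj : j < n) (M : ℕ) :
    Function.update (lowBits n j M) ⟨j, hj⟩ (M.testBit j) = lowBits n (j + 1) M := by
  ext i
  by_cases h : i = ⟨j, hj⟩
  · subst h; simp [lowBits]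
  · rw [Function.update_of_ne h]
    have : (i : ℕ) ≠ j := fun h' => h (Fin.ext h')
    simp only [lowBits]
    congr 1
    apply propext
    omega

theorem castLEEmb_last {j : ℕ} (hj : j < n) :
    (Fin.castLEEmb hj : Fin (j + 1) ↪ Fin n) (Fin.last j) = ⟨j, hj⟩ := rfl

theorem chainStep_near (hgl : Discriminates g l) {α δ : ℝ} (h0 : 0 < α) (h1 : α < 1) (hδ : 0 < δ)
    {j : ℕ} (hj : j < n) {lam : ℝ} {M : ℕ} (hc : IsCentered n α lam M j) :
    ∃ u : ℂ, ‖u‖ = 1 ∧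
      vnorm ((chainStep (bitProtocol g l) n α δ ⟨j, hj⟩).act (eigenvalue lam) *ᵥ
        ket (lowBits n j M) - u • ket (lowBits n (j + 1) M)) ≤ δ / 2 ^ (j + 1) / 8 := by
  obtain ⟨u, hu, h, -⟩ := act_bit_near (n := n) (k := j) hgl h0 h1
    (by positivity : 0 < δ / 2 ^ (j + 1)) (Fin.castLEEmb hj) (lam := lam) (x := lowBits n j M)
    (by simp [lowBits]) (M := M) (fun i => by simp [lowBits]) hj hc
  rw [castLEEmb_last, update_lowBits] at h
  refine ⟨u, hu, ?_⟩
  rw [chainStep, onQubits_bitProtocol]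
  exact h

/-- Later steps are isometries, so errors add up along a geometric series. Starting at any `j`
matters: without a promise only the steps from `1` on are under control. -/
theorem chainFrom_near (hgl : Discriminates g l) {α δ : ℝ} (h0 : 0 < α) (h1 : α < 1) (hδ : 0 < δ)
    {lam : ℝ} {M j : ℕ} (hj : j ≤ n) (hc : ∀ i, j ≤ i → IsCentered n α lam M i) :
    ∃ u : ℂ, ‖u‖ = 1 ∧
      vnorm ((chainFrom (bitProtocol g l) n α δ j).act (eigenvalue lam) *ᵥ
        ket (lowBits n j M) - u • ket (bits n M)) ≤ δ / 2 ^ j / 8 := by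
  induction hj using Nat.decreasingInduction with
  | self =>
    refine ⟨1, by simp, ?_⟩
    have : chainFrom (bitProtocol g l) n α δ n = [] := by
      rw [chainFrom, List.drop_eq_nil_of_le (by simp)]; rfl
    rw [this, Circuit.act, one_mulVec, lowBits_self, one_smul, sub_self]
    simp only [vnorm, WithLp.toLp_zero, norm_zero]
    positivity
  | of_succ j hj ih =>
    obtain ⟨u, hu, h⟩ := ih fun i hi => hc i (by omega)
    obtain ⟨u', hu', h'⟩ := chainStep_near hgl h0 h1 hδ hj (hc j le_rfl)
    refine ⟨u' * u, by rw [norm_mul, hu, hu', one_mul], ?_⟩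
    rw [chainFrom_of_lt _ α δ hj, Circuit.act_append, ← mulVec_mulVec]
    set A := (chainFrom (bitProtocol g l) n α δ (j + 1)).act (eigenvalue lam)
    set w := (chainStep (bitProtocol g l) n α δ ⟨j, hj⟩).act (eigenvalue lam) *ᵥ
      ket (lowBits n j M)
    have e : A *ᵥ w - (u' * u) • ket (bits n M) =
        A *ᵥ (w - u' • ket (lowBits n (j + 1) M)) +
          u' • (A *ᵥ ket (lowBits n (j + 1) M) - u • ket (bits n M)) := by
      rw [mulVec_sub, mulVec_smul]; module
    rw [e]
    refine (vnorm_add_le _ _).trans ?_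
    rw [vnorm_mulVec_of_isometry (Circuit.act_isometry (norm_eigenvalue lam) _), vnorm_smul, hu',
      one_mul]
    calc _ ≤ δ / 2 ^ (j + 1) / 8 + δ / 2 ^ (j + 1) / 8 := add_le_add h' h
      _ = δ / 2 ^ j / 8 := by rw [pow_succ]; field_simp; norm_num

theorem isPhaseEstimatorWithPhases_stitch (hgl : Discriminates g l) :
    IsPhaseEstimatorWithPhases (stitch (bitProtocol g l)) := by
  intro n α δ _ h0 h1 hδ d U lam ψ hU hR
  have hstep : ∀ j, ∃ u : ℂ, ‖u‖ = 1 ∧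
      vnorm ((stitch (bitProtocol g l) n α δ).act (eigenvalue (lam j)) *ᵥ ket (fun _ => false) -
        u • ket (bits n (estimate n (lam j)))) ≤ δ / 8 := by
    intro j
    obtain ⟨hl0, hl1⟩ := hU.1 j
    have := chainFrom_near hgl h0 h1 hδ (Nat.zero_le n) fun i _ =>
      isCentered_of_le h0 hl0 (hR.lt_mul hl0 hl1).le i
    rwa [lowBits_zero, pow_zero, div_one, ← stitch_eq_chainFrom] at this
  choose u hu hnear using hstep
  refine ⟨fun j => (u j).arg, ?_⟩
  have e : ∀ j, Complex.exp (Complex.I * (u j).arg) = u j := by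
    intro j
    have := Complex.norm_mul_exp_arg_mul_I (u j)
    rwa [hu j, Complex.ofReal_one, one_mul, mul_comm] at this
  simp only [e]
  exact Circuit.diamondNorm_isometry_sub_targetMap_le hU _ (by positivity)
    (by linarith : 2 * (δ / 8) ≤ δ) (fun j => vnorm_smul_ket (hu j) _) hnear

/-- The estimate below `M`, cyclically. -/
theorem exists_pred_mod (M : ℕ) (hM : M < 2 ^ n) :
    ∃ w : ℤ, (M : ℝ) = ((M + (2 ^ n - 1)) % 2 ^ n : ℕ) + 1 + 2 ^ n * w := by
  have h2 : 1 ≤ 2 ^ n := Nat.one_le_two_pow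
  rcases Nat.eq_zero_or_pos M with rfl | hpos
  · refine ⟨-1, ?_⟩
    rw [zero_add, Nat.mod_eq_of_lt (by omega)]
    push_cast [h2]
    ring
  · refine ⟨0, ?_⟩
    have : M + (2 ^ n - 1) = (M - 1) + 2 ^ n := by omega
    rw [this, Nat.add_mod_right, Nat.mod_eq_of_lt (by omega)]
    push_cast [hpos]
    ring

/-- As `2 ^ n` is even, the parity flips even across the wrap-around; the two candidates separate at
the very first bit. -/
theorem testBit_zero_pred_mod (hn : 1 ≤ n) (M : ℕ) :
    ((M + (2 ^ n - 1)) % 2 ^ n).testBit 0 = !M.testBit 0 := by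
  obtain ⟨m, rfl⟩ := Nat.exists_eq_add_of_le' hn
  rw [Nat.testBit_zero, Nat.testBit_zero, Nat.mod_mod_of_dvd _ (by exact dvd_pow_self 2 (by omega))]
  have h : 2 ^ (m + 1) = 2 * 2 ^ m := pow_succ' 2 m
  have h2 : 1 ≤ 2 ^ m := Nat.one_le_two_pow
  rcases Nat.mod_two_eq_zero_or_one M with h' | h' <;> rw [h']
  · have : (M + (2 ^ (m + 1) - 1)) % 2 = 1 := by omega
    simp [this]
  · have : (M + (2 ^ (m + 1) - 1)) % 2 = 0 := by omega
    simp [this]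

theorem exists_amplitudes (hgl : Discriminates g l) {α δ : ℝ} (hn : 1 ≤ n) (h0 : 0 < α)
    (h1 : α < 1) (hδ : 0 < δ) {a : ℝ} (ha0 : 0 ≤ a) (ha1 : a < 1) :
    ∃ ξ ζ : ℂ, ‖ξ‖ ^ 2 + ‖ζ‖ ^ 2 = 1 ∧
      vnorm ((stitch (bitProtocol g l) n α δ).act (eigenvalue a) *ᵥ ket (fun _ => false) -
        (ξ • ket (bits n (estimate n a)) +
          ζ • ket (bits n ((estimate n a + (2 ^ n - 1)) % 2 ^ n)))) ≤ δ / 8 := by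
  set M := estimate n a with hM
  set M' := (M + (2 ^ n - 1)) % 2 ^ n with hM'
  rw [stitch_eq_chainFrom]
  rcases le_or_gt ((M : ℝ) + α) (2 ^ n * a) with hle | hlt
  · obtain ⟨u, hu, h⟩ := chainFrom_near hgl h0 h1 hδ (Nat.zero_le n) fun i _ =>
      isCentered_of_le h0 ha0 hle i
    refine ⟨u, 0, by simp [hu], ?_⟩
    rw [zero_smul, add_zero]
    rwa [lowBits_zero, pow_zero, div_one, ← hM] at h
  · have hMa := estimate_le (n := n) ha0
    rw [← hM] at hMa
    have hc : ∀ i, 1 ≤ i → IsCentered n α a M i := fun i hi =>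
      isCentered_of_ne_zero (f := 2 ^ n * a - M) (w := 0) (by linarith) (by linarith)
        (by simp) (by omega)
    have hc' : ∀ i, 1 ≤ i → IsCentered n α a M' i := fun i hi => by
      obtain ⟨w, hw⟩ := exists_pred_mod M (estimate_lt ha0 ha1)
      exact isCentered_of_ne_zero (f := 2 ^ n * a - M + 1) (w := w) (by linarith) (by linarith)
        (by linarith) (by omega)
    obtain ⟨u, hu, h⟩ := chainFrom_near hgl h0 h1 hδ hn hc
    obtain ⟨u', hu', h'⟩ := chainFrom_near hgl h0 h1 hδ hn hc'
    -- Nothing is known about the amplitudes after step `0`, but the two values of bit `0` are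
    -- exactly those of `M` and `M'`; which is which depends on the parity of `M`.
    obtain ⟨ξ, ζ, hn1, hact⟩ : ∃ ξ ζ : ℂ, ‖ξ‖ ^ 2 + ‖ζ‖ ^ 2 = 1 ∧
        (chainStep (bitProtocol g l) n α δ ⟨0, hn⟩).act (eigenvalue a) *ᵥ ket (fun _ => false) =
          ξ • ket (lowBits n 1 M) + ζ • ket (lowBits n 1 M') := by
      obtain ⟨p, q, hpq, hact, -⟩ := act_bit (n := n) (k := 0) hgl h0 h1
        (by positivity : 0 < δ / 2 ^ (0 + 1)) (Fin.castLEEmb hn) a (x := fun _ : Fin n => false) rfl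
      have e1 : ∀ m : ℕ, lowBits n 1 m =
          Function.update (fun _ => false) ⟨0, hn⟩ (m.testBit 0) := fun m => by
        rw [← update_lowBits hn, lowBits_zero]
      have e2 : Function.update (fun _ : Fin n => false) ⟨0, hn⟩ false = fun _ => false := by
        simp
      rw [e1, e1, testBit_zero_pred_mod hn, chainStep, onQubits_bitProtocol]
      cases hb : M.testBit 0
      · refine ⟨p, q, hpq, ?_⟩
        rw [e2]; exact hact
      · refine ⟨q, p, (add_comm _ _).trans hpq, ?_⟩
        rw [Bool.not_true, e2]; exact hact.trans (add_comm _ _)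
    refine ⟨ξ * u, ζ * u', by rw [norm_mul, norm_mul, hu, hu', mul_one, mul_one]; exact hn1, ?_⟩
    rw [chainFrom_of_lt _ α δ hn, Circuit.act_append, ← mulVec_mulVec, hact]
    set A := (chainFrom (bitProtocol g l) n α δ (0 + 1)).act (eigenvalue a)
    have e : A *ᵥ (ξ • ket (lowBits n 1 M) + ζ • ket (lowBits n 1 M')) -
        ((ξ * u) • ket (bits n M) + (ζ * u') • ket (bits n M')) =
        ξ • (A *ᵥ ket (lowBits n 1 M) - u • ket (bits n M)) +
        ζ • (A *ᵥ ket (lowBits n 1 M') - u' • ket (bits n M')) := by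
      rw [mulVec_add, mulVec_smul, mulVec_smul]; module
    rw [e]
    refine (vnorm_add_le _ _).trans ?_
    rw [vnorm_smul, vnorm_smul]
    have hξ : ‖ξ‖ ≤ 1 := by nlinarith [sq_nonneg ‖ζ‖, norm_nonneg ξ]
    have hζ : ‖ζ‖ ≤ 1 := by nlinarith [sq_nonneg ‖ξ‖, norm_nonneg ζ]
    -- From bit `1` on each branch has error at most `δ / 2 / 8`, so bounding both weights by `1`
    -- still gives `δ / 8`.
    rw [pow_one] at h h'
    have b1 := mul_le_mul hξ h (vnorm_nonneg _) zero_le_one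
    have b2 := mul_le_mul hζ h' (vnorm_nonneg _) zero_le_one
    refine (add_le_add b1 b2).trans ?_
    linarith

theorem exists_amplitudes_diamondNorm (hgl : Discriminates g l) (hn : 1 ≤ n) {α δ : ℝ}
    (h0 : 0 < α) (h1 : α < 1) (hδ : 0 < δ) {d : ℕ} {U : Matrix (Fin d) (Fin d) ℂ}
    {lam : Fin d → ℝ} {ψ : OrthonormalBasis (Fin d) ℂ (EuclideanSpace ℂ (Fin d))}
    (hU : IsPhaseDecomposition U lam ψ) :
    ∃ ξ ζ : Fin d → ℂ, (∀ j, ‖ξ j‖ ^ 2 + ‖ζ j‖ ^ 2 = 1) ∧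
      diamondNorm (conjMap ((stitch (bitProtocol g l) n α δ).isometry U) -
        conjMap (targetMap ψ fun j => ξ j • ket (bits n (estimate n (lam j))) +
          ζ j • ket (bits n ((estimate n (lam j) + (2 ^ n - 1)) % 2 ^ n)))) ≤
        ENNReal.ofReal δ := by
  choose ξ ζ hn1 hnear using fun j =>
    exists_amplitudes hgl hn h0 h1 hδ (hU.1 j).1 (hU.1 j).2
  refine ⟨ξ, ζ, hn1, Circuit.diamondNorm_isometry_sub_targetMap_le hU _ (by positivity)
    (by linarith : 2 * (δ / 8) ≤ δ) (fun j => vnorm_add_kets (hn1 j) ?_) hnear⟩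
  intro h
  have := congrFun h ⟨0, hn⟩
  simp only [bits] at this
  rw [testBit_zero_pred_mod hn] at this
  cases hb : (estimate n (lam j)).testBit 0 <;> rw [hb] at this <;> simp at this

/-! ### Query complexity -/

/-- The factor `5` is `log (16 / δ) = 4 log 2 + log δ⁻¹ ≤ 5 log δ⁻¹`, valid for `δ ≤ 1 / 2`. -/
theorem queries_bitProtocol_le {K : ℝ} (hK : 0 < K)
    (hl : ∀ η ε : ℝ, 0 < η → η ≤ 1 → 0 < ε → ε ≤ 1 / 2 →
      ((l η ε).length : ℝ) ≤ K * (η⁻¹ * Real.log ε⁻¹))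
    {α δ : ℝ} (h0 : 0 < α) (h1 : α < 1) (hk : k < n) (hδ : 0 < δ) (hδ1 : δ ≤ 1 / 2) :
    ((bitProtocol g l n α k δ).queries : ℝ) ≤
      5 * K * (2 ^ (n - k) * (ampGap α k)⁻¹ * Real.log δ⁻¹) := by
  have hη := ampGap_pos h0 h1 k
  have h := hl (ampGap α k) (gateError δ) hη (by linarith [ampGap_le_half h0 h1 k])
    (gateError_pos hδ) gateError_le_half
  rw [bitProtocol, queries_bitCircuit]
  have hlog : Real.log (gateError δ)⁻¹ ≤ 5 * Real.log δ⁻¹ := by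
    have e : (gateError δ)⁻¹ = 2 ^ 4 * δ⁻¹ := by
      rw [gateError, min_eq_left hδ1, inv_div]; ring
    have h2 : Real.log 2 ≤ Real.log δ⁻¹ := by
      apply Real.log_le_log (by norm_num)
      rw [le_inv_comm₀ (by norm_num) hδ]; linarith
    rw [e, Real.log_mul (by norm_num) (by positivity), Real.log_pow]
    push_cast
    linarith
  have hpow : ((signalPower n k : ℕ) : ℝ) ≤ 2 ^ (n - k) := by
    rw [signalPower]
    push_cast
    exact pow_le_pow_right₀ (by norm_num) (by omega)
  have hlδ : 0 ≤ Real.log δ⁻¹ := Real.log_nonneg (by rw [one_le_inv₀ hδ]; linarith)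
  push_cast
  calc _ ≤ (K * ((ampGap α k)⁻¹ * (5 * Real.log δ⁻¹))) * 2 ^ (n - k) := by
        refine mul_le_mul (h.trans ?_) hpow (by positivity) (by positivity)
        gcongr
    _ = _ := by ring

theorem queries_stitch (E : IterativeProtocol) (n : ℕ) (α δ : ℝ) :
    (stitch E n α δ).queries =
      ∑ k ∈ Finset.range n, (E n α k (δ / 2 ^ (k + 1))).queries := by
  have h : ∀ L : List (Fin n), Circuit.queries (L.flatMap fun k : Fin n =>
      Circuit.onQubits (Fin.castLEEmb k.isLt) (E n α k (δ / 2 ^ ((k : ℕ) + 1)))) =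
      (L.map fun k : Fin n => (E n α k (δ / 2 ^ ((k : ℕ) + 1))).queries).sum := by
    intro L
    induction L with
    | nil => simp [Circuit.queries]
    | cons k L ih =>
      rw [List.flatMap_cons, queries_append, ih, queries_onQubits, List.map_cons, List.sum_cons]
  rw [stitch, h, ← Fin.sum_univ_def, Finset.sum_range]

theorem sum_succ_div_two_pow (n : ℕ) :
    ∑ k ∈ Finset.range n, ((k : ℝ) + 1) / 2 ^ k = 4 - (2 * n + 4) / 2 ^ n := by
  induction n with
  | zero => norm_num
  | succ n ih =>
    rw [Finset.sum_range_succ, ih, pow_succ]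
    push_cast
    field_simp
    ring

/-- Among `k ≥ 1` the smallest gap is `(1 - α) / 4 ≥ c / 4`, at `k = 1`. This is where `α` must stay
away from `1`. -/
theorem inv_ampGap_le {α c : ℝ} (h0 : 0 < α) (hc : 0 < c) (hα : α ≤ 1 - c) (k : ℕ) :
    (ampGap α k)⁻¹ ≤ 4 / c * α⁻¹ := by
  have h : c * α / 4 ≤ ampGap α k := by
    rw [ampGap]
    split_ifs with hk
    · nlinarith
    · have : (1 : ℝ) / 2 ^ k ≤ 1 / 2 := by
        rw [div_le_div_iff₀ (by positivity) (by norm_num), one_mul, one_mul]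
        calc (2 : ℝ) = 2 ^ 1 := by norm_num
          _ ≤ 2 ^ k := pow_le_pow_right₀ (by norm_num) (Nat.one_le_iff_ne_zero.2 hk)
      nlinarith
  calc (ampGap α k)⁻¹ ≤ (c * α / 4)⁻¹ := inv_anti₀ (by positivity) h
    _ = _ := by rw [inv_div, div_mul_eq_div_div_swap]; field_simp

theorem queries_stitch_le {E : IterativeProtocol} {C : ℝ} (hC : 0 < C)
    (hE : ∀ (n : ℕ) (α : ℝ) (k : ℕ) (δ : ℝ), 0 < α → α < 1 → k < n → 0 < δ → δ ≤ 1 / 2 →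
      ((E n α k δ).queries : ℝ) ≤ C * (2 ^ (n - k) * (ampGap α k)⁻¹ * Real.log δ⁻¹))
    {c : ℝ} (hc : 0 < c) : ∃ C' : ℝ, 0 < C' ∧ ∀ (n : ℕ) (α δ : ℝ),
      1 ≤ n → 0 < α → α ≤ 1 - c → 0 < δ → δ ≤ 1 - c →
      ((stitch E n α δ).queries : ℝ) ≤ C' * (2 ^ n * α⁻¹ * Real.log δ⁻¹) := by
  rcases le_or_gt 1 c with hc1 | hc1
  · exact ⟨1, one_pos, fun n α δ _ h0 hα => by linarith⟩
  set L := Real.log (1 - c)⁻¹ with hL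
  have hL0 : 0 < L := Real.log_pos (by rw [one_lt_inv₀ (by linarith)]; linarith)
  set D := 1 + L⁻¹ with hD
  refine ⟨C * (4 / c) * D * 4, by positivity, fun n α δ hn h0 hα hδ hδ1 => ?_⟩
  set Λ := Real.log δ⁻¹ with hΛ
  have hΛL : L ≤ Λ := Real.log_le_log (by rw [inv_pos]; linarith) (inv_anti₀ hδ hδ1)
  have hΛ0 : 0 < Λ := by linarith
  have hlog : ∀ k : ℕ, Real.log (δ / 2 ^ (k + 1))⁻¹ ≤ (k + 1) * (D * Λ) := by
    intro k
    rw [inv_div, div_eq_mul_inv, Real.log_mul (by positivity) (by positivity), Real.log_pow]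
    have h2 : Real.log 2 ≤ 1 := by have := Real.log_two_lt_d9; linarith
    have h3 : 1 ≤ L⁻¹ * Λ := by
      rw [inv_mul_eq_div, one_le_div hL0]; exact hΛL
    have h4 : Real.log 2 + Λ ≤ D * Λ := by
      rw [hD, add_mul, one_mul]; linarith
    have hk : (0 : ℝ) ≤ k := Nat.cast_nonneg k
    push_cast
    rw [← hΛ]
    nlinarith
  rw [queries_stitch]
  push_cast
  calc ∑ k ∈ Finset.range n, ((E n α k (δ / 2 ^ (k + 1))).queries : ℝ)
      ≤ ∑ k ∈ Finset.range n, (C * (4 / c) * D * (2 ^ n * α⁻¹ * Λ)) * ((k + 1) / 2 ^ k) := by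
        refine Finset.sum_le_sum fun k hk => ?_
        have hkn := Finset.mem_range.1 hk
        have hsmall : δ / 2 ^ (k + 1) ≤ 1 / 2 := by
          rw [pow_succ, div_le_iff₀ (by positivity)]
          have : (1 : ℝ) ≤ 2 ^ k := one_le_pow₀ (by norm_num)
          linarith
        refine (hE n α k _ h0 (by linarith) hkn (by positivity) hsmall).trans ?_
        have hp : (2 : ℝ) ^ (n - k) = 2 ^ n / 2 ^ k := by
          rw [eq_div_iff (by positivity), ← pow_add]; congr 1; omega
        have hlog0 : 0 ≤ Real.log (δ / 2 ^ (k + 1))⁻¹ := by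
          apply Real.log_nonneg
          rw [one_le_inv₀ (by positivity)]; linarith
        rw [hp]
        calc C * (2 ^ n / 2 ^ k * (ampGap α k)⁻¹ * Real.log (δ / 2 ^ (k + 1))⁻¹)
            ≤ C * (2 ^ n / 2 ^ k * (4 / c * α⁻¹) * ((k + 1) * (D * Λ))) := by
              refine mul_le_mul_of_nonneg_left ?_ hC.le
              refine mul_le_mul (mul_le_mul_of_nonneg_left (inv_ampGap_le h0 hc hα k)
                (by positivity)) (hlog k) hlog0 (by positivity)
          _ = _ := by ring
    _ ≤ (C * (4 / c) * D * (2 ^ n * α⁻¹ * Λ)) * 4 := by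
        rw [← Finset.mul_sum, sum_succ_div_two_pow]
        refine mul_le_mul_of_nonneg_left ?_ (by positivity)
        have : (0 : ℝ) ≤ (2 * n + 4) / 2 ^ n := by positivity
        linarith
    _ = _ := by ring

end Estimator

end QPE

theorem mainTheorem2 :
    ∃ E : QPE.IterativeProtocol,
      -- `E` is a coherent iterative phase estimator with phases, making
      -- `O(2 ^ (n - k) * η⁻¹ * log δ⁻¹)` queries for bit `k`
      QPE.IsIterativePhaseEstimatorWithPhases E ∧
      (∃ C : ℝ, 0 < C ∧ ∀ (n : ℕ) (α : ℝ) (k : ℕ) (δ : ℝ),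
        0 < α → α < 1 → k < n → 0 < δ → δ ≤ 1 / 2 →
        ((E n α k δ).queries : ℝ) ≤
          C * (2 ^ (n - k) * (QPE.ampGap α k)⁻¹ * Real.log δ⁻¹)) ∧
      -- the chained circuits form a phase estimator with phases
      QPE.IsPhaseEstimatorWithPhases (QPE.stitch E) ∧
      -- its query complexity, for `α` (and `δ`) bounded away from `1`
      (∀ c : ℝ, 0 < c → ∃ C : ℝ, 0 < C ∧ ∀ (n : ℕ) (α δ : ℝ),
        1 ≤ n → 0 < α → α ≤ 1 - c → 0 < δ → δ ≤ 1 - c →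
        ((QPE.stitch E n α δ).queries : ℝ) ≤ C * (2 ^ n * α⁻¹ * Real.log δ⁻¹)) ∧
      -- the behaviour of the same circuits without a rounding promise
      (∀ (n : ℕ) (α δ : ℝ), 1 ≤ n → 0 < α → α < 1 → 0 < δ →
        ∀ (d : ℕ) (U : Matrix (Fin d) (Fin d) ℂ) (lam : Fin d → ℝ)
          (ψ : OrthonormalBasis (Fin d) ℂ (EuclideanSpace ℂ (Fin d))),
          QPE.IsPhaseDecomposition U lam ψ →
          ∃ ξ ζ : Fin d → ℂ,
            (∀ j, ‖ξ j‖ ^ 2 + ‖ζ j‖ ^ 2 = 1) ∧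
            QPE.diamondNorm (QPE.conjMap ((QPE.stitch E n α δ).isometry U) -
              QPE.conjMap (QPE.targetMap ψ fun j =>
                ξ j • QPE.ket (QPE.bits n (QPE.estimate n (lam j))) +
                ζ j • QPE.ket (QPE.bits n
                  ((QPE.estimate n (lam j) + (2 ^ n - 1)) % 2 ^ n)))) ≤
            ENNReal.ofReal δ) := by
  obtain ⟨K, g, l, hK, hgl, hl⟩ := QPE.exists_discriminates
  have hq : ∀ (n : ℕ) (α : ℝ) (k : ℕ) (δ : ℝ), 0 < α → α < 1 → k < n → 0 < δ → δ ≤ 1 / 2 →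
      ((QPE.bitProtocol g l n α k δ).queries : ℝ) ≤
        5 * K * (2 ^ (n - k) * (QPE.ampGap α k)⁻¹ * Real.log δ⁻¹) :=
    fun n α k δ h0 h1 hk hδ hδ1 => QPE.queries_bitProtocol_le hK hl h0 h1 hk hδ hδ1
  exact ⟨QPE.bitProtocol g l, QPE.isIterativePhaseEstimatorWithPhases_bitProtocol hgl,
    ⟨5 * K, by positivity, hq⟩, QPE.isPhaseEstimatorWithPhases_stitch hgl,
    fun c hc => QPE.queries_stitch_le (by positivity) hq hc,
    fun n α δ hn h0 h1 hδ d U lam ψ hU =>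
      QPE.exists_amplitudes_diamondNorm hgl hn h0 h1 hδ hU⟩
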